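/- Let $H$ be a real Hilbert space with a complete orthonormal basis $(e_k)_{k\ge1}$, and let $A$ be a self-adjoint operator on $H$ with $Ae_k=-\lambda_ke_k$, where $0<\lambda_1\le\lambda_2\le\cdots$ and $\lambda_k\to\infty$, generating the strongly continuous semigroup $(e^{tA})_{t\ge0}$. Let $1\le p<\alpha<2$ with $\alpha>1$. Let $\mathscr P_p$ be the set of Borel probability measures $\mu$ on $H$ with $\mu(|\cdot|^p):=\int|x|^p\mu(dx)<\infty$, with the $L^p$-Wasserstein distance $\mathbb W_p$. On a filtered probability space $(\Omega,\mathcal F,(\mathcal F_t)_{t\ge0},\mathbb P)$ let $L_t=\sum_k\beta_kL^k_te_k$ and $Z_t=\sum_k\gamma_kZ^k_te_k$ ($\beta_k,\gamma_k>0$) be two mutually independent adapted cylindrical $\alpha$-stable processes: $(L^k)_k$ and $(Z^k)_k$ are sequences of independent one-dimensional symmetric $\alpha$-stable Lévy processes with $\mathbb E e^{ihL^k_t}=\mathbb E e^{ihZ^k_t}=e^{-t|h|^\alpha}$. Stochastic convolutions are defined coordinatewise: $\int_0^te^{(t-s)A}dL_s=\sum_k\beta_k\int_0^te^{(t-s)A}e_k\,dL^k_s$,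 and likewise for $Z$. Let $F,G:H\times\mathscr P_p\times H\to H$ and constants $C,L_G>0$ satisfy, for all $x_i,y_i\in H$, $\mu_i\in\mathscr P_p$, $$|F(x_1,\mu_1,y_1)-F(x_2,\mu_2,y_2)|\le C\big[|x_1-x_2|+\mathbb W_p(\mu_1,\mu_2)+|y_1-y_2|\big],$$ $$|G(x_1,\mu_1,y_1)-G(x_2,\mu_2,y_2)|\le C\big[|x_1-x_2|+\mathbb W_p(\mu_1,\mu_2)\big]+L_G|y_1-y_2|.$$ Suppose that there is $\theta\in(0,2/\alpha]$ with $\sum_k\beta_k^\alpha\lambda_k^{-(1-\alpha\theta/2)}<\infty$, that $\sum_k\gamma_k^\alpha/\lambda_k<\infty$, that $\lambda_1>L_G$, and that $\sup_{x,y\in H}|F(x,\mu,y)|\le C'[1+\mu(|\cdot|^p)^{1/p}]$ for all $\mu\in\mathscr P_p$ and some constant $C'$. For $B:H\times\mathscr P_p\to H$ and an $\mathcal F_0$-measurable $\xi$ with $\mathbb E|\xi|^p<\infty$, a mild solution of $dX_t=[AX_t+B(X_t,\mathscr L_{X_t})]dt+dL_t$, $X_0=\xi$, where $\mathscr L_{X_t}$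 denotes the law of $X_t$, is a predictable adapted $H$-valued process with $\sup_{t\le T}\mathbb E|X_t|^p<\infty$ for every $T$ such that, for every $t\ge0$, $\mathbb P$-a.s., $\int_0^t|e^{(t-s)A}B(X_s,\mathscr L_{X_s})|ds<\infty$ and $$X_t=e^{tA}\xi+\int_0^te^{(t-s)A}B(X_s,\mathscr L_{X_s})ds+\int_0^te^{(t-s)A}dL_s.$$ Uniqueness means that any two mild solutions $X,X'$ satisfy $X_t=X'_t$ $\mathbb P$-a.s. for every $t\ge0$. The same terminology is used with $Z$ in place of $L$. Theorem 3.8. (i) For all $x,y\in H$ and $\mu\in\mathscr P_p$ the frozen equation $dY_t=[AY_t+G(x,\mu,Y_t)]dt+dZ_t$, $Y_0=y$, has a unique mild solution $Y^{x,\mu,y}$; there is exactly one Borel probability measure $\nu^{x,\mu}$ on $H$ that is invariant for $P^{x,\mu}_t\varphi(y):=\mathbb E\varphi(Y^{x,\mu,y}_t)$, i.e. $\int P^{x,\mu}_t\varphi\,d\nu^{x,\mu}=\int\varphi\,d\nu^{x,\mu}$ for all $t\ge0$ and all bounded measurable $\varphi:H\to\mathbb R$; and $F(x,\mu,\cdot)$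 is $\nu^{x,\mu}$-integrable. (ii) The averaged coefficient $\bar F(x,\mu):=\int_HF(x,\mu,y)\,\nu^{x,\mu}(dy)$ is Lipschitz: there is a constant $K>0$ such that for all $x_1,x_2\in H$, $\mu_1,\mu_2\in\mathscr P_p$, $$|\bar F(x_1,\mu_1)-\bar F(x_2,\mu_2)|\le K\big[|x_1-x_2|+\mathbb W_p(\mu_1,\mu_2)\big].$$ (iii) For every $\mathcal F_0$-measurable $\xi$ with $\mathbb E|\xi|^p<\infty$, the averaged equation $d\bar X_t=[A\bar X_t+\bar F(\bar X_t,\mathscr L_{\bar X_t})]dt+dL_t$, $\bar X_0=\xi$, has a unique mild solution. -/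

import Mathlib

open MeasureTheory ProbabilityTheory Filter Topology
open scoped NNReal ENNReal

noncomputable section

/-- `S = (e^{tA})_{t ≥ 0}`: `S` is a strongly continuous semigroup of bounded operators on `H` whose
infinitesimal generator (with its full domain) is the unbounded operator `A`. -/
structure IsSemigroupGeneratedBy {H : Type*} [NormedAddCommGroup H] [InnerProductSpace ℝ H]
    (A : H →ₗ.[ℝ] H) (S : ℝ≥0 → H →L[ℝ] H) : Prop where
  map_zero : S 0 = ContinuousLinearMap.id ℝ H
  map_add : ∀ s t : ℝ≥0, S (s + t) = (S s).comp (S t)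
  continuous : ∀ x : H, Continuous fun t : ℝ≥0 => S t x
  generator : ∀ x y : H, (x, y) ∈ A.graph ↔
    Tendsto (fun h : ℝ≥0 => (h : ℝ)⁻¹ • (S h x - x)) (𝓝[>] 0) (𝓝 y)

/-- The set `𝒫_p` of Borel probability measures on `H` with finite `p`-th moment. -/
def Pp (H : Type*) [NormedAddCommGroup H] [MeasurableSpace H] (p : ℝ) : Type _ :=
  {μ : Measure H // IsProbabilityMeasure μ ∧ ∫⁻ x, ‖x‖ₑ ^ p ∂μ < ∞}

/-- `(μ(|·|^p))^{1/p}`. -/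
def Pp.momentNorm {H : Type*} [NormedAddCommGroup H] [MeasurableSpace H] {p : ℝ}
    (μ : Pp H p) : ℝ :=
  (∫ x, ‖x‖ ^ p ∂μ.1) ^ (1 / p)

/-- The `L^p`-Wasserstein distance: the infimum over all couplings `π` of `μ` and `ν`
of `(∫ |x - y|^p π(dx,dy))^{1/p}`. -/
def wassersteinDist {H : Type*} [NormedAddCommGroup H] [MeasurableSpace H] {p : ℝ}
    (μ ν : Pp H p) : ℝ :=
  (⨅ π ∈ {π : Measure (H × H) | π.fst = μ.1 ∧ π.snd = ν.1},
    (∫⁻ z, ‖z.1 - z.2‖ₑ ^ p ∂π) ^ (1 / p)).toReal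

/-- A standard one-dimensional symmetric `α`-stable Lévy process:
`ℓ₀ = 0`, independent and stationary increments, càdlàg paths, and
`𝔼 exp(i h ℓ_t) = exp(-t |h|^α)`. -/
structure IsSymmetricStableProcess {Ω : Type*} [MeasurableSpace Ω] (P : Measure Ω) (α : ℝ)
    (ℓ : ℝ≥0 → Ω → ℝ) : Prop where
  zero : ∀ᵐ ω ∂P, ℓ 0 ω = 0
  indep_increments : HasIndepIncrements ℓ P
  stationary_increments : ∀ s t : ℝ≥0,
    IdentDistrib (fun ω => ℓ (s + t) ω - ℓ s ω) (ℓ t) P P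
  char_fun : ∀ (t : ℝ≥0) (h : ℝ),
    ∫ ω, Complex.exp (Complex.I * ((ℓ t ω * h : ℝ) : ℂ)) ∂P
      = (Real.exp (-((t : ℝ) * |h| ^ α)) : ℂ)
  cadlag : ∀ᵐ ω ∂P, ∀ t : ℝ≥0,
    Tendsto (fun s => ℓ s ω) (𝓝[>] t) (𝓝 (ℓ t ω)) ∧
      ∃ a : ℝ, Tendsto (fun s => ℓ s ω) (𝓝[<] t) (𝓝 a)

/-- The coordinates `(L^k)_k` of a cylindrical `α`-stable process `L_t = ∑ₖ βₖ L^k_t eₖ`: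
independent symmetric `α`-stable processes, adapted to the filtration. (The series itself need not
converge in `H`, so the cylindrical process is given by its coordinates.) -/
structure IsCylindricalStable {Ω : Type*} [m : MeasurableSpace Ω] (P : Measure Ω)
    (ℱ : Filtration ℝ≥0 m) (α : ℝ) (L : ℕ → ℝ≥0 → Ω → ℝ) : Prop where
  stable : ∀ k, IsSymmetricStableProcess P α (L k)
  indep : iIndepFun (fun (k : ℕ) (ω : Ω) (t : ℝ≥0) => L k t ω) P
  adapted : ∀ k, Adapted ℱ (L k)

/-- The integral `∫₀ᵗ g(s) dℓ(s)` of a (smooth) deterministic `H`-valued function against a real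
càdlàg path: the limit of the left-point Riemann sums along the uniform partitions of `[0,t]`. -/
def pathIntegral {H : Type*} [NormedAddCommGroup H] [InnerProductSpace ℝ H]
    (g : ℝ≥0 → H) (ℓ : ℝ≥0 → ℝ) (t : ℝ≥0) : H :=
  limUnder atTop fun n : ℕ => ∑ i ∈ Finset.range (n + 1),
    (ℓ (t * (i + 1) / (n + 1)) - ℓ (t * i / (n + 1))) • g (t * i / (n + 1))

/-- The stochastic convolution `∫₀ᵗ e^{(t-s)A} dL_s = ∑ₖ βₖ ∫₀ᵗ e^{(t-s)A} eₖ dL^k_s`. -/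
def stochConvolution {Ω H : Type*} [NormedAddCommGroup H] [InnerProductSpace ℝ H]
    (S : ℝ≥0 → H →L[ℝ] H) (e : ℕ → H) (β : ℕ → ℝ) (L : ℕ → ℝ≥0 → Ω → ℝ)
    (t : ℝ≥0) (ω : Ω) : H :=
  ∑' k, β k • pathIntegral (fun s => S (t - s) (e k)) (fun s => L k s ω) t

/-- `X` is a mild solution of `dX = [A X + B(X, Law(X))] dt + dL`, `X₀ = ξ`, where `S = e^{·A}` and
`L = ∑ₖ βₖ L^k eₖ`: a predictable adapted process with locally bounded `p`-th moments satisfying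
`X_t = e^{tA} ξ + ∫₀ᵗ e^{(t-s)A} B(X_s, Law(X_s)) ds + ∫₀ᵗ e^{(t-s)A} dL_s` a.s. for each `t`. -/
structure IsMildSolution {Ω H : Type*} [m : MeasurableSpace Ω] [NormedAddCommGroup H]
    [InnerProductSpace ℝ H] [MeasurableSpace H] (P : Measure Ω) (ℱ : Filtration ℝ≥0 m)
    (S : ℝ≥0 → H →L[ℝ] H) (e : ℕ → H) (p : ℝ) (β : ℕ → ℝ) (L : ℕ → ℝ≥0 → Ω → ℝ)
    (B : H → Pp H p → H) (ξ : Ω → H) (X : ℝ≥0 → Ω → H) : Prop where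
  predictable : IsStronglyPredictable ℱ X
  adapted : Adapted ℱ X
  moment : ∀ T : ℝ≥0, ∃ M : ℝ≥0, ∀ t ≤ T, ∫⁻ ω, ‖X t ω‖ₑ ^ p ∂P ≤ M
  equation : ∃ law : ℝ≥0 → Pp H p, (∀ t, (law t).1 = P.map (X t)) ∧
    (∀ t : ℝ≥0, ∀ᵐ ω ∂P, IntervalIntegrable
      (fun s : ℝ => S (t - s.toNNReal) (B (X s.toNNReal ω) (law s.toNNReal))) volume 0 t) ∧
    ∀ t : ℝ≥0, ∀ᵐ ω ∂P, X t ω = S t (ξ ω)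
      + (∫ s in (0 : ℝ)..t, S (t - s.toNNReal) (B (X s.toNNReal ω) (law s.toNNReal)))
      + stochConvolution S e β L t ω

/-- `X` is a mild solution, and every mild solution is a modification of `X`. -/
def IsUniqueMildSolution {Ω H : Type*} [m : MeasurableSpace Ω] [NormedAddCommGroup H]
    [InnerProductSpace ℝ H] [MeasurableSpace H] (P : Measure Ω) (ℱ : Filtration ℝ≥0 m)
    (S : ℝ≥0 → H →L[ℝ] H) (e : ℕ → H) (p : ℝ) (β : ℕ → ℝ) (L : ℕ → ℝ≥0 → Ω → ℝ)
    (B : H → Pp H p → H) (ξ : Ω → H) (X : ℝ≥0 → Ω → H) : Prop :=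
  IsMildSolution P ℱ S e p β L B ξ X ∧
    ∀ X' : ℝ≥0 → Ω → H, IsMildSolution P ℱ S e p β L B ξ X' → ∀ t, X' t =ᵐ[P] X t

/-- `(P_t φ)(y) = 𝔼 φ(Y^y_t)` for a family of processes `Y^y` indexed by the starting point. -/
def transitionOp {Ω H : Type*} [MeasurableSpace Ω] (P : Measure Ω) (Y : H → ℝ≥0 → Ω → H)
    (t : ℝ≥0) (φ : H → ℝ) (y : H) : ℝ :=
  ∫ ω, φ (Y y t ω) ∂P

/-- `ρ` is an invariant probability measure of the operators `(P_t)_{t ≥ 0}`: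
`∫ P_t φ dρ = ∫ φ dρ` for all `t` and all bounded measurable `φ`. -/
def IsInvariantMeasure {H : Type*} [MeasurableSpace H] (Pt : ℝ≥0 → (H → ℝ) → H → ℝ)
    (ρ : Measure H) : Prop :=
  IsProbabilityMeasure ρ ∧ ∀ (t : ℝ≥0) (φ : H → ℝ), Measurable φ → (∃ M : ℝ, ∀ y, |φ y| ≤ M) →
    ∫ y, Pt t φ y ∂ρ = ∫ y, φ y ∂ρ

/-- The averaged coefficient `F̄(x,μ) = ∫ F(x,μ,y) ν^{x,μ}(dy)`. -/
def averagedCoeff {H : Type*} [NormedAddCommGroup H] [InnerProductSpace ℝ H] [MeasurableSpace H]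
    {p : ℝ} (F : H → Pp H p → H → H) (ν : H → Pp H p → Measure H) (x : H) (μ : Pp H p) : H :=
  ∫ y, F x μ y ∂(ν x μ)

end

/-!
The noise is additive, so every equation in sight is an ordinary integral equation in the Banach
space `E = L^p(Ω; H)`, driven by one fixed curve `w`: the stochastic convolution. Once `w` is
known to be a bounded continuous adapted curve in `E`, no further stochastic calculus is needed.

*The stochastic convolution.* Eigenvectors of `A` are eigenvectors of the semigroup, so the
convolution has the coordinates `γ k ∫ₛᵗ e^{-lam k (t - r)} dZ^k_r`, which integration by parts
turns into a functional of the càdlàg path; for such paths the left-point Riemann sums converge.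
Their characteristic functions are explicit. Averaged over an interval, they bound the truncated
second moments `𝔼 min(1, T²|·|²)` by `20 γ_k^α lam_k⁻¹ T^α` (`lintegral_truncSq_le_of_charFun`).
Truncated second moments are subadditive over orthogonal series and control moments of every order
`p < α` (`lintegral_rpow_le_of_truncSq`); together with dominated convergence for the increments
this gives `IsConvolvableNoise.exists_noiseCurve`. For `L` the summability condition with exponent
`1 - α θ / 2 ≤ 1` is stronger than the one used, since the eigenvalues are bounded below.

*Well-posedness.* A coefficient that is Lipschitz in the state and the law acts as a Lipschitz map
on `E`, because the joint law of two random variables is a coupling. A Picard contraction in a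
weighted norm gives a solution curve in `E`, Euler approximation shows that it is adapted, and a
predictable version of it is a mild solution. Uniqueness is Gronwall's inequality for
`𝔼|X_t - X'_t|^p`, with the predictable processes themselves rather than curves in `E`, since mild
solutions are not assumed continuous.

*Invariant measures.* All frozen equations are coupled by the same curve `w`. Since `L_G < lam 0`,
Gronwall's inequality with the kernel `e^{-lam 0 (t - s)}` shows that two frozen solutions
approach each other at rate `lam 0 - L_G` (`IsMildCurve.norm_sub_le`). The semigroup property of
`P_t φ(y) = 𝔼 φ(Y^y_t)` is first proved for the Euler scheme, which is a Markov chain because the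
increments of the stochastic convolution are independent and identically distributed, and passes
to the limit for bounded Lipschitz `φ`. Contraction and semigroup property make `P_n φ(0)` a
Cauchy sequence, uniformly over Lipschitz functions with a given constant; applied to thickened
indicators this gives tightness, and the weak limit `ν` attracts every starting point. Hence `ν`
is the only invariant measure. It is invariant at rational times because `P_n P_t φ = P_t P_n φ`,
and then at all times by continuity.

*Averaging.* `F̄(x, μ)` is the limit of `𝔼 F(x, μ, Y^{x,μ,0}_n)`. With the same noise, the frozen
solutions for two parameters stay within `C D / (lam 0 - L_G)` of each other, where `D` is the
distance of the parameters, so `F̄` is Lipschitz with constant `C + C² / (lam 0 - L_G)`. Thus the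
averaged equation is again an equation with Lipschitz coefficient.
-/

/-! ### The semigroup in the eigenbasis -/

namespace IsSemigroupGeneratedBy

variable {H : Type*} [NormedAddCommGroup H] [InnerProductSpace ℝ H] {A : H →ₗ.[ℝ] H}
  {S : ℝ≥0 → H →L[ℝ] H}

/-- The orbit of an eigenvector solves `u' = c u`, so it is an exponential. -/
theorem apply_eigenvector (hS : IsSemigroupGeneratedBy A S) {v : H} {c : ℝ}
    (hv : (v, c • v) ∈ A.graph) (t : ℝ≥0) : S t v = Real.exp (c * t) • v := by
  set f : ℝ → H := fun s => Real.exp (-(c * s)) • S s.toNNReal v with hf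
  have hcont : Continuous f :=
    (by fun_prop : Continuous fun s : ℝ => Real.exp (-(c * s))).smul
      ((hS.continuous v).comp continuous_real_toNNReal)
  have hlim := (hS.generator v (c • v)).1 hv
  have hderiv : ∀ x ∈ Set.Ico (0 : ℝ) t, HasDerivWithinAt f 0 (Set.Ici x) x := by
    intro x hx
    have h1 : HasDerivWithinAt (fun s : ℝ => S s.toNNReal v) (c • S x.toNNReal v)
        (Set.Ici x) x := by
      rw [hasDerivWithinAt_iff_tendsto_slope, Set.Ici_sdiff_left]
      have hmap : Tendsto (fun y : ℝ => (y - x).toNNReal) (𝓝[>] x) (𝓝[>] 0) := by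
        refine tendsto_nhdsWithin_iff.2 ⟨?_, ?_⟩
        · have : Tendsto (fun y : ℝ => (y - x).toNNReal) (𝓝 x) (𝓝 ((x - x).toNNReal)) :=
            (continuous_real_toNNReal.comp (by fun_prop)).tendsto x
          simpa using this.mono_left nhdsWithin_le_nhds
        · filter_upwards [self_mem_nhdsWithin] with y hy
          simpa using hy
      have h2 := ((S x.toNNReal).continuous.tendsto _).comp (hlim.comp hmap)
      simp only [map_smul] at h2
      refine h2.congr' ?_
      filter_upwards [self_mem_nhdsWithin] with y hy
      have hy' : x < y := hy
      have hadd : y.toNNReal = x.toNNReal + (y - x).toNNReal := by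
        rw [← Real.toNNReal_add hx.1 (by linarith)]; congr 1; ring
      simp only [Function.comp_apply, map_smul, slope, vsub_eq_sub, map_sub]
      rw [hadd, hS.map_add, Real.coe_toNNReal _ (by linarith)]
      simp
    have h3 : HasDerivWithinAt (fun s : ℝ => Real.exp (-(c * s)))
        (-c * Real.exp (-(c * x))) (Set.Ici x) x := by
      have : HasDerivAt (fun s : ℝ => Real.exp (-(c * s))) (Real.exp (-(c * x)) * (-(c * 1))) x :=
        (((hasDerivAt_id x).const_mul c).neg).exp
      exact this.hasDerivWithinAt.congr_deriv (by ring)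
    refine (h3.smul h1).congr_deriv ?_
    rw [smul_smul, ← add_smul, show Real.exp (-(c * x)) * c + -c * Real.exp (-(c * x)) = 0 by ring,
      zero_smul]
  have := constant_of_has_deriv_right_zero hcont.continuousOn hderiv t ⟨t.2, le_rfl⟩
  simp only [hf, Real.toNNReal_coe, Real.toNNReal_zero, hS.map_zero, mul_zero, neg_zero,
    Real.exp_zero, one_smul, ContinuousLinearMap.id_apply] at this
  conv_rhs => rw [← this]
  rw [smul_smul, ← Real.exp_add]
  simp

variable {e : HilbertBasis ℕ ℝ H} {lam : ℕ → ℝ}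

theorem repr_apply (hS : IsSemigroupGeneratedBy A S)
    (hAe : ∀ k, (e k, -(lam k) • e k) ∈ A.graph) (t : ℝ≥0) (x : H) (k : ℕ) :
    e.repr (S t x) k = Real.exp (-lam k * t) * e.repr x k := by
  have h1 := (e.hasSum_repr x).mapL (S t)
  have h2 := h1.mapL (innerSL ℝ (e k))
  rw [e.repr_apply_apply]
  refine (h2.unique (hasSum_single k ?_)).trans ?_
  · intro j hj
    simp [hS.apply_eigenvector (hAe j), e.orthonormal.inner_eq_zero hj.symm]
  · simp [hS.apply_eigenvector (hAe k), e.orthonormal.1 k, mul_comm]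

theorem norm_apply_le (hS : IsSemigroupGeneratedBy A S)
    (hAe : ∀ k, (e k, -(lam k) • e k) ∈ A.graph) (hlam : Monotone lam) (t : ℝ≥0) (x : H) :
    ‖S t x‖ ≤ Real.exp (-lam 0 * t) * ‖x‖ := by
  have hp : (0 : ℝ) < (2 : ℝ≥0∞).toReal := by norm_num
  have h1 := lp.norm_rpow_eq_tsum hp (e.repr (S t x))
  have h2 := lp.hasSum_norm hp (e.repr x)
  have hle : ‖e.repr (S t x)‖ ^ (2 : ℝ≥0∞).toReal
      ≤ (Real.exp (-lam 0 * t)) ^ (2 : ℝ≥0∞).toReal * ‖e.repr x‖ ^ (2 : ℝ≥0∞).toReal := by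
    refine hasSum_le (fun k => ?_) (lp.hasSum_norm hp (e.repr (S t x))) (h2.mul_left _)
    rw [hS.repr_apply hAe, norm_mul, Real.mul_rpow (norm_nonneg _) (norm_nonneg _)]
    gcongr
    rw [Real.norm_of_nonneg (Real.exp_nonneg _)]
    gcongr
    exact hlam (Nat.zero_le k)
  rw [← Real.mul_rpow (Real.exp_nonneg _) (norm_nonneg _)] at hle
  have := (Real.rpow_le_rpow_iff (norm_nonneg _) (by positivity) hp).1 hle
  simpa using this

end IsSemigroupGeneratedBy

/-! ### Mild curves in Banach spaces -/

/-- A strongly continuous semigroup of bounded operators with `‖T t‖ ≤ e^{-lam t}`. -/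
structure IsDecaySemigroup {E : Type*} [NormedAddCommGroup E] [NormedSpace ℝ E]
    (T : ℝ≥0 → E →L[ℝ] E) (lam : ℝ) : Prop where
  map_zero : T 0 = ContinuousLinearMap.id ℝ E
  map_add : ∀ s t : ℝ≥0, T (s + t) = (T s).comp (T t)
  continuous : ∀ x : E, Continuous fun t : ℝ≥0 => T t x
  norm_le : ∀ (t : ℝ≥0) (x : E), ‖T t x‖ ≤ Real.exp (-lam * t) * ‖x‖
  nonneg : 0 ≤ lam

section Abstract

variable {E : Type*} [NormedAddCommGroup E] [NormedSpace ℝ E] {T : ℝ≥0 → E →L[ℝ] E} {lam : ℝ}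

/-- The deterministic convolution `∫₀ᵗ T (t - s) f(s) ds`. -/
noncomputable def mildConv (T : ℝ≥0 → E →L[ℝ] E) (f : ℝ≥0 → E) (t : ℝ≥0) : E :=
  ∫ s in (0 : ℝ)..t, T (t - s.toNNReal) (f s.toNNReal)

/-- A continuous solution of `x(t) = T(t) x₀ + ∫₀ᵗ T(t - s) B(x(s)) ds + w(t)`. -/
structure IsMildCurve (T : ℝ≥0 → E →L[ℝ] E) (B : E → E) (w : ℝ≥0 → E) (x₀ : E)
    (x : ℝ≥0 → E) : Prop where
  continuous : Continuous x
  eq : ∀ t, x t = T t x₀ + mildConv T (fun s => B (x s)) t + w t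

namespace IsDecaySemigroup

theorem norm_apply_le (hT : IsDecaySemigroup T lam) (t : ℝ≥0) (x : E) : ‖T t x‖ ≤ ‖x‖ := by
  refine (hT.norm_le t x).trans (mul_le_of_le_one_left (norm_nonneg _) ?_)
  rw [Real.exp_le_one_iff]
  nlinarith [hT.nonneg, t.2]

theorem continuous_uncurry (hT : IsDecaySemigroup T lam) :
    Continuous fun q : E × ℝ≥0 => T q.2 q.1 := by
  refine continuous_prod_of_continuous_lipschitzWith _ 1 (fun x => hT.continuous x) fun t => ?_
  refine LipschitzWith.of_dist_le_mul fun x y => ?_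
  rw [dist_eq_norm, dist_eq_norm, ← map_sub]
  simpa using hT.norm_apply_le t (x - y)

theorem continuous_integrand (hT : IsDecaySemigroup T lam) {f : ℝ≥0 → E} (hf : Continuous f) :
    Continuous fun q : ℝ≥0 × ℝ => T (q.1 - q.2.toNNReal) (f q.2.toNNReal) :=
  hT.continuous_uncurry.comp ((hf.comp (continuous_real_toNNReal.comp continuous_snd)).prodMk
    (continuous_fst.sub (continuous_real_toNNReal.comp continuous_snd)))

theorem intervalIntegrable_integrand (hT : IsDecaySemigroup T lam) {f : ℝ≥0 → E}
    (hf : Continuous f) (t : ℝ≥0) (a b : ℝ) :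
    IntervalIntegrable (fun s : ℝ => T (t - s.toNNReal) (f s.toNNReal)) volume a b :=
  ((hT.continuous_integrand hf).comp (by fun_prop : Continuous fun s : ℝ => (t,
      s))).intervalIntegrable
    a b

theorem continuous_mildConv (hT : IsDecaySemigroup T lam) {f : ℝ≥0 → E} (hf : Continuous f) :
    Continuous (mildConv T f) := by
  unfold mildConv
  exact intervalIntegral.continuous_parametric_intervalIntegral_of_continuous
    (hT.continuous_integrand hf) NNReal.continuous_coe

theorem mildConv_sub (hT : IsDecaySemigroup T lam) {f g : ℝ≥0 → E} (hf : Continuous f)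
    (hg : Continuous g) (t : ℝ≥0) :
    mildConv T f t - mildConv T g t = mildConv T (fun s => f s - g s) t := by
  unfold mildConv
  rw [← intervalIntegral.integral_sub (hT.intervalIntegrable_integrand hf t _ _)
    (hT.intervalIntegrable_integrand hg t _ _)]
  simp

theorem norm_mildConv_le (hT : IsDecaySemigroup T lam) {f : ℝ≥0 → E} {b : ℝ≥0 → ℝ}
    (hb : Continuous b) (h : ∀ s, ‖f s‖ ≤ b s) (t : ℝ≥0) :
    ‖mildConv T f t‖ ≤ ∫ s in (0 : ℝ)..t, Real.exp (-lam * (t - s)) * b s.toNNReal := by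
  refine intervalIntegral.norm_integral_le_of_norm_le t.2 (Eventually.of_forall fun s hs => ?_) ?_
  · refine (hT.norm_le _ _).trans ?_
    have hs' : ((t - s.toNNReal : ℝ≥0) : ℝ) = t - s := by
      rw [NNReal.coe_sub (Real.toNNReal_le_iff_le_coe.2 hs.2), Real.coe_toNNReal _ hs.1.le]
    rw [hs']
    gcongr
    exact h _
  · refine Continuous.intervalIntegrable ?_ _ _
    exact (by fun_prop : Continuous fun s : ℝ => Real.exp (-lam * (t - s))).mul
      (hb.comp continuous_real_toNNReal)

theorem norm_mildConv_le_exp (hT : IsDecaySemigroup T lam) {f : ℝ≥0 → E} {D c : ℝ} (hc : 0 < c)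
    (h : ∀ s : ℝ≥0, ‖f s‖ ≤ D * Real.exp (c * s)) (t : ℝ≥0) :
    ‖mildConv T f t‖ ≤ D / c * Real.exp (c * t) := by
  have hD : 0 ≤ D := by simpa using (norm_nonneg _).trans (h 0)
  have h1 := hT.norm_mildConv_le (b := fun s : ℝ≥0 => D * Real.exp (c * s)) (by fun_prop) h t
  have hderiv : ∀ x ∈ Set.uIcc (0 : ℝ) t,
      HasDerivAt (fun s => D / c * Real.exp (c * s)) (D * Real.exp (c * x)) x := fun x _ => by
    have := ((((hasDerivAt_id x).const_mul c).exp).const_mul (D / c))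
    refine this.congr_deriv ?_
    simp only [id, mul_one]
    field_simp
  have h2 : ∫ s in (0 : ℝ)..t, D * Real.exp (c * s) = D / c * Real.exp (c * t) - D / c := by
    rw [intervalIntegral.integral_eq_sub_of_hasDerivAt hderiv
      ((by fun_prop : Continuous fun s : ℝ => D * Real.exp (c * s)).intervalIntegrable _ _)]
    simp
  refine h1.trans (le_trans ?_ (h2.le.trans (sub_le_self _ (by positivity))))
  refine intervalIntegral.integral_mono_on t.2 ?_ ?_ fun s hs => ?_
  · refine Continuous.intervalIntegrable ?_ _ _
    exact (by fun_prop : Continuous fun s : ℝ => Real.exp (-lam * (t - s))).mul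
      ((by fun_prop : Continuous fun s : ℝ≥0 => D * Real.exp (c * s)).comp
        continuous_real_toNNReal)
  · exact (by fun_prop : Continuous fun s : ℝ => D * Real.exp (c * s)).intervalIntegrable _ _
  · rw [Real.coe_toNNReal _ hs.1]
    refine mul_le_of_le_one_left (by positivity) ?_
    rw [Real.exp_le_one_iff]
    nlinarith [hT.nonneg, hs.2]

/-- Flow property of the convolution. -/
theorem mildConv_add [CompleteSpace E] (hT : IsDecaySemigroup T lam) {f : ℝ≥0 → E}
    (hf : Continuous f) (t h : ℝ≥0) :
    mildConv T f (t + h) = T h (mildConv T f t) + mildConv T (fun s => f (t + s)) h := by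
  have h1 : mildConv T f (t + h)
      = (∫ s in (0 : ℝ)..t, T (t + h - s.toNNReal) (f s.toNNReal))
        + ∫ s in (t : ℝ)..(t + h : ℝ≥0), T (t + h - s.toNNReal) (f s.toNNReal) :=
    (intervalIntegral.integral_add_adjacent_intervals (hT.intervalIntegrable_integrand hf _ _ _)
      (hT.intervalIntegrable_integrand hf _ _ _)).symm
  rw [h1]
  congr 1
  · unfold mildConv
    rw [← ContinuousLinearMap.intervalIntegral_comp_comm _
      (hT.intervalIntegrable_integrand hf _ _ _)]
    refine intervalIntegral.integral_congr fun s hs => ?_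
    rw [Set.uIcc_of_le t.coe_nonneg] at hs
    have hs' : s.toNNReal ≤ t := Real.toNNReal_le_iff_le_coe.2 hs.2
    have : t + h - s.toNNReal = h + (t - s.toNNReal) := by
      rw [add_comm t h, add_tsub_assoc_of_le hs']
    simp only [this, hT.map_add, ContinuousLinearMap.comp_apply]
  · unfold mildConv
    have := intervalIntegral.integral_comp_add_left
      (fun s : ℝ => T (t + h - s.toNNReal) (f s.toNNReal)) (a := 0) (b := h) (t : ℝ)
    rw [add_zero, ← NNReal.coe_add] at this
    rw [← this]
    refine intervalIntegral.integral_congr fun s hs => ?_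
    rw [Set.uIcc_of_le h.coe_nonneg] at hs
    have h2 : ((t : ℝ) + s).toNNReal = t + s.toNNReal := by
      rw [Real.toNNReal_add t.coe_nonneg hs.1, Real.toNNReal_coe]
    simp only [h2, add_tsub_add_eq_tsub_left]

/-- Existence of global mild curves: the Picard map is a contraction for the norm
`sup_t e^{-ct} ‖x(t)‖` with `c` larger than the Lipschitz constant. -/
theorem exists_isMildCurve [CompleteSpace E] (hT : IsDecaySemigroup T lam) {B : E → E} {K : ℝ≥0}
    (hB : LipschitzWith K B) {w : ℝ≥0 → E} (hw : Continuous w) {M : ℝ} (hM : ∀ t, ‖w t‖ ≤ M)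
    (x₀ : E) : ∃ x, IsMildCurve T B w x₀ x := by
  set c : ℝ := K + 1 with hc
  have hcpos : 0 < c := by positivity
  have hexp1 : ∀ s : ℝ≥0, 1 ≤ Real.exp (c * s) := fun s => Real.one_le_exp (by positivity)
  have hexp : ∀ s : ℝ≥0, Real.exp (-(c * s)) * Real.exp (c * s) = 1 := fun s => by
    rw [← Real.exp_add]; simp
  have hBn : ∀ z, ‖B z‖ ≤ ‖B 0‖ + K * ‖z‖ := fun z => by
    have := hB.norm_sub_le z 0
    rw [sub_zero] at this
    linarith [norm_le_norm_add_norm_sub' (B z) (B 0)]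
  let g : BoundedContinuousFunction ℝ≥0 E → ℝ≥0 → E := fun y s => B (Real.exp (c * s) • y s)
  have hg : ∀ y, Continuous (g y) := fun y =>
    hB.continuous.comp ((by fun_prop : Continuous fun s : ℝ≥0 => Real.exp (c * s)).smul
      y.continuous)
  let Ψ₀ : BoundedContinuousFunction ℝ≥0 E → ℝ≥0 → E := fun y t =>
    Real.exp (-(c * t)) • (T t x₀ + mildConv T (g y) t + w t)
  have hΨc : ∀ y, Continuous (Ψ₀ y) := fun y =>
    (by fun_prop : Continuous fun s : ℝ≥0 => Real.exp (-(c * s))).smul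
      (((hT.continuous x₀).add (hT.continuous_mildConv (hg y))).add hw)
  have hΨb : ∀ y t, ‖Ψ₀ y t‖ ≤ ‖x₀‖ + (‖B 0‖ + K * ‖y‖) / c + M := fun y t => by
    have h1 : ∀ s : ℝ≥0, ‖g y s‖ ≤ (‖B 0‖ + K * ‖y‖) * Real.exp (c * s) := fun s => by
      refine (hBn _).trans ?_
      rw [norm_smul, Real.norm_of_nonneg (Real.exp_nonneg _), add_mul ‖B 0‖]
      have := y.norm_coe_le_norm s
      refine add_le_add (le_mul_of_one_le_right (norm_nonneg (B 0)) (hexp1 s)) ?_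
      rw [mul_assoc, mul_comm ‖y‖]
      gcongr
    have h2 := hT.norm_mildConv_le_exp hcpos h1 t
    have hM0 : 0 ≤ M := (norm_nonneg _).trans (hM t)
    have hle : Real.exp (-(c * t)) ≤ 1 := by
      rw [Real.exp_le_one_iff]; nlinarith [t.2]
    calc ‖Ψ₀ y t‖ = Real.exp (-(c * t)) * ‖T t x₀ + mildConv T (g y) t + w t‖ := by
          simp only [Ψ₀]; rw [norm_smul, Real.norm_of_nonneg (Real.exp_nonneg _)]
      _ ≤ Real.exp (-(c * t)) *
          (‖x₀‖ + (‖B 0‖ + K * ‖y‖) / c * Real.exp (c * t) + M) := by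
          gcongr
          refine norm_add₃_le.trans (add_le_add (add_le_add (hT.norm_apply_le t x₀) h2) (hM t))
      _ = Real.exp (-(c * t)) * ‖x₀‖
          + (‖B 0‖ + K * ‖y‖) / c * (Real.exp (-(c * t)) * Real.exp (c * t))
          + Real.exp (-(c * t)) * M := by ring
      _ ≤ _ := by
          rw [hexp, mul_one]
          gcongr
          · exact mul_le_of_le_one_left (norm_nonneg _) hle
          · exact mul_le_of_le_one_left hM0 hle
  let Ψ : BoundedContinuousFunction ℝ≥0 E → BoundedContinuousFunction ℝ≥0 E := fun y =>
    BoundedContinuousFunction.ofNormedAddCommGroup (Ψ₀ y) (hΨc y) _ (hΨb y)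
  have hcontr : ContractingWith (K / (K + 1)) Ψ := by
    refine ⟨?_, LipschitzWith.of_dist_le_mul fun y z => ?_⟩
    · rw [div_lt_one (by positivity)]
      exact lt_add_one K
    · rw [BoundedContinuousFunction.dist_le (by positivity)]
      intro t
      have h1 : ∀ s : ℝ≥0, ‖g y s - g z s‖ ≤ (K * dist y z) * Real.exp (c * s) := fun s => by
        refine (hB.norm_sub_le _ _).trans ?_
        rw [← smul_sub, norm_smul, Real.norm_of_nonneg (Real.exp_nonneg _), mul_assoc,
          mul_comm (dist y z)]
        have := BoundedContinuousFunction.dist_coe_le_dist (f := y) (g := z) s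
        rw [dist_eq_norm] at this
        gcongr
      have h2 := hT.norm_mildConv_le_exp hcpos h1 t
      rw [← hT.mildConv_sub (hg y) (hg z)] at h2
      rw [dist_eq_norm]
      have h3 : Ψ y t - Ψ z t
          = Real.exp (-(c * t)) • (mildConv T (g y) t - mildConv T (g z) t) := by
        change Ψ₀ y t - Ψ₀ z t = _
        simp only [Ψ₀]
        rw [← smul_sub]
        congr 1
        abel
      rw [h3, norm_smul, Real.norm_of_nonneg (Real.exp_nonneg _)]
      calc Real.exp (-(c * t)) * ‖mildConv T (g y) t - mildConv T (g z) t‖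
          ≤ Real.exp (-(c * t)) * (K * dist y z / c * Real.exp (c * t)) := by gcongr
        _ = (K * dist y z / c) * (Real.exp (-(c * t)) * Real.exp (c * t)) := by ring
        _ = _ := by rw [hexp, hc]; push_cast; ring
  obtain ⟨y, hy⟩ : ∃ y, Ψ y = y := ⟨_, hcontr.fixedPoint_isFixedPt⟩
  refine ⟨fun t => Real.exp (c * t) • y t,
    (by fun_prop : Continuous fun s : ℝ≥0 => Real.exp (c * s)).smul y.continuous, fun t => ?_⟩
  have h1 : Ψ₀ y t = y t := congrArg (fun f : BoundedContinuousFunction ℝ≥0 E => f t) hy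
  change Real.exp (c * t) • y t = T t x₀ + mildConv T (g y) t + w t
  rw [← h1]
  simp only [Ψ₀]
  rw [smul_smul, mul_comm, hexp, one_smul]

end IsDecaySemigroup

end Abstract

/-! ### Stability, Euler approximation and adaptedness of mild curves -/

section Gronwall

/-- Gronwall's inequality for a convolution with an exponential kernel that decays faster than the
growth rate `K`. -/
theorem gronwall_exp_kernel {d : ℝ≥0 → ℝ} (hd : Continuous d) {lam K a b : ℝ} (hK : 0 ≤ K)
    (hKl : K < lam) (hb : 0 ≤ b)
    (h : ∀ t : ℝ≥0, d t ≤ Real.exp (-lam * t) * a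
      + ∫ s in (0 : ℝ)..t, Real.exp (-lam * (t - s)) * (b + K * d s.toNNReal)) (t : ℝ≥0) :
    d t ≤ Real.exp (-(lam - K) * t) * a + b / (lam - K) := by
  have hκ : 0 < lam - K := by linarith
  set q : ℝ → ℝ := fun s => Real.exp (lam * s) * (b + K * d s.toNNReal) with hq
  have hqc : Continuous q := (by fun_prop : Continuous fun s : ℝ => Real.exp (lam * s)).mul
    (continuous_const.add (continuous_const.mul (hd.comp continuous_real_toNNReal)))
  set v : ℝ → ℝ := fun r => a + ∫ s in (0 : ℝ)..r, q s with hv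
  have hvd : ∀ r, HasDerivAt v (q r) r := fun r =>
    (intervalIntegral.integral_hasDerivAt_right (hqc.intervalIntegrable _ _)
      hqc.stronglyMeasurable.stronglyMeasurableAtFilter hqc.continuousAt).const_add a
  have hvle : ∀ r : ℝ≥0, Real.exp (lam * r) * d r ≤ v r := fun r => by
    have h1 : ∫ s in (0 : ℝ)..r, Real.exp (-lam * (r - s)) * (b + K * d s.toNNReal)
        = Real.exp (-lam * r) * ∫ s in (0 : ℝ)..r, q s := by
      rw [← intervalIntegral.integral_const_mul]
      refine intervalIntegral.integral_congr fun s _ => ?_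
      simp only [hq]
      rw [← mul_assoc, ← Real.exp_add]
      ring_nf
    have h2 := h r
    rw [h1, ← mul_add] at h2
    calc Real.exp (lam * r) * d r ≤ Real.exp (lam * r) * (Real.exp (-lam * r) * v r) := by
          gcongr
      _ = v r := by rw [← mul_assoc, ← Real.exp_add]; simp
  set g : ℝ → ℝ := fun r => Real.exp (-K * r) * v r - b / (lam - K) * Real.exp ((lam - K) * r)
    with hg
  have hgd : ∀ r, HasDerivAt g (Real.exp (-K * r) * (q r - K * v r)
      - b * Real.exp ((lam - K) * r)) r := fun r => by
    have e1 := (((hasDerivAt_id r).const_mul (-K)).exp).mul (hvd r)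
    have e2 := (((hasDerivAt_id r).const_mul (lam - K)).exp).const_mul (b / (lam - K))
    refine (e1.sub e2).congr_deriv ?_
    simp only [id]
    field_simp
    ring
  have hanti : AntitoneOn g (Set.Ici 0) := by
    refine antitoneOn_of_deriv_nonpos (convex_Ici 0)
      (fun r _ => (hgd r).continuousAt.continuousWithinAt)
      (fun r _ => (hgd r).differentiableAt.differentiableWithinAt) fun r hr => ?_
    rw [interior_Ici] at hr
    rw [(hgd r).deriv]
    have hr' : (r.toNNReal : ℝ) = r := Real.coe_toNNReal _ (le_of_lt hr)
    have h1 := hvle r.toNNReal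
    rw [hr'] at h1
    have h2 : q r - K * v r ≤ b * Real.exp (lam * r) := by
      simp only [hq]
      nlinarith
    calc _ ≤ Real.exp (-K * r) * (b * Real.exp (lam * r)) - b * Real.exp ((lam - K) * r) := by
          gcongr
      _ = 0 := by
          rw [mul_left_comm, ← Real.exp_add]
          ring_nf
  have h0 := hanti (Set.mem_Ici.2 le_rfl) (Set.mem_Ici.2 t.coe_nonneg) t.coe_nonneg
  simp only [hg, hv, intervalIntegral.integral_same, mul_zero, Real.exp_zero, add_zero, one_mul,
    mul_one] at h0
  have h3 : Real.exp (-K * t) * (Real.exp (lam * t) * d t)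
      ≤ a - b / (lam - K) + b / (lam - K) * Real.exp ((lam - K) * t) := by
    have := mul_le_mul_of_nonneg_left (hvle t) (Real.exp_nonneg (-K * t))
    simp only [hv] at this
    linarith
  have h4 : Real.exp (-(lam - K) * t) * Real.exp ((lam - K) * t) = 1 := by
    rw [← Real.exp_add, neg_mul, neg_add_cancel, Real.exp_zero]
  have h5 : d t = Real.exp (-(lam - K) * t) * (Real.exp (-K * t) * (Real.exp (lam * t) * d t)) := by
    rw [← mul_assoc, ← mul_assoc, ← Real.exp_add, ← Real.exp_add]
    ring_nf
    simp
  rw [h5]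
  have hbk : 0 ≤ b / (lam - K) := by positivity
  calc _ ≤ Real.exp (-(lam - K) * t)
        * (a - b / (lam - K) + b / (lam - K) * Real.exp ((lam - K) * t)) := by gcongr
    _ = Real.exp (-(lam - K) * t) * a - Real.exp (-(lam - K) * t) * (b / (lam - K))
        + b / (lam - K) * (Real.exp (-(lam - K) * t) * Real.exp ((lam - K) * t)) := by ring
    _ ≤ _ := by
        rw [h4, mul_one]
        have := mul_nonneg (Real.exp_nonneg (-(lam - K) * t)) hbk
        linarith

end Gronwall

section Curves

variable {E : Type*} [NormedAddCommGroup E] [NormedSpace ℝ E] {T : ℝ≥0 → E →L[ℝ] E} {lam : ℝ}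

/-- Two mild curves driven by the same noise, with drifts that differ by at most `b` and are
`K`-Lipschitz with `K < lam`, approach each other exponentially fast up to `b / (lam - K)`. -/
theorem IsMildCurve.norm_sub_le (hT : IsDecaySemigroup T lam) {B₁ B₂ : E → E}
    (hB₁ : Continuous B₁) (hB₂ : Continuous B₂) {K b : ℝ} (hK : 0 ≤ K) (hKl : K < lam)
    (hb : 0 ≤ b) (hB : ∀ z₁ z₂, ‖B₁ z₁ - B₂ z₂‖ ≤ b + K * ‖z₁ - z₂‖) {w : ℝ≥0 → E}
    {x₁ x₂ : E} {y₁ y₂ : ℝ≥0 → E} (h₁ : IsMildCurve T B₁ w x₁ y₁) (h₂ : IsMildCurve T B₂ w x₂ y₂)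
    (t : ℝ≥0) :
    ‖y₁ t - y₂ t‖ ≤ Real.exp (-(lam - K) * t) * ‖x₁ - x₂‖ + b / (lam - K) := by
  have hd : Continuous fun t => ‖y₁ t - y₂ t‖ := (h₁.continuous.sub h₂.continuous).norm
  refine gronwall_exp_kernel hd hK hKl hb (fun t => ?_) t
  have e : y₁ t - y₂ t = T t (x₁ - x₂) + mildConv T (fun s => B₁ (y₁ s) - B₂ (y₂ s)) t := by
    rw [← hT.mildConv_sub (f := fun s => B₁ (y₁ s)) (g := fun s => B₂ (y₂ s))
      (hB₁.comp h₁.continuous) (hB₂.comp h₂.continuous), h₁.eq, h₂.eq, map_sub]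
    abel
  rw [e]
  refine (norm_add_le _ _).trans (add_le_add (hT.norm_le _ _) ?_)
  exact hT.norm_mildConv_le (continuous_const.add (continuous_const.mul hd))
    (fun s => hB _ _) t

/-- A mild curve with bounded noise and `K`-Lipschitz drift, `K < lam`, is bounded. -/
theorem IsMildCurve.norm_le (hT : IsDecaySemigroup T lam) {B : E → E}
    {K : ℝ≥0} (hB : LipschitzWith K B) (hKl : K < lam) {w : ℝ≥0 → E} {M : ℝ}
    (hM : ∀ t, ‖w t‖ ≤ M) {x : E} {y : ℝ≥0 → E} (h : IsMildCurve T B w x y) (t : ℝ≥0) :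
    ‖y t‖ ≤ ‖x‖ + (‖B 0‖ + K * M) / (lam - K) + M := by
  have hM0 : 0 ≤ M := (norm_nonneg _).trans (hM t)
  have hd : Continuous fun t => ‖y t‖ - M := h.continuous.norm.sub continuous_const
  have key := gronwall_exp_kernel hd (a := ‖x‖) (b := ‖B 0‖ + K * M) K.coe_nonneg hKl
      (by positivity)
    (fun t => ?_) t
  · have : Real.exp (-(lam - K) * t) ≤ 1 := by
      rw [Real.exp_le_one_iff]
      nlinarith [t.coe_nonneg]
    have := mul_le_of_le_one_left (norm_nonneg x) this
    linarith
  · have h1 := hT.norm_mildConv_le (f := fun s => B (y s))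
      (b := fun s => ‖B 0‖ + K * M + K * (‖y s‖ - M)) (continuous_const.add
        (continuous_const.mul hd)) (fun s => ?_) t
    · have h2 : ‖y t‖ ≤ ‖T t x‖ + ‖mildConv T (fun s => B (y s)) t‖ + ‖w t‖ := by
        conv_lhs => rw [h.eq]
        exact norm_add₃_le
      have h3 := hT.norm_le t x
      have h4 := hM t
      linarith
    · have := hB.norm_sub_le (y s) 0
      rw [sub_zero] at this
      have h2 := norm_le_norm_add_norm_sub' (B (y s)) (B 0)
      linarith

/-- The explicit exponential Euler scheme with step `h` driven by the increments `Δ j`. -/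
def euler (T : ℝ≥0 → E →L[ℝ] E) (B : E → E) (h : ℝ≥0) (Δ : ℕ → E) (x₀ : E) : ℕ → E
  | 0 => x₀
  | n + 1 => T h (euler T B h Δ x₀ n + (h : ℝ) • B (euler T B h Δ x₀ n)) + Δ n

theorem IsMildCurve.step [CompleteSpace E] (hT : IsDecaySemigroup T lam) {B : E → E}
    (hB : Continuous B) {w : ℝ≥0 → E} {x₀ : E} {x : ℝ≥0 → E} (hx : IsMildCurve T B w x₀ x)
    (t h : ℝ≥0) :
    x (t + h) = T h (x t) + mildConv T (fun s => B (x (t + s))) h + (w (t + h) - T h (w t)) := by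
  rw [hx.eq (t + h), hT.mildConv_add (f := fun s => B (x s)) (hB.comp hx.continuous),
      add_comm t h, hT.map_add]
  conv_rhs => rw [hx.eq t]
  simp only [map_add, ContinuousLinearMap.comp_apply]
  abel

/-- The Euler scheme converges, uniformly on bounded time intervals. -/
theorem IsMildCurve.euler_close [CompleteSpace E] (hT : IsDecaySemigroup T lam) {B : E → E}
    {K : ℝ≥0} (hB : LipschitzWith K B) {w : ℝ≥0 → E} (hw0 : w 0 = 0) {x₀ : E} {x : ℝ≥0 → E}
    (hx : IsMildCurve T B w x₀ x) (t : ℝ≥0) {ε : ℝ} (hε : 0 < ε) :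
    ∃ δ : ℝ≥0, 0 < δ ∧ ∀ h : ℝ≥0, h ≤ δ → ∀ n : ℕ, n * h ≤ t →
      ‖x (n * h) - euler T B h (fun j => w ((j + 1 : ℕ) * h) - T h (w (j * h))) x₀ n‖ ≤ ε := by
  obtain ⟨η, hη, hηε⟩ : ∃ η : ℝ, 0 < η ∧ η * (t * Real.exp (K * t)) ≤ ε := by
    refine ⟨ε / (t * Real.exp (K * t) + 1), by positivity, ?_⟩
    rw [div_mul_eq_mul_div, div_le_iff₀ (by positivity)]
    nlinarith
  -- the map `(u, s) ↦ T u (B (x s))` is uniformly continuous on `[0, t] × [0, t]`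
  have hcont : Continuous fun q : ℝ≥0 × ℝ≥0 => T q.1 (B (x q.2)) :=
    hT.continuous_uncurry.comp
      (((hB.continuous.comp hx.continuous).comp continuous_snd).prodMk continuous_fst)
  have hcpt : IsCompact (Set.Icc (0 : ℝ≥0) t ×ˢ Set.Icc (0 : ℝ≥0) t) :=
    isCompact_Icc.prod isCompact_Icc
  have huc := Metric.uniformContinuousOn_iff.1
    (hcpt.uniformContinuousOn_of_continuous hcont.continuousOn) η hη
  obtain ⟨δ, hδ, hδη⟩ := huc
  refine ⟨(δ / 2).toNNReal, Real.toNNReal_pos.2 (by linarith), fun h hh n hn => ?_⟩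
  have hhδ : (h : ℝ) < δ := by
    have : (h : ℝ) ≤ δ / 2 := by
      have := NNReal.coe_le_coe.2 hh
      rwa [Real.coe_toNNReal _ (by linarith)] at this
    linarith
  set Δ : ℕ → E := fun j => w ((j + 1 : ℕ) * h) - T h (w (j * h)) with hΔ
  have main : ∀ j : ℕ, (j : ℝ≥0) * h ≤ t →
      ‖x (j * h) - euler T B h Δ x₀ j‖ ≤ η * (j * h) * Real.exp (K * (j * h)) := by
    intro j
    induction j with
    | zero =>
      intro _
      have h0 := hx.eq 0
      simp only [hT.map_zero, hw0, add_zero, ContinuousLinearMap.id_apply, mildConv,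
        NNReal.coe_zero, intervalIntegral.integral_same] at h0
      simp [euler, h0]
    | succ j ih =>
      intro hj
      have hcast : ((j + 1 : ℕ) : ℝ≥0) * h = j * h + h := by push_cast; ring
      have hj' : (j : ℝ≥0) * h ≤ t := le_trans (by rw [hcast]; exact le_self_add) hj
      have hht : h ≤ t := le_trans (by rw [hcast]; exact le_add_self) hj
      set d := x (j * h) - euler T B h Δ x₀ j with hd
      have h1 := hx.step hT hB.continuous (j * h) h
      have h2 : ‖mildConv T (fun s => B (x (j * h + s))) h - (h : ℝ) • T h (B (x (j * h)))‖
          ≤ η * h := by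
        have hc : (h : ℝ) • T h (B (x (j * h))) = ∫ s in (0 : ℝ)..h, T h (B (x (j * h))) := by
          simp
        rw [hc, mildConv, ← intervalIntegral.integral_sub]
        · refine (intervalIntegral.norm_integral_le_of_norm_le_const (C := η) fun s hs => ?_).trans
            (by simp)
          rw [Set.uIoc_of_le h.coe_nonneg] at hs
          have hs' : s.toNNReal ≤ h := Real.toNNReal_le_iff_le_coe.2 hs.2
          have hsc : ((s.toNNReal : ℝ≥0) : ℝ) = s := Real.coe_toNNReal _ hs.1.le
          rw [← dist_eq_norm]
          refine (hδη (h - s.toNNReal, j * h + s.toNNReal) ?_ (h, j * h) ?_ ?_).le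
          · exact ⟨⟨zero_le, tsub_le_self.trans hht⟩, zero_le,
              (add_le_add_right hs' _).trans (hcast ▸ hj)⟩
          · exact ⟨⟨zero_le, hht⟩, zero_le, hj'⟩
          · have e1 : dist (h - s.toNNReal) h = s := by
              rw [NNReal.dist_eq, NNReal.coe_sub hs', hsc]
              simp [hs.1.le]
            have e2 : dist ((j : ℝ≥0) * h + s.toNNReal) (j * h) = s := by
              rw [NNReal.dist_eq]
              push_cast [hsc]
              simp [hs.1.le]
            rw [Prod.dist_eq, e1, e2, max_self]
            linarith [hs.2]
        · exact hT.intervalIntegrable_integrand (f := fun s => B (x (j * h + s)))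
            (hB.continuous.comp (hx.continuous.comp (by fun_prop))) h _ _
        · exact intervalIntegrable_const
      have h3 : x ((j + 1 : ℕ) * h) - euler T B h Δ x₀ (j + 1)
          = T h d + (mildConv T (fun s => B (x (j * h + s))) h - (h : ℝ) • T h (B (x (j * h))))
            + (h : ℝ) • T h (B (x (j * h)) - B (euler T B h Δ x₀ j)) := by
        rw [hcast, h1]
        simp only [euler, hΔ, hd, map_sub, map_add, map_smul, hcast, smul_sub]
        abel
      rw [h3]
      have h4 : ‖(h : ℝ) • T h (B (x (j * h)) - B (euler T B h Δ x₀ j))‖ ≤ h * (K * ‖d‖) := by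
        rw [norm_smul, Real.norm_of_nonneg h.coe_nonneg]
        gcongr
        exact (hT.norm_apply_le _ _).trans (hB.norm_sub_le _ _)
      have h5 := ih hj'
      have h6 : 1 + (K : ℝ) * h ≤ Real.exp (K * h) := by
        linarith [Real.add_one_le_exp ((K : ℝ) * h)]
      have h7 : (1 : ℝ) ≤ Real.exp (K * (j * h + h)) := Real.one_le_exp (by positivity)
      calc _ ≤ ‖d‖ + η * h + h * (K * ‖d‖) :=
            norm_add₃_le.trans (add_le_add (add_le_add (hT.norm_apply_le _ _) h2) h4)
        _ = (1 + K * h) * ‖d‖ + η * h * 1 := by ring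
        _ ≤ Real.exp (K * h) * (η * (j * h) * Real.exp (K * (j * h)))
            + η * h * Real.exp (K * (j * h + h)) := by gcongr
        _ = _ := by
            have : Real.exp (K * (j * h + h)) = Real.exp (K * h) * Real.exp (K * (j * h)) := by
              rw [← Real.exp_add]; ring_nf
            push_cast
            rw [show ((j : ℝ) + 1) * h = j * h + h by ring, this]
            ring
  have hnt : (n : ℝ) * h ≤ t := by exact_mod_cast hn
  refine (main n hn).trans (le_trans ?_ hηε)
  rw [mul_assoc]
  gcongr

theorem euler_mem {B : E → E} {V : ℕ → Submodule ℝ E} (hV : Monotone V) {h : ℝ≥0}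
    (hTV : ∀ n, ∀ z ∈ V n, T h z ∈ V n) (hBV : ∀ n, ∀ z ∈ V n, B z ∈ V n) {Δ : ℕ → E}
    (hΔ : ∀ n, Δ n ∈ V (n + 1)) {x₀ : E} (hx₀ : x₀ ∈ V 0) (n : ℕ) :
    euler T B h Δ x₀ n ∈ V n := by
  induction n with
  | zero => exact hx₀
  | succ n ih =>
    refine (V (n + 1)).add_mem (hV n.le_succ ?_) (hΔ n)
    exact hTV n _ ((V n).add_mem ih ((V n).smul_mem _ (hBV n _ ih)))

/-- A mild curve is adapted to every increasing family of closed subspaces that is preserved by the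
semigroup and the drift and to which the noise is adapted. -/
theorem IsMildCurve.mem [CompleteSpace E] (hT : IsDecaySemigroup T lam) {B : E → E}
    {K : ℝ≥0} (hB : LipschitzWith K B) {w : ℝ≥0 → E} (hw0 : w 0 = 0) {x₀ : E} {x : ℝ≥0 → E}
    (hx : IsMildCurve T B w x₀ x) {V : ℝ≥0 → Submodule ℝ E} (hV : Monotone V)
    (hVc : ∀ t, IsClosed (V t : Set E)) (hTV : ∀ t h, ∀ z ∈ V t, T h z ∈ V t)
    (hBV : ∀ t, ∀ z ∈ V t, B z ∈ V t) (hw : ∀ t, w t ∈ V t) (hx₀ : x₀ ∈ V 0) (t : ℝ≥0) :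
    x t ∈ V t := by
  rw [← SetLike.mem_coe, ← (hVc t).closure_eq, Metric.mem_closure_iff]
  intro ε hε
  obtain ⟨δ, hδ, h⟩ := hx.euler_close hT hB hw0 t (half_pos hε)
  obtain ⟨n, hn⟩ := exists_nat_gt (t / δ)
  have hn0 : (0 : ℝ≥0) < n := lt_of_le_of_lt (zero_le) hn
  have hnt : (n : ℝ≥0) * (t / n) = t := mul_div_cancel₀ _ hn0.ne'
  have key := h (t / n) ?_ n hnt.le
  · rw [hnt] at key
    refine ⟨_, ?_, lt_of_le_of_lt ((dist_eq_norm _ _).trans_le key) (half_lt_self hε)⟩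
    have hmono : Monotone fun j : ℕ => V (j * (t / n)) := fun i j hij => hV (by gcongr)
    have := euler_mem hmono (h := t / n) (fun j => hTV _ _) (fun j => hBV _)
      (Δ := fun j => w ((j + 1 : ℕ) * (t / n)) - T (t / n) (w (j * (t / n)))) (fun j => ?_)
      (x₀ := x₀) (by simpa using hx₀) n
    · rwa [hnt] at this
    · exact Submodule.sub_mem _ (hw _) (hTV _ _ _ (hV (by gcongr; simp) (hw _)))
  · rw [div_lt_iff₀ hδ] at hn
    rw [div_le_iff₀ hn0, mul_comm]
    exact hn.le

end Curves

/-! ### Truncated second moments and stable increments -/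

section Sinc

/-- The constant `20` comes from `π² ≤ 10` and `1 - cos y ≥ 2 y² / π²`. -/
theorem min_one_sq_le_one_sub_sinc (x : ℝ) : min 1 (x ^ 2) ≤ 20 * (1 - Real.sinc x) := by
  rcases lt_or_ge 2 |x| with hx | hx
  · have hx0 : x ≠ 0 := by
      rintro rfl
      norm_num at hx
    have h1 := Real.sinc_le_inv_abs hx0
    have h2 : |x|⁻¹ ≤ 2⁻¹ := inv_anti₀ (by norm_num) hx.le
    have := min_le_left 1 (x ^ 2)
    linarith
  · rcases eq_or_ne x 0 with rfl | hx0
    · simp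
    -- `sinc x = sinc (x / 2) cos (x / 2) ≤ cos (x / 2)`
    have hpi := Real.pi_gt_three
    have hx2 : |x / 2| ≤ 1 := by rw [abs_div, abs_two]; linarith
    have hcos0 : 0 ≤ Real.cos (x / 2) := by
      have h1 := neg_le_of_abs_le hx2
      have h2 := le_of_abs_le hx2
      exact Real.cos_nonneg_of_neg_pi_div_two_le_of_le (by linarith) (by linarith)
    have hcos := Real.cos_le_one_sub_mul_cos_sq (x := x / 2) (by linarith)
    have hs : Real.sinc x = Real.sinc (x / 2) * Real.cos (x / 2) := by
      rw [Real.sinc_of_ne_zero hx0, Real.sinc_of_ne_zero (by positivity)]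
      conv_lhs => rw [show x = 2 * (x / 2) by ring, Real.sin_two_mul]
      field_simp
    have h1 : Real.sinc x ≤ Real.cos (x / 2) := by
      rw [hs]; exact mul_le_of_le_one_left hcos0 (Real.sinc_le_one _)
    have hpi2 : Real.pi ^ 2 ≤ 10 := by nlinarith [Real.pi_lt_d2]
    have h2 : x ^ 2 / 20 ≤ 2 / Real.pi ^ 2 * (x / 2) ^ 2 := by
      have : (1 : ℝ) / 10 ≤ 1 / Real.pi ^ 2 := one_div_le_one_div_of_le (by positivity) hpi2
      calc x ^ 2 / 20 = 1 / 10 * (x ^ 2 / 2) := by ring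
        _ ≤ 1 / Real.pi ^ 2 * (x ^ 2 / 2) := by gcongr
        _ = _ := by ring
    have := min_le_right 1 (x ^ 2)
    linarith

/-- The truncated square `min(1, T²‖v‖²)`; it is bounded, countably subadditive over orthogonal
sums, and its expectation controls tails and fractional moments. -/
noncomputable def truncSq {V : Type*} [ENorm V] (T : ℝ≥0) (v : V) : ℝ≥0∞ :=
  min 1 ((T : ℝ≥0∞) ^ 2 * ‖v‖ₑ ^ 2)

theorem truncSq_real (T : ℝ≥0) (x : ℝ) : truncSq T x = ENNReal.ofReal (min 1 ((T * x) ^ 2)) := by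
  rw [truncSq, ENNReal.ofReal_min, ENNReal.ofReal_one, mul_pow,
    ENNReal.ofReal_mul (by positivity), ← sq_abs x, ENNReal.ofReal_pow (abs_nonneg x),
    Real.enorm_eq_ofReal_abs, ENNReal.ofReal_pow T.coe_nonneg, ENNReal.ofReal_coe_nnreal]

theorem continuous_truncSq {V : Type*} [SeminormedAddCommGroup V] (T : ℝ≥0) :
    Continuous (truncSq T : V → ℝ≥0∞) := by
  unfold truncSq
  refine continuous_const.min (ENNReal.continuous_const_mul (by simp) |>.comp ?_)
  exact (ENNReal.continuous_pow 2).comp continuous_enorm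

theorem truncSq_add_le {V : Type*} [SeminormedAddCommGroup V] (T : ℝ≥0) (u v : V) :
    truncSq T (u + v) ≤ 2 * truncSq T u + 2 * truncSq T v := by
  unfold truncSq
  have h : (T : ℝ≥0∞) ^ 2 * ‖u + v‖ₑ ^ 2
      ≤ 2 * ((T : ℝ≥0∞) ^ 2 * ‖u‖ₑ ^ 2) + 2 * ((T : ℝ≥0∞) ^ 2 * ‖v‖ₑ ^ 2) := by
    have h1 : ‖u + v‖ₑ ^ 2 ≤ 2 * ‖u‖ₑ ^ 2 + 2 * ‖v‖ₑ ^ 2 := by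
      simp only [← ofReal_norm]
      rw [← ENNReal.ofReal_pow (norm_nonneg _), ← ENNReal.ofReal_pow (norm_nonneg _),
        ← ENNReal.ofReal_pow (norm_nonneg _), show (2 : ℝ≥0∞) = ENNReal.ofReal 2 by simp,
        ← ENNReal.ofReal_mul (by norm_num), ← ENNReal.ofReal_mul (by norm_num),
        ← ENNReal.ofReal_add (by positivity) (by positivity)]
      refine ENNReal.ofReal_le_ofReal ?_
      have := norm_add_le u v
      nlinarith [sq_nonneg (‖u‖ - ‖v‖), norm_nonneg (u + v), norm_nonneg u, norm_nonneg v]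
    calc _ ≤ (T : ℝ≥0∞) ^ 2 * (2 * ‖u‖ₑ ^ 2 + 2 * ‖v‖ₑ ^ 2) := by gcongr
      _ = _ := by ring
  rcases le_total 1 ((T : ℝ≥0∞) ^ 2 * ‖u‖ₑ ^ 2) with hu | hu
  · rw [min_eq_left hu]
    exact (min_le_left _ _).trans (le_add_right (by norm_num))
  rcases le_total 1 ((T : ℝ≥0∞) ^ 2 * ‖v‖ₑ ^ 2) with hv | hv
  · rw [min_eq_left hv]
    exact (min_le_left _ _).trans (le_add_left (by norm_num))
  rw [min_eq_right hu, min_eq_right hv]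
  exact (min_le_right _ _).trans h

variable {Ω : Type*} [MeasurableSpace Ω] {P : Measure Ω} [IsProbabilityMeasure P]

/-- Averaging the characteristic function over `[-T, T]` gives `∫ (1 - sinc (T X))`, which bounds
the truncated second moment. -/
theorem lintegral_truncSq_le_of_charFun {X : Ω → ℝ} (hX : AEMeasurable X P) {s α : ℝ}
    (hs : 0 ≤ s) (hα : 0 < α)
    (h : ∀ t, ‖1 - charFun (P.map X) t‖ ≤ s * |t| ^ α) (T : ℝ≥0) :
    ∫⁻ ω, truncSq T (X ω) ∂P ≤ ENNReal.ofReal (20 * (s * T ^ α)) := by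
  rcases eq_or_ne T 0 with rfl | hT0
  · simp [truncSq]
  have hT : (0 : ℝ) < T := NNReal.coe_pos.2 (pos_iff_ne_zero.2 hT0)
  have hprob : IsProbabilityMeasure (P.map X) := Measure.isProbabilityMeasure_map hX
  have hi := integral_charFun_Icc (μ := P.map X) hT
  have hsi : Integrable (fun x => Real.sinc (T * x)) (P.map X) :=
    Integrable.of_bound (C := 1) (Real.continuous_sinc.comp (by fun_prop)).aestronglyMeasurable
      (ae_of_all _ fun x => Real.abs_sinc_le_one _)
  have h1 : ∫ t in (-T : ℝ)..T, (1 - charFun (P.map X) t)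
      = ((2 * T * ∫ x, (1 - Real.sinc (T * x)) ∂(P.map X) : ℝ) : ℂ) := by
    rw [intervalIntegral.integral_sub intervalIntegrable_const intervalIntegrable_charFun, hi,
      integral_sub (integrable_const 1) hsi]
    simp
    ring
  have h2 : ‖∫ t in (-T : ℝ)..T, (1 - charFun (P.map X) t)‖ ≤ s * T ^ α * |T - (-T : ℝ)| := by
    refine intervalIntegral.norm_integral_le_of_norm_le_const fun t ht => (h t).trans ?_
    gcongr
    rw [Set.uIoc_of_le (by linarith)] at ht
    exact abs_le.2 ⟨ht.1.le, ht.2⟩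
  rw [h1, Complex.norm_real, Real.norm_eq_abs, sub_neg_eq_add, abs_of_pos (add_pos hT hT)] at h2
  have h3 := (le_abs_self _).trans h2
  have h4 : ∫ x, (1 - Real.sinc (T * x)) ∂(P.map X) ≤ s * T ^ α := by
    have : (2 * T : ℝ) * ∫ x, (1 - Real.sinc (T * x)) ∂(P.map X) ≤ (2 * T) * (s * T ^ α) := by
      linarith
    exact le_of_mul_le_mul_left this (by linarith)
  have hmap : ∫⁻ ω, truncSq T (X ω) ∂P = ∫⁻ x, truncSq T x ∂(P.map X) :=
    (lintegral_map' (continuous_truncSq T).measurable.aemeasurable hX).symm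
  rw [hmap]
  calc ∫⁻ x, truncSq T x ∂(P.map X)
      ≤ ∫⁻ x, ENNReal.ofReal (20 * (1 - Real.sinc (T * x))) ∂(P.map X) := by
        refine lintegral_mono fun x => ?_
        rw [truncSq_real]
        exact ENNReal.ofReal_le_ofReal (min_one_sq_le_one_sub_sinc _)
    _ = ENNReal.ofReal (∫ x, 20 * (1 - Real.sinc (T * x)) ∂(P.map X)) := by
        rw [ofReal_integral_eq_lintegral_ofReal]
        · exact ((integrable_const 1).sub hsi).const_mul 20
        · exact ae_of_all _ fun x => by
            have := Real.sinc_le_one (T * x)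
            simp only [Pi.zero_apply]
            linarith
    _ ≤ _ := by
        refine ENNReal.ofReal_le_ofReal ?_
        rw [integral_const_mul]
        gcongr

end Sinc

section StableIncrements

variable {Ω : Type*} [MeasurableSpace Ω] {P : Measure Ω} {α : ℝ} {ℓ : ℝ≥0 → Ω → ℝ}

theorem IsSymmetricStableProcess.charFun_increment (hℓ : IsSymmetricStableProcess P α ℓ)
    (hm : ∀ t, Measurable (ℓ t)) {s t : ℝ≥0} (hst : s ≤ t) (u : ℝ) :
    charFun (P.map fun ω => ℓ t ω - ℓ s ω) u = (Real.exp (-((t - s : ℝ) * |u| ^ α)) : ℂ) := by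
  have h1 := hℓ.stationary_increments s (t - s)
  rw [add_tsub_cancel_of_le hst] at h1
  rw [h1.map_eq, charFun_apply_real, integral_map (hm _).aemeasurable (by fun_prop)]
  have h2 := hℓ.char_fun (t - s) u
  rw [NNReal.coe_sub hst] at h2
  rw [← h2]
  refine integral_congr_ae (ae_of_all _ fun ω => ?_)
  simp only
  congr 1
  push_cast
  ring

/-- Joint law of weighted increments of a symmetric stable process. -/
theorem IsSymmetricStableProcess.charFun_sum_increments [IsProbabilityMeasure P]
    (hℓ : IsSymmetricStableProcess P α ℓ)
    (hm : ∀ t, Measurable (ℓ t)) {τ : ℕ → ℝ≥0} (hτ : Monotone τ) {ι : Type*} [Fintype ι]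
    {g : ι → ℕ} (hg : Function.Injective g) (c : ι → ℝ) (u : ℝ) :
    charFun (P.map fun ω => ∑ i, c i * (ℓ (τ (g i + 1)) ω - ℓ (τ (g i)) ω)) u
      = ∏ i, (Real.exp (-((τ (g i + 1) - τ (g i) : ℝ) * |c i * u| ^ α)) : ℂ) := by
  have hind := (hℓ.indep_increments.nat hτ).precomp hg
  have hmi : ∀ i, Measurable fun ω => ℓ (τ (g i + 1)) ω - ℓ (τ (g i)) ω :=
    fun i => (hm _).sub (hm _)
  have hind' : iIndepFun (fun i ω => c i * (ℓ (τ (g i + 1)) ω - ℓ (τ (g i)) ω)) P :=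
    hind.comp (fun i x => c i * x) (fun i => by fun_prop)
  rw [hind'.charFun_map_fun_sum_eq_prod (fun i => ((hmi i).const_mul _).aemeasurable),
    Finset.prod_apply]
  refine Finset.prod_congr rfl fun i _ => ?_
  rw [charFun_map_mul_comp (hmi i).aemeasurable, hℓ.charFun_increment hm (hτ (Nat.le_succ _))]

end StableIncrements

/-! ### Pathwise convolution of a càdlàg path with an exponential -/

section Cadlag

/-- Right-continuity with left limits, for a real path. -/
def IsCadlag (ℓ : ℝ≥0 → ℝ) : Prop :=
  ∀ t : ℝ≥0, Tendsto ℓ (𝓝[>] t) (𝓝 (ℓ t)) ∧ ∃ a : ℝ, Tendsto ℓ (𝓝[<] t) (𝓝 a)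

variable {ℓ : ℝ≥0 → ℝ}

theorem IsCadlag.continuousWithinAt (h : IsCadlag ℓ) (t : ℝ≥0) :
    Tendsto ℓ (𝓝[≥] t) (𝓝 (ℓ t)) := by
  rw [← Set.Ioi_insert, nhdsWithin_insert]
  exact (tendsto_pure_nhds ℓ t).sup (h t).1

theorem IsCadlag.tendsto_seq (h : IsCadlag ℓ) {t : ℝ≥0} {x : ℕ → ℝ≥0}
    (hx : Tendsto x atTop (𝓝 t)) (hle : ∀ᶠ n in atTop, t ≤ x n) :
    Tendsto (fun n => ℓ (x n)) atTop (𝓝 (ℓ t)) :=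
  (h.continuousWithinAt t).comp (tendsto_nhdsWithin_iff.2 ⟨hx, hle⟩)

theorem IsCadlag.exists_bound (h : IsCadlag ℓ) (t : ℝ≥0) :
    ∃ M : ℝ, ∀ r ≤ t, |ℓ r| ≤ M := by
  obtain ⟨M, hM⟩ : ∃ M : ℝ, ∀ r ∈ Set.Icc 0 t, |ℓ r| ≤ M := by
    refine (isCompact_Icc (a := (0 : ℝ≥0)) (b := t)).induction_on
      (p := fun s => ∃ M : ℝ, ∀ r ∈ s, |ℓ r| ≤ M) ⟨0, by simp⟩ ?_ ?_ ?_
    · rintro s s' hss ⟨M, hM⟩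
      exact ⟨M, fun r hr => hM r (hss hr)⟩
    · rintro s s' ⟨M, hM⟩ ⟨M', hM'⟩
      exact ⟨max M M', fun r hr => hr.elim (fun h => (hM r h).trans (le_max_left _ _))
        fun h => (hM' r h).trans (le_max_right _ _)⟩
    · intro x _
      obtain ⟨a, ha⟩ := (h x).2
      have h1 : ∀ᶠ r in 𝓝[<] x, |ℓ r| < |a| + 1 := ha.abs.eventually_lt_const (by linarith)
      have h2 : ∀ᶠ r in 𝓝[≥] x, |ℓ r| < |ℓ x| + 1 :=
        (h.continuousWithinAt x).abs.eventually_lt_const (by linarith)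
      have h3 : ∀ᶠ r in 𝓝 x, |ℓ r| ≤ max (|a| + 1) (|ℓ x| + 1) := by
        rw [← nhdsLT_sup_nhdsGE, eventually_sup]
        exact ⟨h1.mono fun r hr => hr.le.trans (le_max_left _ _),
          h2.mono fun r hr => hr.le.trans (le_max_right _ _)⟩
      exact ⟨_, mem_nhdsWithin_of_mem_nhds h3, _, fun r hr => hr⟩
  exact ⟨M, fun r hr => hM r ⟨zero_le, hr⟩⟩

theorem tendsto_ceil_mul_div (x : ℝ) (hx : 0 ≤ x) :
    Tendsto (fun n : ℕ => (⌈x * (n + 1)⌉₊ : ℝ) / (n + 1)) atTop (𝓝 x) := by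
  refine tendsto_of_tendsto_of_tendsto_of_le_of_le tendsto_const_nhds
    (h := fun n : ℕ => x + 1 / ((n : ℝ) + 1)) ?_ (fun n => ?_) fun n => ?_
  · simpa using tendsto_one_div_add_atTop_nhds_zero_nat.const_add x
  · rw [le_div_iff₀ (by positivity)]
    exact Nat.le_ceil _
  · have := Nat.ceil_lt_add_one (a := x * (n + 1)) (by positivity)
    simp only
    rw [div_le_iff₀ (by positivity), add_mul, one_div, inv_mul_cancel₀ (by positivity)]
    exact this.le

theorem IsCadlag.measurable (h : IsCadlag ℓ) : Measurable ℓ := by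
  refine measurable_of_tendsto_metrizable (f := fun n : ℕ => fun r : ℝ≥0 =>
    ℓ ((⌈(r : ℝ) * (n + 1)⌉₊ : ℝ≥0) / (n + 1))) (fun n => ?_) (tendsto_pi_nhds.2 fun r => ?_)
  · exact (measurable_from_nat (f := fun m : ℕ => ℓ ((m : ℝ≥0) / (n + 1)))).comp
      (Nat.measurable_ceil.comp (by fun_prop))
  · refine h.tendsto_seq ?_ (Eventually.of_forall fun n => ?_)
    · rw [← NNReal.tendsto_coe]
      push_cast
      exact tendsto_ceil_mul_div r r.coe_nonneg
    · rw [← NNReal.coe_le_coe]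
      push_cast
      rw [le_div_iff₀ (by positivity)]
      exact Nat.le_ceil _

theorem IsCadlag.intervalIntegrable (h : IsCadlag ℓ) (lam : ℝ) (t : ℝ≥0) {a b : ℝ} (hab : a ≤ b) :
    IntervalIntegrable (fun r : ℝ => Real.exp (-lam * (t - r)) * ℓ r.toNNReal) volume a b := by
  obtain ⟨M, hM⟩ := h.exists_bound b.toNNReal
  refine IntervalIntegrable.continuousOn_mul (f := fun r : ℝ => ℓ r.toNNReal) ?_
    (by fun_prop : Continuous fun r : ℝ => Real.exp (-lam * (t - r))).continuousOn
  rw [intervalIntegrable_iff_integrableOn_Ioc_of_le hab]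
  refine Measure.integrableOn_of_bounded (M := M) (by simp)
    (h.measurable.comp measurable_real_toNNReal).aestronglyMeasurable ?_
  refine (ae_restrict_iff' measurableSet_Ioc).2 (ae_of_all _ fun r hr => hM _ ?_)
  exact Real.toNNReal_le_toNNReal hr.2

end Cadlag

section PathConvolution

/-- The pathwise integral `∫ₛᵗ e^{-lam (t - r)} dℓ(r)`, written by integration by parts. -/
noncomputable def pathConv (lam : ℝ) (ℓ : ℝ≥0 → ℝ) (s t : ℝ≥0) : ℝ :=
  ℓ t - Real.exp (-lam * (t - s)) * ℓ s
    - lam * ∫ r in (s : ℝ)..t, Real.exp (-lam * (t - r)) * ℓ r.toNNReal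

/-- The `i`-th point of the uniform partition of `[s, t]` into `n + 1` intervals. -/
noncomputable def gridPt (s t : ℝ≥0) (n i : ℕ) : ℝ≥0 := s + (t - s) * i / (n + 1)

/-- The left-point Riemann sum of `∫ₛᵗ e^{-lam (t - r)} dℓ(r)` along a uniform partition. -/
noncomputable def riemannSum (lam : ℝ) (ℓ : ℝ≥0 → ℝ) (s t : ℝ≥0) (n : ℕ) : ℝ :=
  ∑ i ∈ Finset.range (n + 1), Real.exp (-lam * (t - gridPt s t n i))
    * (ℓ (gridPt s t n (i + 1)) - ℓ (gridPt s t n i))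

variable {ℓ : ℝ≥0 → ℝ} {s t : ℝ≥0}

theorem gridPt_mono (s t : ℝ≥0) (n : ℕ) : Monotone (gridPt s t n) := fun i j hij => by
  unfold gridPt
  gcongr

theorem gridPt_zero (s t : ℝ≥0) (n : ℕ) : gridPt s t n 0 = s := by simp [gridPt]

theorem gridPt_last (hst : s ≤ t) (n : ℕ) : gridPt s t n (n + 1) = t := by
  unfold gridPt
  push_cast
  rw [mul_div_cancel_right₀ _ (by positivity), add_tsub_cancel_of_le hst]

theorem gridPt_coe (hst : s ≤ t) (n i : ℕ) :
    (gridPt s t n i : ℝ) = s + (t - s) * i / (n + 1) := by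
  unfold gridPt
  push_cast [NNReal.coe_sub hst]
  rfl

theorem pathConv_self (lam : ℝ) (ℓ : ℝ≥0 → ℝ) (s : ℝ≥0) : pathConv lam ℓ s s = 0 := by
  simp [pathConv]

theorem IsCadlag.pathConv_add (h : IsCadlag ℓ) (lam : ℝ) {r : ℝ≥0} (hsr : s ≤ r) (hrt : r ≤ t) :
    pathConv lam ℓ s t
      = pathConv lam ℓ r t + Real.exp (-lam * (t - r)) * pathConv lam ℓ s r := by
  have h1 := intervalIntegral.integral_add_adjacent_intervals
    (h.intervalIntegrable lam t (NNReal.coe_le_coe.2 hsr))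
    (h.intervalIntegrable lam t (NNReal.coe_le_coe.2 hrt))
  have h2 : ∫ x in (s : ℝ)..r, Real.exp (-lam * (t - x)) * ℓ x.toNNReal
      = Real.exp (-lam * (t - r)) * ∫ x in (s : ℝ)..r, Real.exp (-lam *
          (r - x)) * ℓ x.toNNReal := by
    rw [← intervalIntegral.integral_const_mul]
    refine intervalIntegral.integral_congr fun x _ => ?_
    rw [← mul_assoc, ← Real.exp_add]
    ring_nf
  have h3 : Real.exp (-lam * (t - s)) = Real.exp (-lam * (t - r)) * Real.exp (-lam * (r - s)) := by
    rw [← Real.exp_add]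
    ring_nf
  unfold pathConv
  rw [← h1, h2, h3]
  ring

theorem sum_mul_sub_by_parts (g l : ℕ → ℝ) (N : ℕ) :
    ∑ i ∈ Finset.range N, g i * (l (i + 1) - l i)
      = g N * l N - g 0 * l 0 - ∑ i ∈ Finset.range N, l (i + 1) * (g (i + 1) - g i) := by
  induction N with
  | zero => simp
  | succ N ih =>
    rw [Finset.sum_range_succ, Finset.sum_range_succ, ih]
    ring

/-- Riemann sums along uniform partitions converge for every càdlàg path: after summation by parts
the integrator is sampled at the right end point of each interval, where right-continuity
applies. -/
theorem IsCadlag.tendsto_riemannSum (h : IsCadlag ℓ) {lam : ℝ} (hlam : 0 ≤ lam) (hst : s ≤ t) :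
    Tendsto (riemannSum lam ℓ s t) atTop (𝓝 (pathConv lam ℓ s t)) := by
  rcases hst.eq_or_lt with rfl | hlt
  · rw [pathConv_self]
    refine tendsto_const_nhds.congr fun n => ?_
    simp [riemannSum, gridPt]
  have hu : (0 : ℝ) < t - s := sub_pos.2 (NNReal.coe_lt_coe.2 hlt)
  obtain ⟨M, hM⟩ := h.exists_bound t
  -- `ce n r` is the right end point of the interval of the `n`-th partition that contains `r`
  set c : ℕ → ℝ → ℝ := fun n r => (r - s) / (t - s) * (n + 1) with hc
  set ce : ℕ → ℝ → ℝ≥0 := fun n r => gridPt s t n ⌈c n r⌉₊ with hce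
  set g : ℝ → ℝ := fun r => Real.exp (-lam * (t - r)) with hg
  have hgd : ∀ r, HasDerivAt g (lam * g r) r := fun r => by
    have : HasDerivAt g (Real.exp (-lam * (t - r)) * (-lam * (0 - 1))) r :=
      (((hasDerivAt_const r (t : ℝ)).sub (hasDerivAt_id r)).const_mul (-lam)).exp
    exact this.congr_deriv (by simp only [hg]; ring)
  have hgc : Continuous g := by fun_prop
  have hpiece : ∀ n i : ℕ, ∀ r ∈ Set.Ioc (gridPt s t n i : ℝ) (gridPt s t n (i + 1)),
      ce n r = gridPt s t n (i + 1) := by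
    intro n i r hr
    rw [gridPt_coe hst, gridPt_coe hst] at hr
    simp only [hce]
    congr 1
    rw [Nat.ceil_eq_iff (by simp)]
    simp only [hc, Nat.add_sub_cancel]
    have h1 := hr.1
    have h2 := hr.2
    have hn : (0 : ℝ) < n + 1 := by positivity
    constructor
    · rw [div_mul_eq_mul_div, lt_div_iff₀ hu]
      have : (t - s : ℝ) * i / (n + 1) < r - s := by linarith
      rw [div_lt_iff₀ hn] at this
      linarith
    · rw [div_mul_eq_mul_div, div_le_iff₀ hu]
      have : r - s ≤ (t - s : ℝ) * (i + 1 : ℕ) / (n + 1) := by linarith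
      rw [le_div_iff₀ hn] at this
      linarith
  have hpi : ∀ n i : ℕ, IntervalIntegrable (fun r => lam * g r * ℓ (ce n r)) volume
        (gridPt s t n i) (gridPt s t n (i + 1)) ∧
      ∫ r in (gridPt s t n i : ℝ)..gridPt s t n (i + 1), lam * g r * ℓ (ce n r)
        = ℓ (gridPt s t n (i + 1)) * (g (gridPt s t n (i + 1)) - g (gridPt s t n i)) := by
    intro n i
    have hle : (gridPt s t n i : ℝ) ≤ gridPt s t n (i + 1) :=
      NNReal.coe_le_coe.2 (gridPt_mono s t n i.le_succ)
    have heq : Set.EqOn (fun r => lam * g r * ℓ (gridPt s t n (i + 1)))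
        (fun r => lam * g r * ℓ (ce n r)) (Set.uIoc (gridPt s t n i : ℝ) (gridPt s t n
            (i + 1))) := by
      intro r hr
      rw [Set.uIoc_of_le hle] at hr
      simp only [hpiece n i r hr]
    have hi : IntervalIntegrable (fun r => lam * g r * ℓ (gridPt s t n (i + 1))) volume
        (gridPt s t n i) (gridPt s t n (i + 1)) :=
      (by fun_prop : Continuous fun r => lam * g r * ℓ (gridPt s t n
          (i + 1))).intervalIntegrable _ _
    refine ⟨hi.congr heq, ?_⟩
    rw [← intervalIntegral.integral_congr_ae (ae_of_all _ fun r hr => heq hr),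
        intervalIntegral.integral_mul_const,
      intervalIntegral.integral_eq_sub_of_hasDerivAt (fun r _ => hgd r)
        ((by fun_prop : Continuous fun r => lam * g r).intervalIntegrable _ _), mul_comm]
  have hsum : ∀ n, riemannSum lam ℓ s t n = ℓ t - g s * ℓ s
      - ∫ r in (s : ℝ)..t, lam * g r * ℓ (ce n r) := by
    intro n
    have h1 := intervalIntegral.sum_integral_adjacent_intervals (n := n + 1)
      (a := fun i => (gridPt s t n i : ℝ)) (f := fun r => lam * g r * ℓ (ce n r)) (μ := volume)
      (fun i _ => (hpi n i).1)
    rw [gridPt_zero, gridPt_last hst] at h1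
    rw [← h1, Finset.sum_congr rfl fun i _ => (hpi n i).2, riemannSum]
    have h2 := sum_mul_sub_by_parts (fun i => g (gridPt s t n i)) (fun i => ℓ
        (gridPt s t n i)) (n + 1)
    simp only [gridPt_zero, gridPt_last hst] at h2
    have h3 : g t = 1 := by simp [hg]
    rw [h3, one_mul] at h2
    exact h2
  have hlim : Tendsto (fun n => ∫ r in (s : ℝ)..t, lam * g r * ℓ (ce n r)) atTop
      (𝓝 (∫ r in (s : ℝ)..t, lam * g r * ℓ r.toNNReal)) := by
    refine intervalIntegral.tendsto_integral_filter_of_dominated_convergence (fun _ => lam * M)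
      (Eventually.of_forall fun n => ?_) (Eventually.of_forall fun n => ae_of_all _ fun r hr => ?_)
      intervalIntegrable_const (ae_of_all _ fun r hr => ?_)
    · refine (Measurable.mul (by fun_prop) ?_).aestronglyMeasurable
      exact (measurable_from_nat (f := fun m : ℕ => ℓ (gridPt s t n m))).comp
        (Nat.measurable_ceil.comp (by fun_prop))
    · rw [Set.uIoc_of_le (NNReal.coe_le_coe.2 hst)] at hr
      have h1 : g r ≤ 1 := by
        simp only [hg, Real.exp_le_one_iff]
        nlinarith [hr.2]
      have h2 : |ℓ (ce n r)| ≤ M := by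
        refine hM _ ?_
        refine (gridPt_mono s t n ?_).trans (gridPt_last hst n).le
        refine Nat.ceil_le.2 ?_
        push_cast
        exact mul_le_of_le_one_left (by positivity)
          ((div_le_one hu).2 (by linarith [hr.2]))
      rw [norm_mul, norm_mul, Real.norm_of_nonneg hlam, Real.norm_of_nonneg (Real.exp_nonneg _),
        Real.norm_eq_abs]
      have hM0 : 0 ≤ M := (abs_nonneg _).trans h2
      calc lam * g r * |ℓ (ce n r)| ≤ lam * 1 * M := by gcongr
        _ = lam * M := by ring
    · rw [Set.uIoc_of_le (NNReal.coe_le_coe.2 hst)] at hr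
      have hr0 : 0 ≤ r := s.coe_nonneg.trans hr.1.le
      refine Tendsto.const_mul _ (h.tendsto_seq ?_ (Eventually.of_forall fun n => ?_))
      · rw [← NNReal.tendsto_coe, Real.coe_toNNReal _ hr0]
        simp only [hce, gridPt_coe hst]
        have := ((tendsto_ceil_mul_div ((r - s) / (t - s))
          (div_nonneg (by linarith [hr.1]) hu.le)).const_mul (t - s : ℝ)).const_add (s : ℝ)
        rw [mul_div_cancel₀ _ hu.ne', add_sub_cancel] at this
        refine this.congr fun n => ?_
        simp only [hc]
        ring
      · rw [← NNReal.coe_le_coe, Real.coe_toNNReal _ hr0]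
        simp only [hce, gridPt_coe hst]
        have h1 := Nat.le_ceil (c n r)
        have h2 : r - s = (t - s) * c n r / (n + 1) := by
          simp only [hc]
          field_simp
        have h3 : (t - s : ℝ) * c n r / (n + 1) ≤ (t - s) * ⌈c n r⌉₊ / (n + 1) := by gcongr
        linarith
  have hfin : pathConv lam ℓ s t = ℓ t - g s * ℓ s - ∫ r in (s : ℝ)..t,
      lam * g r * ℓ r.toNNReal := by
    unfold pathConv
    rw [← intervalIntegral.integral_const_mul]
    simp only [hg, mul_assoc]
  rw [hfin]
  exact (tendsto_const_nhds.sub hlim).congr fun n => (hsum n).symm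

end PathConvolution

/-! ### Orthogonal series with random coefficients -/

section OrthogonalSeries

variable {H : Type*} [NormedAddCommGroup H] [InnerProductSpace ℝ H]

theorem HilbertBasis.norm_sum_smul_sq (e : HilbertBasis ℕ ℝ H) (a : ℕ → ℝ) (s : Finset ℕ) :
    ‖∑ k ∈ s, a k • e k‖ ^ 2 = ∑ k ∈ s, ‖a k‖ ^ 2 :=
  e.orthonormal.orthogonalFamily.norm_sum a s

theorem HilbertBasis.summable_smul_iff [CompleteSpace H] (e : HilbertBasis ℕ ℝ H) (a : ℕ → ℝ) :
    (Summable fun k => a k • e k) ↔ Summable fun k => ‖a k‖ ^ 2 :=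
  e.orthonormal.orthogonalFamily.summable_iff_norm_sq_summable a

theorem truncSq_sum_le (e : HilbertBasis ℕ ℝ H) (a : ℕ → ℝ) (T : ℝ≥0) (s : Finset ℕ) :
    truncSq T (∑ k ∈ s, a k • e k) ≤ ∑ k ∈ s, truncSq T (a k) := by
  have h1 : ‖∑ k ∈ s, a k • e k‖ₑ ^ 2 = ∑ k ∈ s, ‖a k‖ₑ ^ 2 := by
    simp only [← ofReal_norm, ← ENNReal.ofReal_pow (norm_nonneg _)]
    rw [e.norm_sum_smul_sq, ENNReal.ofReal_sum_of_nonneg fun _ _ => by positivity]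
  have h2 : ∀ (X : ℕ → ℝ≥0∞) (s : Finset ℕ), min 1 (∑ k ∈ s, X k) ≤ ∑ k ∈ s, min 1 (X k) := by
    intro X s
    by_cases h : ∃ k ∈ s, 1 ≤ X k
    · obtain ⟨k, hk, hk1⟩ := h
      refine (min_le_left _ _).trans ?_
      exact (min_eq_left hk1).ge.trans
        (Finset.single_le_sum (f := fun k => min 1 (X k)) (fun _ _ => zero_le) hk)
    · push Not at h
      refine (min_le_right _ _).trans (Finset.sum_le_sum fun k hk => ?_)
      rw [min_eq_right (h k hk).le]
  unfold truncSq
  rw [h1, Finset.mul_sum]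
  exact h2 _ _

theorem truncSq_tsum_le (e : HilbertBasis ℕ ℝ H) (a : ℕ → ℝ) (T : ℝ≥0) :
    truncSq T (∑' k, a k • e k) ≤ ∑' k, truncSq T (a k) := by
  by_cases h : Summable fun k => a k • e k
  · refine le_of_tendsto (((continuous_truncSq T).tendsto _).comp h.hasSum)
      (Eventually.of_forall fun s => ?_)
    exact (truncSq_sum_le e a T s).trans (ENNReal.sum_le_tsum s)
  · rw [tsum_eq_zero_of_not_summable h]
    simp [truncSq]

variable {Ω : Type*} [MeasurableSpace Ω] {P : Measure Ω}

/-- The expected truncated square of an orthogonal series is at most the sum of those of its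
coordinates; no independence of the coordinates is needed. -/
theorem lintegral_truncSq_tsum_le (e : HilbertBasis ℕ ℝ H) {a : ℕ → Ω → ℝ}
    (ha : ∀ k, AEMeasurable (a k) P) {d : ℕ → ℝ} (hd0 : ∀ k, 0 ≤ d k) (hd : Summable d) {α : ℝ}
    (h : ∀ k (T : ℝ≥0), ∫⁻ ω, truncSq T (a k ω) ∂P ≤ ENNReal.ofReal (d k * T ^ α)) (T : ℝ≥0) :
    ∫⁻ ω, truncSq T (∑' k, a k ω • e k) ∂P ≤ ENNReal.ofReal ((∑' k, d k) * T ^ α) := by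
  calc ∫⁻ ω, truncSq T (∑' k, a k ω • e k) ∂P
      ≤ ∫⁻ ω, ∑' k, truncSq T (a k ω) ∂P := lintegral_mono fun ω => truncSq_tsum_le e _ T
    _ = ∑' k, ∫⁻ ω, truncSq T (a k ω) ∂P :=
        lintegral_tsum fun k => (continuous_truncSq T).measurable.comp_aemeasurable (ha k)
    _ ≤ ∑' k, ENNReal.ofReal (d k * T ^ α) := ENNReal.tsum_le_tsum fun k => h k T
    _ = ENNReal.ofReal (∑' k, d k * T ^ α) :=
        (ENNReal.ofReal_tsum_of_nonneg
          (fun k => mul_nonneg (hd0 k) (Real.rpow_nonneg T.coe_nonneg _)) (hd.mul_right _)).symm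
    _ = _ := by rw [tsum_mul_right]

theorem ae_summable_smul_of_truncSq [CompleteSpace H] (e : HilbertBasis ℕ ℝ H) {a : ℕ → Ω → ℝ}
    (ha : ∀ k, AEMeasurable (a k) P) {d : ℕ → ℝ} (hd0 : ∀ k, 0 ≤ d k) (hd : Summable d)
    (h : ∀ k, ∫⁻ ω, truncSq 1 (a k ω) ∂P ≤ ENNReal.ofReal (d k)) :
    ∀ᵐ ω ∂P, Summable fun k => a k ω • e k := by
  have hfin : ∫⁻ ω, ∑' k, truncSq 1 (a k ω) ∂P ≠ ∞ := by
    rw [lintegral_tsum (f := fun k ω => truncSq 1 (a k ω))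
      fun k => (continuous_truncSq 1).measurable.comp_aemeasurable (ha k)]
    refine ne_top_of_le_ne_top ?_ (ENNReal.tsum_le_tsum h)
    rw [← ENNReal.ofReal_tsum_of_nonneg hd0 hd]
    exact ENNReal.ofReal_ne_top
  have hm : AEMeasurable (fun ω => ∑' k, truncSq 1 (a k ω)) P :=
    AEMeasurable.tsum fun k => (continuous_truncSq 1).measurable.comp_aemeasurable (ha k)
  filter_upwards [ae_lt_top' hm hfin] with ω hω
  rw [e.summable_smul_iff]
  have h1 : ∀ k, truncSq 1 (a k ω) = ENNReal.ofReal (min 1 (a k ω ^ 2)) := fun k => by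
    rw [truncSq_real]; simp
  have h2 : Summable fun k => min 1 (a k ω ^ 2) := by
    have h3 := ENNReal.summable_toReal hω.ne
    refine h3.congr fun k => ?_
    rw [h1, ENNReal.toReal_ofReal (by positivity)]
  have h3 : ∀ᶠ k in atTop, min 1 (a k ω ^ 2) = ‖a k ω‖ ^ 2 := by
    filter_upwards [h2.tendsto_atTop_zero.eventually_lt_const one_pos] with k hk
    rw [Real.norm_eq_abs, sq_abs]
    rcases min_lt_iff.1 hk with h | h
    · exact absurd h (lt_irrefl _)
    · exact min_eq_right h.le
  exact (summable_congr_atTop h3).1 h2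

/-- The constant of the moment estimate `lintegral_rpow_le_of_truncSq`. -/
noncomputable def momentConst (p α : ℝ) : ℝ := 1 + p / (α - p)

/-- A tail bound of order `α`, in the form of truncated second moments, controls moments of order
`p < α`. -/
theorem lintegral_rpow_le_of_truncSq {B : Type*} [NormedAddCommGroup B] [MeasurableSpace B]
    [BorelSpace B] [IsProbabilityMeasure P] {V : Ω → B}
    (hV : AEMeasurable V P) {p α D : ℝ} (hp : 0 < p) (hpα : p < α) (hD : 0 < D)
    (h : ∀ T : ℝ≥0, ∫⁻ ω, truncSq T (V ω) ∂P ≤ ENNReal.ofReal (D * T ^ α)) :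
    ∫⁻ ω, ‖V ω‖ₑ ^ p ∂P ≤ ENNReal.ofReal (momentConst p α * D ^ (p / α)) := by
  have hα : 0 < α := hp.trans hpα
  -- the layer-cake integral is split where the tail bound becomes smaller than `1`
  set δ : ℝ := D ^ (1 / α) with hδ
  have hδ0 : 0 < δ := Real.rpow_pos_of_pos hD _
  have htail : ∀ t : ℝ, 0 < t → P {ω | t ≤ ‖V ω‖} ≤ ENNReal.ofReal (D * t ^ (-α)) := by
    intro t ht
    have h1 : ∀ ω, t ≤ ‖V ω‖ → 1 ≤ truncSq (t⁻¹).toNNReal (V ω) := fun ω hω => by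
      refine le_min le_rfl ?_
      rw [← mul_pow, ← ofReal_norm, ENNReal.ofNNReal_toNNReal, ← ENNReal.ofReal_mul (by positivity)]
      refine one_le_pow₀ ?_
      rw [ENNReal.one_le_ofReal, inv_mul_eq_div, le_div_iff₀ ht, one_mul]
      exact hω
    have h2 := meas_ge_le_lintegral_div (μ := P) (f := fun ω => truncSq (t⁻¹).toNNReal (V ω))
      ((continuous_truncSq _).measurable.comp_aemeasurable hV) one_ne_zero ENNReal.one_ne_top
    rw [div_one] at h2
    refine (measure_mono fun ω hω => h1 ω hω).trans (h2.trans ((h _).trans_eq ?_))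
    rw [Real.coe_toNNReal _ (by positivity), Real.inv_rpow ht.le, Real.rpow_neg ht.le]
  have hlc := lintegral_rpow_eq_lintegral_meas_le_mul P (f := fun ω => ‖V ω‖)
    (ae_of_all _ fun ω => norm_nonneg _) hV.norm hp
  have hconv : ∫⁻ ω, ‖V ω‖ₑ ^ p ∂P = ∫⁻ ω, ENNReal.ofReal (‖V ω‖ ^ p) ∂P := by
    refine lintegral_congr fun ω => ?_
    rw [← ofReal_norm, ENNReal.ofReal_rpow_of_nonneg (norm_nonneg _) hp.le]
  rw [hconv, hlc, ← Set.Ioc_union_Ioi_eq_Ioi hδ0.le, lintegral_union measurableSet_Ioi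
    (Set.Ioc_disjoint_Ioi le_rfl)]
  have hA : ∫⁻ t in Set.Ioc 0 δ, P {ω | t ≤ ‖V ω‖} * ENNReal.ofReal (t ^ (p - 1))
      ≤ ENNReal.ofReal (δ ^ p / p) := by
    calc _ ≤ ∫⁻ t in Set.Ioc 0 δ, ENNReal.ofReal (t ^ (p - 1)) :=
          lintegral_mono fun t => mul_le_of_le_one_left zero_le prob_le_one
      _ = ENNReal.ofReal (∫ t in Set.Ioc 0 δ, t ^ (p - 1)) := by
          rw [ofReal_integral_eq_lintegral_ofReal]
          · exact (intervalIntegral.intervalIntegrable_rpow' (by linarith)).1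
          · exact (ae_restrict_iff' measurableSet_Ioc).2
              (ae_of_all _ fun t ht => Real.rpow_nonneg ht.1.le _)
      _ = _ := by
          rw [← intervalIntegral.integral_of_le hδ0.le, integral_rpow (Or.inl (by linarith))]
          congr 1
          rw [sub_add_cancel, Real.zero_rpow hp.ne', sub_zero]
  have hB : ∫⁻ t in Set.Ioi δ, P {ω | t ≤ ‖V ω‖} * ENNReal.ofReal (t ^ (p - 1))
      ≤ ENNReal.ofReal (D * (δ ^ (p - α) / (α - p))) := by
    calc _ ≤ ∫⁻ t in Set.Ioi δ, ENNReal.ofReal (D * t ^ (p - 1 - α)) := by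
          refine setLIntegral_mono' measurableSet_Ioi fun t ht => ?_
          have ht0 : 0 < t := hδ0.trans ht
          refine (mul_le_mul_left (htail t ht0) _).trans_eq ?_
          rw [← ENNReal.ofReal_mul (by positivity), mul_assoc, ← Real.rpow_add ht0]
          ring_nf
      _ = ENNReal.ofReal (∫ t in Set.Ioi δ, D * t ^ (p - 1 - α)) := by
          rw [ofReal_integral_eq_lintegral_ofReal]
          · exact (integrableOn_Ioi_rpow_of_lt (by linarith) hδ0).const_mul D
          · exact (ae_restrict_iff' measurableSet_Ioi).2 (ae_of_all _ fun t ht =>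
              mul_nonneg hD.le (Real.rpow_nonneg (hδ0.trans ht).le _))
      _ = _ := by
          rw [integral_const_mul, integral_Ioi_rpow_of_lt (by linarith) hδ0]
          congr 2
          rw [show p - 1 - α + 1 = -(α - p) by ring, neg_div_neg_eq]
          congr 2
          ring
  have hpα' : 0 < α - p := by linarith
  calc _ ≤ ENNReal.ofReal p * (ENNReal.ofReal (δ ^ p / p)
        + ENNReal.ofReal (D * (δ ^ (p - α) / (α - p)))) := by gcongr
    _ = ENNReal.ofReal (p * (δ ^ p / p + D * (δ ^ (p - α) / (α - p)))) := by
        rw [← ENNReal.ofReal_add (by positivity) (by positivity), ← ENNReal.ofReal_mul hp.le]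
    _ = _ := by
        congr 1
        have e1 : δ ^ p = D ^ (p / α) := by
          rw [hδ, ← Real.rpow_mul hD.le]; congr 1; ring
        have e2 : D * δ ^ (p - α) = D ^ (p / α) := by
          rw [hδ, ← Real.rpow_mul hD.le]
          nth_rw 1 [← Real.rpow_one D]
          rw [← Real.rpow_add hD]
          congr 1
          field_simp
          ring
        rw [← mul_div_assoc, e1, e2, momentConst]
        field_simp

end OrthogonalSeries

section SubSigmaAlgebra

theorem stronglyMeasurable_limUnder_seq {Ω V : Type*} {m : MeasurableSpace Ω}
    [TopologicalSpace V] [TopologicalSpace.IsCompletelyMetrizableSpace V] [Nonempty V]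
    {f : ℕ → Ω → V} (hf : ∀ n, StronglyMeasurable (f n)) :
    StronglyMeasurable fun ω => limUnder atTop fun n => f n ω :=
  StronglyMeasurable.limUnder hf

/-- An almost sure limit is measurable for a sub-`σ`-algebra up to modification, even if the
sub-`σ`-algebra contains no null sets. -/
theorem aestronglyMeasurable_sub_of_tendsto_ae {Ω V : Type*} {m m₀ : MeasurableSpace Ω}
    {P : Measure[m₀] Ω} [TopologicalSpace V] [TopologicalSpace.IsCompletelyMetrizableSpace V]
        [Nonempty V]
    {f : ℕ → Ω → V} {g : Ω → V} (hf : ∀ n, AEStronglyMeasurable[m] (f n) P)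
    (h : ∀ᵐ ω ∂P, Tendsto (fun n => f n ω) atTop (𝓝 (g ω))) : AEStronglyMeasurable[m] g P := by
  choose f' hf' hae using hf
  refine ⟨_, stronglyMeasurable_limUnder_seq hf', ?_⟩
  filter_upwards [h, ae_all_iff.2 hae] with ω hω hω'
  exact (Tendsto.limUnder_eq (hω.congr hω')).symm

end SubSigmaAlgebra

/-! ### Coordinates of the stochastic convolution -/

section CoordinateConvolution

variable {Ω : Type*} [MeasurableSpace Ω] {P : Measure Ω} {α : ℝ} {ℓ : ℝ≥0 → Ω → ℝ}

theorem IsSymmetricStableProcess.ae_isCadlag (hℓ : IsSymmetricStableProcess P α ℓ) :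
    ∀ᵐ ω ∂P, IsCadlag fun r => ℓ r ω := hℓ.cadlag

/-- The left-point Riemann sum of `∫₀ᵘ e^{-lam (u - r)} dr` is at most `min u (1 / lam)`. -/
theorem sum_exp_grid_le {lam : ℝ} (hlam : 0 < lam) {s t : ℝ≥0} (hst : s ≤ t) (n : ℕ) :
    ∑ i ∈ Finset.range (n + 1), (gridPt s t n (i + 1) - gridPt s t n i : ℝ)
      * Real.exp (-lam * (t - gridPt s t n i)) ≤ min (t - s : ℝ) (1 / lam) := by
  set h : ℝ := (t - s) / (n + 1) with hh
  have hu : (0 : ℝ) ≤ t - s := sub_nonneg.2 (NNReal.coe_le_coe.2 hst)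
  have hh0 : 0 ≤ h := by positivity
  have hn : (0 : ℝ) < n + 1 := by positivity
  have hstep : ∀ i : ℕ, (gridPt s t n (i + 1) - gridPt s t n i : ℝ) = h := fun i => by
    rw [gridPt_coe hst, gridPt_coe hst, hh]
    push_cast
    field_simp
    ring
  have hpt : ∀ i : ℕ, (t : ℝ) - gridPt s t n i = (n + 1 - i) * h := fun i => by
    rw [gridPt_coe hst, hh]
    field_simp
    ring
  simp only [hstep]
  rw [← Finset.mul_sum]
  refine le_min ?_ ?_
  · calc h * ∑ i ∈ Finset.range (n + 1), Real.exp (-lam * (t - gridPt s t n i))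
        ≤ h * ∑ i ∈ Finset.range (n + 1), (1 : ℝ) := by
          gcongr with i hi
          rw [Real.exp_le_one_iff, hpt]
          have : (i : ℝ) ≤ n + 1 := by
            have := Finset.mem_range.1 hi
            exact_mod_cast this.le
          have : 0 ≤ (n + 1 - i : ℝ) * h := mul_nonneg (by linarith) hh0
          nlinarith
      _ = t - s := by
          rw [hh]
          simp
          field_simp
  · set q : ℝ := Real.exp (-lam * h) with hq
    have hq0 : 0 < q := Real.exp_pos _
    have hterm : ∀ i ∈ Finset.range (n + 1), Real.exp (-lam * (t - gridPt s t n i))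
        = q ^ (n - i) * q := fun i hi => by
      have hi' : i ≤ n := Nat.lt_succ_iff.1 (Finset.mem_range.1 hi)
      rw [← pow_succ, hq, ← Real.exp_nat_mul, hpt]
      push_cast [Nat.cast_sub hi']
      ring_nf
    rw [Finset.sum_congr rfl hterm, ← Finset.sum_mul]
    have hrefl : ∑ i ∈ Finset.range (n + 1), q ^ (n - i) = ∑ i ∈ Finset.range (n + 1), q ^ i := by
      have := Finset.sum_range_reflect (fun i => q ^ i) (n + 1)
      simpa using this
    rw [hrefl]
    have hgeom : (∑ i ∈ Finset.range (n + 1), q ^ i) * (1 - q) ≤ 1 := by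
      have := geom_sum_mul_neg q (n + 1)
      rw [this]
      linarith [pow_pos hq0 (n + 1)]
    -- `lam h q ≤ 1 - q` because `1 + lam h ≤ e^{lam h}`
    have hkey : lam * h * q ≤ 1 - q := by
      have h1 : (lam * h + 1) * q ≤ Real.exp (lam * h) * q := by
        gcongr
        exact Real.add_one_le_exp _
      have h2 : Real.exp (lam * h) * q = 1 := by
        rw [hq, ← Real.exp_add]
        simp
      linarith
    have hS : 0 ≤ ∑ i ∈ Finset.range (n + 1), q ^ i := Finset.sum_nonneg fun i _ => by positivity
    rw [le_div_iff₀ hlam]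
    calc h * ((∑ i ∈ Finset.range (n + 1), q ^ i) * q) * lam
        = (∑ i ∈ Finset.range (n + 1), q ^ i) * (lam * h * q) := by ring
      _ ≤ (∑ i ∈ Finset.range (n + 1), q ^ i) * (1 - q) := by gcongr
      _ ≤ 1 := hgeom

theorem measurable_riemannSum {Ω : Type*} {m : MeasurableSpace Ω} {ℓ : ℝ≥0 → Ω → ℝ}
    (lam : ℝ) {s t : ℝ≥0}
    (hst : s ≤ t) (hm : ∀ r ≤ t, Measurable (ℓ r)) (n : ℕ) :
    Measurable fun ω => riemannSum lam (fun r => ℓ r ω) s t n := by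
  unfold riemannSum
  have hle : ∀ i ∈ Finset.range (n + 1), gridPt s t n (i + 1) ≤ t := fun i hi =>
    (gridPt_mono s t n (Nat.succ_le_of_lt (Finset.mem_range.1 hi))).trans (gridPt_last hst n).le
  refine Finset.measurable_fun_sum _ fun i hi => Measurable.const_mul ?_ _
  exact (hm _ (hle i hi)).sub (hm _ ((gridPt_mono s t n i.le_succ).trans (hle i hi)))

variable [IsProbabilityMeasure P]

/-- The convolution of a symmetric `α`-stable process with an exponential has truncated second
moments of order `α`, with scale `min (t - s) (1 / lam)`. -/
theorem IsSymmetricStableProcess.lintegral_truncSq_pathConv_le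
    (hℓ : IsSymmetricStableProcess P α ℓ) (hm : ∀ t, Measurable (ℓ t)) (hα : 1 ≤ α) {lam : ℝ}
    (hlam : 0 < lam) {s t : ℝ≥0} (hst : s ≤ t) (T : ℝ≥0) :
    ∫⁻ ω, truncSq T (pathConv lam (fun r => ℓ r ω) s t) ∂P
      ≤ ENNReal.ofReal (20 * (min (t - s : ℝ) (1 / lam) * T ^ α)) := by
  have hmin0 : 0 ≤ min (t - s : ℝ) (1 / lam) :=
    le_min (sub_nonneg.2 (NNReal.coe_le_coe.2 hst)) (by positivity)
  have hR : ∀ n, ∫⁻ ω, truncSq T (riemannSum lam (fun r => ℓ r ω) s t n) ∂P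
      ≤ ENNReal.ofReal (20 * (min (t - s : ℝ) (1 / lam) * T ^ α)) := by
    intro n
    refine lintegral_truncSq_le_of_charFun
      (measurable_riemannSum lam hst (fun r _ => hm r) n).aemeasurable hmin0 (by linarith)
      (fun u => ?_) T
    have hcf := hℓ.charFun_sum_increments hm (gridPt_mono s t n)
      (g := fun i : Fin (n + 1) => (i : ℕ)) Fin.val_injective
      (fun i => Real.exp (-lam * (t - gridPt s t n i))) u
    have hsum : (fun ω => riemannSum lam (fun r => ℓ r ω) s t n)
        = fun ω => ∑ i : Fin (n + 1), Real.exp (-lam * (t - gridPt s t n i))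
          * (ℓ (gridPt s t n (i + 1)) ω - ℓ (gridPt s t n i) ω) := by
      funext ω
      rw [riemannSum, Finset.sum_range]
    rw [hsum, hcf, ← Complex.ofReal_prod, ← Real.exp_sum, ← Complex.ofReal_one,
      ← Complex.ofReal_sub, Complex.norm_real, Finset.sum_neg_distrib]
    set ρ := ∑ i : Fin (n + 1), (gridPt s t n (i + 1) - gridPt s t n i : ℝ)
      * |Real.exp (-lam * (t - gridPt s t n i)) * u| ^ α with hρ
    have hstep : ∀ i : ℕ, (0 : ℝ) ≤ gridPt s t n (i + 1) - gridPt s t n i := fun i =>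
      sub_nonneg.2 (NNReal.coe_le_coe.2 (gridPt_mono s t n i.le_succ))
    have hρ0 : 0 ≤ ρ := Finset.sum_nonneg fun i _ => mul_nonneg (hstep i) (by positivity)
    have h1 : ‖1 - Real.exp (-ρ)‖ ≤ ρ := by
      rw [Real.norm_of_nonneg (by rw [sub_nonneg, Real.exp_le_one_iff]; linarith)]
      linarith [Real.add_one_le_exp (-ρ)]
    refine h1.trans ?_
    have h2 : ρ ≤ (∑ i ∈ Finset.range (n + 1), (gridPt s t n (i + 1) - gridPt s t n i : ℝ)
        * Real.exp (-lam * (t - gridPt s t n i))) * |u| ^ α := by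
      rw [hρ, Finset.sum_range, Finset.sum_mul]
      refine Finset.sum_le_sum fun i _ => ?_
      rw [mul_assoc]
      refine mul_le_mul_of_nonneg_left ?_ (hstep i)
      rw [abs_mul, Real.mul_rpow (abs_nonneg _) (abs_nonneg _), Real.abs_exp]
      refine mul_le_mul_of_nonneg_right ?_ (by positivity)
      have hle1 : Real.exp (-lam * (t - gridPt s t n i)) ≤ 1 := by
        rw [Real.exp_le_one_iff]
        have : gridPt s t n i ≤ t :=
          (gridPt_mono s t n i.2.le).trans (gridPt_last hst n).le
        have := NNReal.coe_le_coe.2 this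
        nlinarith
      exact (Real.rpow_le_rpow_of_exponent_ge (Real.exp_pos _) hle1 hα).trans_eq (Real.rpow_one _)
    exact h2.trans (mul_le_mul_of_nonneg_right (sum_exp_grid_le hlam hst n) (by positivity))
  have hfatou : ∫⁻ ω, truncSq T (pathConv lam (fun r => ℓ r ω) s t) ∂P
      ≤ ∫⁻ ω, liminf (fun n => truncSq T (riemannSum lam (fun r => ℓ r ω) s t n)) atTop ∂P := by
    refine lintegral_mono_ae ?_
    filter_upwards [hℓ.ae_isCadlag] with ω hω
    exact (((continuous_truncSq T).tendsto _).comp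
      (hω.tendsto_riemannSum hlam.le hst)).liminf_eq.ge
  refine hfatou.trans ((lintegral_liminf_le fun n => ?_).trans ?_)
  · exact (continuous_truncSq T).measurable.comp
      (measurable_riemannSum lam hst (fun r _ => hm r) n)
  · refine (liminf_le_liminf (Eventually.of_forall hR)).trans ?_
    simp

theorem IsSymmetricStableProcess.aestronglyMeasurable_pathConv {Ω : Type*}
    {m m₀ : MeasurableSpace Ω} {P : Measure[m₀] Ω} {ℓ : ℝ≥0 → Ω → ℝ}
    (hℓ : IsSymmetricStableProcess P α ℓ)
    {lam : ℝ} (hlam : 0 ≤ lam) {s t : ℝ≥0} (hst : s ≤ t) (hm : ∀ r ≤ t, Measurable[m] (ℓ r)) :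
    AEStronglyMeasurable[m] (fun ω => pathConv lam (fun r => ℓ r ω) s t) P := by
  refine aestronglyMeasurable_sub_of_tendsto_ae
    (f := fun n ω => riemannSum lam (fun r => ℓ r ω) s t n) (fun n => ?_) ?_
  · exact ⟨_, (measurable_riemannSum lam hst hm n).stronglyMeasurable, ae_eq_refl _⟩
  · filter_upwards [hℓ.ae_isCadlag] with ω hω
    exact hω.tendsto_riemannSum hlam hst

theorem truncSq_mul (T c : ℝ≥0) (x : ℝ) : truncSq T ((c : ℝ) * x) = truncSq (T * c) x := by
  unfold truncSq
  rw [enorm_mul, mul_pow, ENNReal.coe_mul, mul_pow, mul_assoc]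
  simp

end CoordinateConvolution

/-! ### The stochastic convolution -/

section Noise

variable {Ω H : Type*} [m : MeasurableSpace Ω] {P : Measure Ω} {ℱ : Filtration ℝ≥0 m} {α : ℝ}
  [NormedAddCommGroup H] [InnerProductSpace ℝ H]

/-- A cylindrical stable process `∑ₖ γₖ Z^k eₖ` whose convolution with the semigroup of the operator
with eigenvalues `-lam k` takes values in the Hilbert space, with bounded moments of
order less than `α`. -/
structure IsConvolvableNoise (P : Measure Ω) (ℱ : Filtration ℝ≥0 m) (α : ℝ) (lam γ : ℕ → ℝ)
    (Z : ℕ → ℝ≥0 → Ω → ℝ) : Prop where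
  cyl : IsCylindricalStable P ℱ α Z
  one_lt : 1 < α
  lam_pos : ∀ k, 0 < lam k
  coef_nonneg : ∀ k, 0 ≤ γ k
  summable : Summable fun k => γ k ^ α / lam k

/-- The stochastic convolution `∫ₛᵗ e^{(t - r)A} dZ_r`, given by its coordinates. Outside the almost
sure event on which the series converges it has the junk value `0`. -/
noncomputable def noise (e : HilbertBasis ℕ ℝ H) (lam γ : ℕ → ℝ) (Z : ℕ → ℝ≥0 → Ω → ℝ)
    (s t : ℝ≥0) (ω : Ω) : H :=
  ∑' k, (γ k * pathConv (lam k) (fun r => Z k r ω) s t) • e k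

variable {e : HilbertBasis ℕ ℝ H} {lam γ : ℕ → ℝ} {Z : ℕ → ℝ≥0 → Ω → ℝ}

omit m in
theorem noise_self (s : ℝ≥0) (ω : Ω) : noise e lam γ Z s s ω = 0 := by
  simp [noise, pathConv_self]

namespace IsConvolvableNoise

theorem measurable (hZ : IsConvolvableNoise P ℱ α lam γ Z) (k : ℕ) (t : ℝ≥0) :
    Measurable (Z k t) :=
  (hZ.cyl.adapted k t).mono (ℱ.le t) le_rfl

theorem ae_isCadlag (hZ : IsConvolvableNoise P ℱ α lam γ Z) :
    ∀ᵐ ω ∂P, ∀ k, IsCadlag fun r => Z k r ω :=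
  ae_all_iff.2 fun k => (hZ.cyl.stable k).ae_isCadlag

theorem aestronglyMeasurable_coord (hZ : IsConvolvableNoise P ℱ α lam γ Z) (k : ℕ) {s t : ℝ≥0}
    (hst : s ≤ t) :
    AEStronglyMeasurable[ℱ t] (fun ω => γ k * pathConv (lam k) (fun r => Z k r ω) s t) P :=
  ((hZ.cyl.stable k).aestronglyMeasurable_pathConv (hZ.lam_pos k).le hst fun r hr =>
    (hZ.cyl.adapted k r).mono (ℱ.mono hr) le_rfl).const_mul _

theorem aemeasurable_coord (hZ : IsConvolvableNoise P ℱ α lam γ Z) (k : ℕ) {s t : ℝ≥0}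
    (hst : s ≤ t) : AEMeasurable (fun ω => γ k * pathConv (lam k) (fun r => Z k r ω) s t) P :=
  ((hZ.aestronglyMeasurable_coord k hst).mono (ℱ.le t)).aemeasurable

variable [IsProbabilityMeasure P]

theorem lintegral_truncSq_coord_le (hZ : IsConvolvableNoise P ℱ α lam γ Z) {c : ℕ → ℝ}
    (hc : ∀ k, 0 ≤ c k) (k : ℕ) {s t : ℝ≥0} (hst : s ≤ t) (T : ℝ≥0) :
    ∫⁻ ω, truncSq T (c k * pathConv (lam k) (fun r => Z k r ω) s t) ∂P
      ≤ ENNReal.ofReal (20 * (c k ^ α * min (t - s : ℝ) (1 / lam k)) * T ^ α) := by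
  have h := (hZ.cyl.stable k).lintegral_truncSq_pathConv_le (hZ.measurable k) hZ.one_lt.le
    (hZ.lam_pos k) hst (T * (c k).toNNReal)
  have hck : (((c k).toNNReal : ℝ≥0) : ℝ) = c k := Real.coe_toNNReal _ (hc k)
  simp_rw [← truncSq_mul, hck] at h
  refine h.trans_eq ?_
  rw [NNReal.coe_mul, Real.mul_rpow T.coe_nonneg (by positivity), hck]
  ring_nf

omit [IsProbabilityMeasure P] in
theorem summable_scale (hZ : IsConvolvableNoise P ℱ α lam γ Z) {u : ℝ} (hu : 0 ≤ u) :
    Summable fun k => 20 * (γ k ^ α * min u (1 / lam k)) := by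
  refine Summable.mul_left _ (hZ.summable.of_nonneg_of_le (fun k => ?_) fun k => ?_)
  · have := hZ.coef_nonneg k
    have := hZ.lam_pos k
    positivity
  · rw [div_eq_mul_one_div (γ k ^ α)]
    exact mul_le_mul_of_nonneg_left (min_le_right _ _) (Real.rpow_nonneg (hZ.coef_nonneg k) _)

theorem ae_summable [CompleteSpace H] (hZ : IsConvolvableNoise P ℱ α lam γ Z) {s t : ℝ≥0}
    (hst : s ≤ t) :
    ∀ᵐ ω ∂P, Summable fun k => (γ k * pathConv (lam k) (fun r => Z k r ω) s t) • e k := by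
  have hu : (0 : ℝ) ≤ t - s := sub_nonneg.2 (NNReal.coe_le_coe.2 hst)
  refine ae_summable_smul_of_truncSq e (fun k => hZ.aemeasurable_coord k hst) (fun k => ?_)
    (hZ.summable_scale hu) fun k => ?_
  · have := hZ.coef_nonneg k
    have := hZ.lam_pos k
    positivity
  · simpa using hZ.lintegral_truncSq_coord_le hZ.coef_nonneg k hst 1

theorem lintegral_truncSq_noise_le (hZ : IsConvolvableNoise P ℱ α lam γ Z) {s t : ℝ≥0}
    (hst : s ≤ t) (T : ℝ≥0) :
    ∫⁻ ω, truncSq T (noise e lam γ Z s t ω) ∂P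
      ≤ ENNReal.ofReal ((∑' k, 20 * (γ k ^ α / lam k)) * T ^ α) := by
  have hterm : ∀ k, 0 ≤ γ k ^ α / lam k := fun k =>
    div_nonneg (Real.rpow_nonneg (hZ.coef_nonneg k) _) (hZ.lam_pos k).le
  refine lintegral_truncSq_tsum_le e (fun k => hZ.aemeasurable_coord k hst)
    (fun k => mul_nonneg (by norm_num) (hterm k)) (hZ.summable.mul_left 20) (fun k T => ?_) T
  refine (hZ.lintegral_truncSq_coord_le hZ.coef_nonneg k hst T).trans (ENNReal.ofReal_le_ofReal ?_)
  have h1 := hZ.coef_nonneg k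
  rw [div_eq_mul_one_div (γ k ^ α)]
  refine mul_le_mul_of_nonneg_right (mul_le_mul_of_nonneg_left ?_ (by norm_num))
    (Real.rpow_nonneg T.coe_nonneg _)
  exact mul_le_mul_of_nonneg_left (min_le_right _ _) (Real.rpow_nonneg h1 _)

theorem aestronglyMeasurable_noise [CompleteSpace H]
    (hZ : IsConvolvableNoise P ℱ α lam γ Z) {s t : ℝ≥0} (hst : s ≤ t) :
    AEStronglyMeasurable[ℱ t] (noise e lam γ Z s t) P := by
  refine aestronglyMeasurable_sub_of_tendsto_ae
    (f := fun n ω => ∑ k ∈ Finset.range n, (γ k * pathConv (lam k) (fun r => Z k r ω) s t) • e k)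
    (fun n => ?_) ?_
  · induction n with
    | zero => simpa using aestronglyMeasurable_const
    | succ n ih =>
      simp only [Finset.sum_range_succ]
      exact ih.add ((hZ.aestronglyMeasurable_coord n hst).smul_const (e n))
  · filter_upwards [hZ.ae_summable (e := e) hst] with ω hω
    exact hω.hasSum.tendsto_sum_nat

/-- Flow property of the stochastic convolution. -/
theorem noise_add [CompleteSpace H] {A : H →ₗ.[ℝ] H} {S : ℝ≥0 → H →L[ℝ] H}
    (hS : IsSemigroupGeneratedBy A S) (hAe : ∀ k, (e k, -(lam k) • e k) ∈ A.graph)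
    (hZ : IsConvolvableNoise P ℱ α lam γ Z) {s r t : ℝ≥0} (hsr : s ≤ r) (hrt : r ≤ t) :
    ∀ᵐ ω ∂P, noise e lam γ Z s t ω
      = noise e lam γ Z r t ω + S (t - r) (noise e lam γ Z s r ω) := by
  filter_upwards [hZ.ae_summable (e := e) hrt, hZ.ae_summable (e := e) hsr, hZ.ae_isCadlag]
    with ω h1 h2 h3
  unfold noise
  rw [(S (t - r)).map_tsum h2, ← h1.tsum_add (h2.mapL (S (t - r)))]
  refine tsum_congr fun k => ?_
  rw [map_smul, hS.apply_eigenvector (hAe k), smul_smul, ← add_smul, (h3 k).pathConv_add _ hsr hrt,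
    NNReal.coe_sub hrt]
  ring_nf

omit [IsProbabilityMeasure P] in
theorem noise_eq_stochConvolution {A : H →ₗ.[ℝ] H} {S : ℝ≥0 → H →L[ℝ] H}
    (hS : IsSemigroupGeneratedBy A S) (hAe : ∀ k, (e k, -(lam k) • e k) ∈ A.graph)
    (hZ : IsConvolvableNoise P ℱ α lam γ Z) (t : ℝ≥0) :
    ∀ᵐ ω ∂P, noise e lam γ Z 0 t ω = stochConvolution S e γ Z t ω := by
  filter_upwards [hZ.ae_isCadlag] with ω hω
  unfold noise stochConvolution
  refine tsum_congr fun k => ?_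
  rw [mul_smul]
  congr 1
  refine (Tendsto.limUnder_eq ?_).symm
  refine (((hω k).tendsto_riemannSum (hZ.lam_pos k).le (zero_le (a := t))).smul_const (e k)).congr
    fun n => ?_
  rw [riemannSum, Finset.sum_smul]
  refine Finset.sum_congr rfl fun i hi => ?_
  have hi' : (i : ℝ≥0) ≤ n + 1 := by exact_mod_cast (Finset.mem_range.1 hi).le
  have hle : t * i / (n + 1) ≤ t := by
    rw [div_le_iff₀ (by positivity)]
    gcongr
  simp only [gridPt, zero_add, tsub_zero]
  rw [hS.apply_eigenvector (hAe k), smul_smul, mul_comm, NNReal.coe_sub hle]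
  push_cast
  rfl

/-- Scale of the `k`-th coordinate of an increment of the stochastic convolution over a time `u`:
the first summand stems from the new noise, the second one from the decay of the old convolution. -/
noncomputable def incrementScale (α : ℝ) (lam γ : ℕ → ℝ) (u : ℝ) (k : ℕ) : ℝ :=
  40 * (γ k ^ α * (min u (1 / lam k) + (1 - Real.exp (-lam k * u)) ^ α * (1 / lam k)))

omit [IsProbabilityMeasure P] in
theorem incrementScale_nonneg (hZ : IsConvolvableNoise P ℱ α lam γ Z) {u : ℝ} (hu : 0 ≤ u) (k : ℕ) :
    0 ≤ incrementScale α lam γ u k := by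
  have h1 := hZ.coef_nonneg k
  have h2 := hZ.lam_pos k
  have h3 : 0 ≤ 1 - Real.exp (-lam k * u) := by
    rw [sub_nonneg, Real.exp_le_one_iff]
    nlinarith
  unfold incrementScale
  positivity

omit [IsProbabilityMeasure P] in
theorem incrementScale_le (hZ : IsConvolvableNoise P ℱ α lam γ Z) {u : ℝ} (hu : 0 ≤ u) (k : ℕ) :
    incrementScale α lam γ u k ≤ 80 * (γ k ^ α / lam k) := by
  have h1 := hZ.coef_nonneg k
  have h2 := hZ.lam_pos k
  have h3 : 0 ≤ 1 - Real.exp (-lam k * u) := by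
    rw [sub_nonneg, Real.exp_le_one_iff]
    nlinarith
  have h4 : (1 - Real.exp (-lam k * u)) ^ α ≤ 1 :=
    Real.rpow_le_one h3 (by linarith [Real.exp_pos (-lam k * u)]) (by linarith [hZ.one_lt])
  unfold incrementScale
  calc _ ≤ 40 * (γ k ^ α * (1 / lam k + 1 * (1 / lam k))) := by
        gcongr
        exact min_le_right _ _
    _ = _ := by ring

omit [IsProbabilityMeasure P] in
theorem summable_incrementScale (hZ : IsConvolvableNoise P ℱ α lam γ Z) {u : ℝ} (hu : 0 ≤ u) :
    Summable (incrementScale α lam γ u) :=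
  (hZ.summable.mul_left 80).of_nonneg_of_le (hZ.incrementScale_nonneg hu) (hZ.incrementScale_le hu)

omit [IsProbabilityMeasure P] in
theorem tendsto_tsum_incrementScale (hZ : IsConvolvableNoise P ℱ α lam γ Z) :
    Tendsto (fun u => ∑' k, incrementScale α lam γ u k) (𝓝[≥] 0) (𝓝 0) := by
  have h0 : ∑' _ : ℕ, (0 : ℝ) = 0 := tsum_zero
  refine (congrArg 𝓝 h0) ▸ (tendsto_tsum_of_dominated_convergence (g := fun _ => (0 : ℝ))
    (hZ.summable.mul_left 80) (fun k => ?_) ?_)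
  · have hα0 : 0 < α := by linarith [hZ.one_lt]
    have hc : Continuous fun u => incrementScale α lam γ u k := by
      unfold incrementScale
      have : Continuous fun u : ℝ => (1 - Real.exp (-lam k * u)) ^ α :=
        Continuous.rpow_const (by fun_prop) fun _ => Or.inr hα0.le
      fun_prop
    have h1 := hc.tendsto 0
    have h2 : incrementScale α lam γ 0 k = 0 := by
      have : min 0 (1 / lam k) = 0 := min_eq_left (one_div_nonneg.2 (hZ.lam_pos k).le)
      simp only [incrementScale, this]
      simp [Real.zero_rpow hα0.ne']
    rw [h2] at h1
    exact h1.mono_left nhdsWithin_le_nhds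
  · filter_upwards [self_mem_nhdsWithin] with u hu k
    rw [Real.norm_of_nonneg (hZ.incrementScale_nonneg hu k)]
    exact hZ.incrementScale_le hu k

/-- The increment over `[s, t]` is the new noise on `[s, t]` minus the part `1 - e^{-lam k (t - s)}`
of the old convolution; both are estimated coordinate by coordinate. -/
theorem lintegral_truncSq_noise_sub_le [CompleteSpace H] (hZ : IsConvolvableNoise P ℱ α lam γ Z)
    {s t : ℝ≥0} (hst : s ≤ t) (T : ℝ≥0) :
    ∫⁻ ω, truncSq T (noise e lam γ Z 0 t ω - noise e lam γ Z 0 s ω) ∂P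
      ≤ ENNReal.ofReal ((∑' k, incrementScale α lam γ (t - s) k) * T ^ α) := by
  have hu : (0 : ℝ) ≤ t - s := sub_nonneg.2 (NNReal.coe_le_coe.2 hst)
  set c : ℕ → ℝ := fun k => γ k * (1 - Real.exp (-lam k * (t - s))) with hc
  have hexp : ∀ k, 0 ≤ 1 - Real.exp (-lam k * (t - s)) := fun k => by
    have := hZ.lam_pos k
    rw [sub_nonneg, Real.exp_le_one_iff]
    nlinarith
  have hc0 : ∀ k, 0 ≤ c k := fun k => mul_nonneg (hZ.coef_nonneg k) (hexp k)
  set a : ℕ → Ω → ℝ := fun k ω => γ k * pathConv (lam k) (fun r => Z k r ω) 0 t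
    - γ k * pathConv (lam k) (fun r => Z k r ω) 0 s with ha
  have heq : ∀ᵐ ω ∂P, noise e lam γ Z 0 t ω - noise e lam γ Z 0 s ω = ∑' k, a k ω • e k := by
    filter_upwards [hZ.ae_summable (e := e) (zero_le (a := t)),
      hZ.ae_summable (e := e) (zero_le (a := s))] with ω h1 h2
    unfold noise
    rw [← h1.tsum_sub h2]
    simp only [ha, sub_smul]
  rw [lintegral_congr_ae (heq.mono fun ω hω => by
    rw [hω])]
  refine lintegral_truncSq_tsum_le e (fun k => (hZ.aemeasurable_coord k zero_le).sub
    (hZ.aemeasurable_coord k zero_le)) (hZ.incrementScale_nonneg hu)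
    (hZ.summable_incrementScale hu) (fun k T => ?_) T
  have hsplit : ∀ᵐ ω ∂P, truncSq T (a k ω)
      ≤ 2 * truncSq T (γ k * pathConv (lam k) (fun r => Z k r ω) s t)
        + 2 * truncSq T (c k * pathConv (lam k) (fun r => Z k r ω) 0 s) := by
    filter_upwards [hZ.ae_isCadlag] with ω hω
    have h1 := (hω k).pathConv_add (lam k) (zero_le (a := s)) hst
    have h2 : a k ω = γ k * pathConv (lam k) (fun r => Z k r ω) s t
        + -(c k * pathConv (lam k) (fun r => Z k r ω) 0 s) := by
      simp only [ha, hc, h1]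
      ring
    rw [h2]
    refine (truncSq_add_le T _ _).trans_eq ?_
    congr 2
    simp only [truncSq, enorm_neg]
  have hme : AEMeasurable
      (fun ω => 2 * truncSq T (γ k * pathConv (lam k) (fun r => Z k r ω) s t)) P :=
    ((continuous_truncSq T).measurable.comp_aemeasurable
      (hZ.aemeasurable_coord k hst)).const_mul 2
  refine (lintegral_mono_ae hsplit).trans ?_
  rw [lintegral_add_left' hme, lintegral_const_mul' _ _ (by simp),
    lintegral_const_mul' _ _ (by simp)]
  have h1 := hZ.lintegral_truncSq_coord_le hZ.coef_nonneg k hst T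
  have h2 := hZ.lintegral_truncSq_coord_le hc0 k (zero_le (a := s)) T
  have hg := hZ.coef_nonneg k
  have hl := hZ.lam_pos k
  have hT0 : (0 : ℝ) ≤ (T : ℝ) ^ α := Real.rpow_nonneg T.coe_nonneg _
  have hm1 : 0 ≤ min (t - s : ℝ) (1 / lam k) := le_min hu (by positivity)
  have hm2 : 0 ≤ min ((s : ℝ) - (0 : ℝ≥0)) (1 / lam k) := le_min (by simp) (by positivity)
  calc _ ≤ ENNReal.ofReal 2 * ENNReal.ofReal (20 * (γ k ^ α * min (t - s : ℝ) (1 / lam k)) * T ^ α)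
        + ENNReal.ofReal 2
          * ENNReal.ofReal (20 * (c k ^ α * min ((s : ℝ) - (0 : ℝ≥0)) (1 / lam k)) * T ^ α) := by
        rw [show ENNReal.ofReal 2 = 2 by simp]
        gcongr
    _ = ENNReal.ofReal (2 * (20 * (γ k ^ α * min (t - s : ℝ) (1 / lam k)) * T ^ α)
        + 2 * (20 * (c k ^ α * min ((s : ℝ) - (0 : ℝ≥0)) (1 / lam k)) * T ^ α)) := by
        have := hc0 k
        rw [← ENNReal.ofReal_mul (by norm_num), ← ENNReal.ofReal_mul (by norm_num),
          ← ENNReal.ofReal_add (by positivity) (by positivity)]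
    _ ≤ _ := by
        refine ENNReal.ofReal_le_ofReal ?_
        have h3 : c k ^ α = γ k ^ α * (1 - Real.exp (-lam k * (t - s))) ^ α :=
          Real.mul_rpow hg (hexp k)
        have h4 : 0 ≤ γ k ^ α * (1 - Real.exp (-lam k * (t - s))) ^ α :=
          mul_nonneg (Real.rpow_nonneg hg _) (Real.rpow_nonneg (hexp k) _)
        rw [h3, incrementScale]
        calc _ ≤ 2 * (20 * (γ k ^ α * min (t - s : ℝ) (1 / lam k)) * T ^ α)
            + 2 * (20 * (γ k ^ α * (1 - Real.exp (-lam k * (t - s))) ^ α *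
                (1 / lam k)) * T ^ α) := by
              gcongr
              exact min_le_right _ _
          _ = _ := by ring

end IsConvolvableNoise

end Noise

/-! ### The stochastic convolution as a curve in `L^p` -/

section LpBasics

variable {Ω H : Type*} [m : MeasurableSpace Ω] {P : Measure Ω} [NormedAddCommGroup H] {p : ℝ}

theorem eLpNorm_ofReal_eq (hp : 0 < p) (f : Ω → H) :
    eLpNorm f (ENNReal.ofReal p) P = (∫⁻ ω, ‖f ω‖ₑ ^ p ∂P) ^ (1 / p) := by
  rw [eLpNorm_eq_lintegral_rpow_enorm_toReal (by simpa using hp) ENNReal.ofReal_ne_top,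
    ENNReal.toReal_ofReal hp.le]

theorem memLp_ofReal_iff (hp : 0 < p) {f : Ω → H} (hf : AEStronglyMeasurable f P) :
    MemLp f (ENNReal.ofReal p) P ↔ ∫⁻ ω, ‖f ω‖ₑ ^ p ∂P < ∞ := by
  rw [MemLp, eLpNorm_ofReal_eq hp, and_iff_right hf, ENNReal.rpow_lt_top_iff_of_pos (by positivity)]

theorem lintegral_rpow_enorm_lp (hp : 0 < p) (f : Lp H (ENNReal.ofReal p) P) :
    ∫⁻ ω, ‖f ω‖ₑ ^ p ∂P = ENNReal.ofReal (‖f‖ ^ p) := by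
  have h1 : ENNReal.ofReal ‖f‖ = eLpNorm f (ENNReal.ofReal p) P := by
    rw [Lp.norm_def, ENNReal.ofReal_toReal (Lp.eLpNorm_ne_top f)]
  have h0 : 0 ≤ ‖f‖ := ENNReal.toReal_nonneg
  have h2 : ENNReal.ofReal (‖f‖ ^ p) = ENNReal.ofReal ‖f‖ ^ p :=
    (ENNReal.ofReal_rpow_of_nonneg h0 hp.le).symm
  rw [h2, h1, eLpNorm_ofReal_eq hp, ← ENNReal.rpow_mul, one_div, inv_mul_cancel₀ hp.ne',
      ENNReal.rpow_one]

theorem Lp_norm_le_of_ae_le [IsProbabilityMeasure P] {q : ℝ≥0∞} [hq : Fact (1 ≤ q)]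
    {f g : Lp H q P} {b K : ℝ} (hb : 0 ≤ b) (hK : 0 ≤ K)
    (h : ∀ᵐ ω ∂P, ‖f ω‖ ≤ b + K * ‖g ω‖) : ‖f‖ ≤ b + K * ‖g‖ := by
  have hg := (Lp.memLp g).norm.const_mul K
  have hbm : MemLp (fun _ : Ω => b) q P := memLp_const b
  have h1 : eLpNorm f q P ≤ eLpNorm ((fun _ : Ω => b) + fun ω => K * ‖g ω‖) q P :=
    eLpNorm_mono_ae_real h
  have h2 := h1.trans (eLpNorm_add_le hbm.1 hg.1 hq.out)
  have hq0 : q ≠ 0 := (zero_lt_one.trans_le hq.out).ne'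
  have h3 : eLpNorm (fun ω => K * ‖g ω‖) q P = ENNReal.ofReal K * eLpNorm g q P := by
    have := eLpNorm_const_smul K (fun ω => ‖g ω‖) q P
    rw [eLpNorm_norm, Real.enorm_of_nonneg hK] at this
    exact this
  rw [eLpNorm_const b hq0 (NeZero.ne P), h3, measure_univ, ENNReal.one_rpow, mul_one,
    Real.enorm_of_nonneg hb] at h2
  have h4 := ENNReal.toReal_mono (ENNReal.add_ne_top.2 ⟨ENNReal.ofReal_ne_top,
    ENNReal.mul_ne_top ENNReal.ofReal_ne_top (Lp.eLpNorm_ne_top g)⟩) h2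
  rw [ENNReal.toReal_add ENNReal.ofReal_ne_top
    (ENNReal.mul_ne_top ENNReal.ofReal_ne_top (Lp.eLpNorm_ne_top g)), ENNReal.toReal_mul,
    ENNReal.toReal_ofReal hb, ENNReal.toReal_ofReal hK] at h4
  exact h4

end LpBasics

section LpSemigroup

variable {Ω H : Type*} [m : MeasurableSpace Ω] {P : Measure Ω} [NormedAddCommGroup H]
  [NormedSpace ℝ H] {p : ℝ} [Fact (1 ≤ ENNReal.ofReal p)]

/-- A strongly continuous decaying semigroup acts on random variables, `ω` by `ω`. -/
theorem IsDecaySemigroup.compLpL {S : ℝ≥0 → H →L[ℝ] H} {lam : ℝ} (hS : IsDecaySemigroup S lam)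
    (hp : 0 < p) :
    IsDecaySemigroup (fun t => (S t).compLpL (ENNReal.ofReal p) P) lam where
  map_zero := by
    ext f : 1
    refine Lp.ext ?_
    filter_upwards [(S 0).coeFn_compLpL f] with ω hω
    rw [hω, hS.map_zero]
    rfl
  map_add s t := by
    ext f : 1
    refine Lp.ext ?_
    filter_upwards [(S (s + t)).coeFn_compLpL f, (S t).coeFn_compLpL f,
      (S s).coeFn_compLpL ((S t).compLpL (ENNReal.ofReal p) P f)] with ω h1 h2 h3
    rw [h1, ContinuousLinearMap.comp_apply, h3, h2, hS.map_add]
    rfl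
  continuous f := by
    refine continuous_iff_continuousAt.2 fun t => ?_
    rw [ContinuousAt, tendsto_iff_edist_tendsto_0]
    have hed : ∀ s, edist ((S s).compLpL (ENNReal.ofReal p) P f)
        ((S t).compLpL (ENNReal.ofReal p) P f)
        = (∫⁻ ω, ‖S s (f ω) - S t (f ω)‖ₑ ^ p ∂P) ^ (1 / p) := fun s => by
      rw [Lp.edist_def, eLpNorm_ofReal_eq hp]
      congr 1
      refine lintegral_congr_ae ?_
      filter_upwards [(S s).coeFn_compLpL f, (S t).coeFn_compLpL f] with ω h1 h2
      rw [Pi.sub_apply, h1, h2]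
    simp_rw [hed]
    have hlim : Tendsto (fun s => ∫⁻ ω, ‖S s (f ω) - S t (f ω)‖ₑ ^ p ∂P) (𝓝 t)
        (𝓝 (∫⁻ _, 0 ∂P)) := by
      have hfm := (Lp.memLp f).1
      refine tendsto_lintegral_filter_of_dominated_convergence' (fun ω => (2 * ‖f ω‖ₑ) ^ p)
        (Eventually.of_forall fun s => ?_) (Eventually.of_forall fun s => ae_of_all _ fun ω => ?_)
            ?_
        (ae_of_all _ fun ω => ?_)
      · exact (((S s).continuous.comp_aestronglyMeasurable hfm).sub
          ((S t).continuous.comp_aestronglyMeasurable hfm)).enorm.pow_const p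
      · refine ENNReal.rpow_le_rpow ?_ hp.le
        refine (enorm_sub_le).trans ?_
        rw [two_mul]
        gcongr <;> exact enorm_le_iff_norm_le.2 (hS.norm_apply_le _ _)
      · simp_rw [ENNReal.mul_rpow_of_nonneg _ _ hp.le]
        rw [lintegral_const_mul' _ _ (by simp), lintegral_rpow_enorm_lp hp]
        exact ENNReal.mul_ne_top (by simp) ENNReal.ofReal_ne_top
      · have h1 : Tendsto (fun s => ‖S s (f ω) - S t (f ω)‖ₑ) (𝓝 t) (𝓝 ‖S t (f ω) - S t (f ω)‖ₑ) :=
          (((hS.continuous (f ω)).tendsto t).sub_const _).enorm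
        rw [sub_self, enorm_zero] at h1
        have h2 := (ENNReal.continuous_rpow_const (y := p)).tendsto 0 |>.comp h1
        rwa [ENNReal.zero_rpow_of_pos hp] at h2
    rw [lintegral_zero] at hlim
    have h2 := (ENNReal.continuous_rpow_const (y := 1 / p)).tendsto 0 |>.comp hlim
    rwa [ENNReal.zero_rpow_of_pos (by positivity)] at h2
  norm_le t f := by
    refine ((S t).compLpL (ENNReal.ofReal p) P).le_of_opNorm_le ?_ f
    refine (ContinuousLinearMap.norm_compLpL_le (S t)).trans ?_
    exact ContinuousLinearMap.opNorm_le_bound _ (Real.exp_nonneg _) (hS.norm_le t)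
  nonneg := hS.nonneg

theorem compLpL_mem_lpMeas {Ω H : Type*} {m' m₀ : MeasurableSpace Ω} {P : Measure[m₀] Ω}
    [NormedAddCommGroup H] [NormedSpace ℝ H] {p : ℝ} [Fact (1 ≤ ENNReal.ofReal p)]
    {S : H →L[ℝ] H} {f : Lp H (ENNReal.ofReal p) P} (hf : f ∈ lpMeas H ℝ m' (ENNReal.ofReal p) P) :
    S.compLpL (ENNReal.ofReal p) P f ∈ lpMeas H ℝ m' (ENNReal.ofReal p) P := by
  rw [mem_lpMeas_iff_aestronglyMeasurable] at hf ⊢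
  exact (S.continuous.comp_aestronglyMeasurable hf).congr (S.coeFn_compLpL f).symm

end LpSemigroup

section NoiseCurve

variable {Ω H : Type*} [m : MeasurableSpace Ω] {P : Measure Ω} [IsProbabilityMeasure P]
  {ℱ : Filtration ℝ≥0 m} {α p : ℝ} [NormedAddCommGroup H] [InnerProductSpace ℝ H] [CompleteSpace H]
  [MeasurableSpace H] [BorelSpace H] {e : HilbertBasis ℕ ℝ H} {lam γ : ℕ → ℝ}
  {Z : ℕ → ℝ≥0 → Ω → ℝ}

theorem momentConst_pos (hp : 0 < p) (hpα : p < α) : 0 < momentConst p α := by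
  have : 0 < α - p := by linarith
  unfold momentConst
  positivity

theorem IsConvolvableNoise.memLp_noise (hZ : IsConvolvableNoise P ℱ α lam γ Z) (hp : 0 < p)
    (hpα : p < α) {s t : ℝ≥0} (hst : s ≤ t) :
    MemLp (noise e lam γ Z s t) (ENNReal.ofReal p) P := by
  have hm := (hZ.aestronglyMeasurable_noise (e := e) hst).mono (ℱ.le t)
  rw [memLp_ofReal_iff hp hm]
  refine (lintegral_rpow_le_of_truncSq hm.aemeasurable hp hpα
    (D := ∑' k, 20 * (γ k ^ α / lam k) + 1) ?_ fun T => ?_).trans_lt ENNReal.ofReal_lt_top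
  · have : 0 ≤ ∑' k, 20 * (γ k ^ α / lam k) := tsum_nonneg fun k =>
      mul_nonneg (by norm_num) (div_nonneg (Real.rpow_nonneg (hZ.coef_nonneg k) _)
        (hZ.lam_pos k).le)
    linarith
  · refine (hZ.lintegral_truncSq_noise_le hst T).trans (ENNReal.ofReal_le_ofReal ?_)
    gcongr
    linarith

/-- The stochastic convolution is a bounded continuous adapted curve of `p`-integrable random
variables. -/
theorem IsConvolvableNoise.exists_noiseCurve [Fact (1 ≤ ENNReal.ofReal p)]
    (hZ : IsConvolvableNoise P ℱ α lam γ Z) (hp : 0 < p) (hpα : p < α) :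
    ∃ w : ℝ≥0 → Lp H (ENNReal.ofReal p) P, Continuous w ∧ (∃ M, ∀ t, ‖w t‖ ≤ M) ∧ w 0 = 0 ∧
      (∀ t, w t ∈ lpMeas H ℝ (ℱ t) (ENNReal.ofReal p) P) ∧
      ∀ t, w t =ᵐ[P] noise e lam γ Z 0 t := by
  set w : ℝ≥0 → Lp H (ENNReal.ofReal p) P := fun t =>
    (hZ.memLp_noise (e := e) hp hpα (zero_le (a := t))).toLp _ with hw
  have hwae : ∀ t, w t =ᵐ[P] noise e lam γ Z 0 t := fun t => MemLp.coeFn_toLp _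
  have hmc := momentConst_pos hp hpα
  have hα : 0 < α := hp.trans hpα
  refine ⟨w, ?_, ?_, ?_, fun t => ?_, hwae⟩
  · have key : ∀ ε : ℝ, 0 < ε → ∃ δ : ℝ, 0 < δ ∧ ∀ s t : ℝ≥0, s ≤ t → (t - s : ℝ) < δ →
        ‖w t - w s‖ ≤ ε := by
      intro ε hε
      set D : ℝ := (ε ^ p / momentConst p α) ^ (α / p) with hD
      have hD0 : 0 < D := by positivity
      have hDε : momentConst p α * D ^ (p / α) = ε ^ p := by
        rw [hD, ← Real.rpow_mul (by positivity), show α / p * (p / α) = 1 by field_simp,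
          Real.rpow_one]
        field_simp
      have hev := hZ.tendsto_tsum_incrementScale.eventually_lt_const hD0
      rw [eventually_iff, mem_nhdsGE_iff_exists_Ico_subset] at hev
      obtain ⟨δ, hδ, hsub⟩ := hev
      refine ⟨δ, hδ, fun s t hst hlt => ?_⟩
      have hu : (0 : ℝ) ≤ t - s := sub_nonneg.2 (NNReal.coe_le_coe.2 hst)
      have hlt' : ∑' k, incrementScale α lam γ (t - s) k < D := hsub ⟨hu, hlt⟩
      have hm : AEStronglyMeasurable
          (fun ω => noise e lam γ Z 0 t ω - noise e lam γ Z 0 s ω) P :=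
        ((hZ.aestronglyMeasurable_noise zero_le).mono (ℱ.le t)).sub
          ((hZ.aestronglyMeasurable_noise zero_le).mono (ℱ.le s))
      have h1 := lintegral_rpow_le_of_truncSq hm.aemeasurable hp hpα hD0 fun T =>
        (hZ.lintegral_truncSq_noise_sub_le (e := e) hst T).trans
          (ENNReal.ofReal_le_ofReal (by gcongr))
      rw [hDε] at h1
      have h2 : ∫⁻ ω, ‖(w t - w s) ω‖ₑ ^ p ∂P ≤ ENNReal.ofReal (ε ^ p) := by
        refine le_trans (lintegral_congr_ae ?_).le h1
        filter_upwards [Lp.coeFn_sub (w t) (w s), hwae t, hwae s] with ω e1 e2 e3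
        rw [e1, Pi.sub_apply, e2, e3]
      rw [lintegral_rpow_enorm_lp hp, ENNReal.ofReal_le_ofReal_iff (by positivity)] at h2
      exact (Real.rpow_le_rpow_iff (norm_nonneg _) hε.le hp).1 h2
    refine Metric.continuous_iff.2 fun t ε hε => ?_
    obtain ⟨δ, hδ, h⟩ := key (ε / 2) (half_pos hε)
    refine ⟨δ, hδ, fun s hs => ?_⟩
    rw [NNReal.dist_eq] at hs
    have hs' := abs_lt.1 hs
    rw [dist_eq_norm]
    rcases le_total s t with hst | hst
    · rw [norm_sub_rev]
      exact (h s t hst (by linarith)).trans_lt (half_lt_self hε)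
    · exact (h t s hst (by linarith)).trans_lt (half_lt_self hε)
  · set D : ℝ := ∑' k, 20 * (γ k ^ α / lam k) + 1 with hD
    have hD0 : 0 < D := by
      have : 0 ≤ ∑' k, 20 * (γ k ^ α / lam k) := tsum_nonneg fun k =>
        mul_nonneg (by norm_num) (div_nonneg (Real.rpow_nonneg (hZ.coef_nonneg k) _)
          (hZ.lam_pos k).le)
      linarith
    refine ⟨(momentConst p α * D ^ (p / α)) ^ (1 / p), fun t => ?_⟩
    have hm := (hZ.aestronglyMeasurable_noise (e := e) (zero_le (a := t))).mono (ℱ.le t)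
    have h1 := lintegral_rpow_le_of_truncSq hm.aemeasurable hp hpα hD0 fun T =>
      (hZ.lintegral_truncSq_noise_le zero_le T).trans
        (ENNReal.ofReal_le_ofReal (by gcongr; linarith))
    have h2 : ∫⁻ ω, ‖w t ω‖ₑ ^ p ∂P ≤ ENNReal.ofReal (momentConst p α * D ^ (p / α)) := by
      refine le_trans (lintegral_congr_ae ?_).le h1
      filter_upwards [hwae t] with ω e2
      rw [e2]
    rw [lintegral_rpow_enorm_lp hp, ENNReal.ofReal_le_ofReal_iff (by positivity)] at h2
    rw [one_div]
    exact (Real.le_rpow_inv_iff_of_pos (norm_nonneg _) (by positivity) hp).2 h2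
  · refine Lp.ext ?_
    filter_upwards [hwae 0, Lp.coeFn_zero H (ENNReal.ofReal p) P] with ω h1 h2
    rw [h1, h2, noise_self]
    rfl
  · rw [mem_lpMeas_iff_aestronglyMeasurable]
    exact (hZ.aestronglyMeasurable_noise zero_le).congr (hwae t).symm

end NoiseCurve

/-! ### Laws, Lipschitz coefficients and predictable versions -/

section Law

variable {Ω H : Type*} [m : MeasurableSpace Ω] {P : Measure Ω} [NormedAddCommGroup H] {p : ℝ}

theorem LipschitzWith.memLp_comp [IsFiniteMeasure P] {K : ℝ≥0} {b : H → H} (hb : LipschitzWith K b)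
    {q : ℝ≥0∞} {X : Ω → H} (hX : MemLp X q P) : MemLp (fun ω => b (X ω)) q P := by
  have h : LipschitzWith K fun x => b x - b 0 := by
    refine LipschitzWith.of_dist_le_mul fun x y => ?_
    rw [dist_sub_right]
    exact hb.dist_le_mul x y
  have h2 := (h.comp_memLp (sub_self _) hX).add (memLp_const (μ := P) (p := q) (b 0))
  refine h2.congr_norm (hb.continuous.comp_aestronglyMeasurable hX.1) (ae_of_all _ fun ω => ?_)
  simp

variable [MeasurableSpace H]

theorem wassersteinDist_nonneg (μ ν : Pp H p) : 0 ≤ wassersteinDist μ ν :=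
  ENNReal.toReal_nonneg

variable [BorelSpace H] [SecondCountableTopology H]

/-- A pair of random variables with the given laws is a coupling of these laws. -/
theorem wassersteinDist_le_of_map {μ ν : Pp H p} {X Y : Ω → H} (hp : 0 < p) (hX : AEMeasurable X P)
    (hY : AEMeasurable Y P) (hμ : μ.1 = P.map X) (hν : ν.1 = P.map Y)
    (h : ∫⁻ ω, ‖X ω - Y ω‖ₑ ^ p ∂P ≠ ∞) :
    wassersteinDist μ ν ≤ ((∫⁻ ω, ‖X ω - Y ω‖ₑ ^ p ∂P) ^ (1 / p)).toReal := by
  refine ENNReal.toReal_mono (ENNReal.rpow_ne_top_of_nonneg (by positivity) h) ?_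
  refine iInf₂_le_of_le (P.map fun ω => (X ω, Y ω)) ⟨?_, ?_⟩ ?_
  · rw [hμ, Measure.fst_map_prodMk₀ hY]
  · rw [hν, Measure.snd_map_prodMk₀ hX]
  · rw [lintegral_map' (by fun_prop) (hX.prodMk hY)]

theorem wassersteinDist_self (hp : 0 < p) (μ : Pp H p) : wassersteinDist μ μ = 0 := by
  have := μ.2.1
  refine le_antisymm ?_ (wassersteinDist_nonneg μ μ)
  refine (wassersteinDist_le_of_map (P := μ.1) (X := id) (Y := id) hp aemeasurable_id
      aemeasurable_id
    Measure.map_id.symm Measure.map_id.symm ?_).trans ?_ <;> simp [hp]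

variable [IsProbabilityMeasure P]

/-- The law of a `p`-integrable random variable. -/
noncomputable def lawPp (hp : 0 < p) (X : Lp H (ENNReal.ofReal p) P) : Pp H p :=
  ⟨P.map X, Measure.isProbabilityMeasure_map (Lp.memLp X).1.aemeasurable, by
    rw [lintegral_map' (by fun_prop) (Lp.memLp X).1.aemeasurable, lintegral_rpow_enorm_lp hp]
    exact ENNReal.ofReal_lt_top⟩

theorem wassersteinDist_lawPp_le (hp : 0 < p) (X Y : Lp H (ENNReal.ofReal p) P) :
    wassersteinDist (lawPp hp X) (lawPp hp Y) ≤ ‖X - Y‖ := by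
  have h : ∫⁻ ω, ‖X ω - Y ω‖ₑ ^ p ∂P = ∫⁻ ω, ‖(X - Y) ω‖ₑ ^ p ∂P := by
    refine lintegral_congr_ae ?_
    filter_upwards [Lp.coeFn_sub X Y] with ω hω
    rw [hω, Pi.sub_apply]
  refine (wassersteinDist_le_of_map hp (Lp.memLp X).1.aemeasurable (Lp.memLp Y).1.aemeasurable rfl
    rfl ?_).trans_eq ?_
  · rw [h, lintegral_rpow_enorm_lp hp]
    exact ENNReal.ofReal_ne_top
  · rw [h, ← eLpNorm_ofReal_eq hp, Lp.norm_def]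

/-- The coefficient `B` is Lipschitz in the state and, for the Wasserstein distance, in the law. -/
def IsLipschitzCoeff (K : ℝ≥0) (B : H → Pp H p → H) : Prop :=
  ∀ x y μ ν, ‖B x μ - B y ν‖ ≤ K * (‖x - y‖ + wassersteinDist μ ν)

theorem IsLipschitzCoeff.lipschitzWith {K : ℝ≥0} {B : H → Pp H p → H} (hB : IsLipschitzCoeff K B)
    (hp : 0 < p) (μ : Pp H p) : LipschitzWith K fun x => B x μ := by
  refine LipschitzWith.of_dist_le_mul fun x y => ?_
  rw [dist_eq_norm, dist_eq_norm]
  simpa [wassersteinDist_self hp] using hB x y μ μ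

/-- The superposition operator `X ↦ B(X, Law(X))` on `p`-integrable random variables. -/
noncomputable def nemytskii (P : Measure Ω) [IsProbabilityMeasure P] {K : ℝ≥0}
    {B : H → Pp H p → H} (hp : 0 < p) (hB : IsLipschitzCoeff K B) (X : Lp H (ENNReal.ofReal p) P) :
    Lp H (ENNReal.ofReal p) P :=
  ((hB.lipschitzWith hp (lawPp hp X)).memLp_comp (Lp.memLp X)).toLp _

theorem coeFn_nemytskii {K : ℝ≥0} {B : H → Pp H p → H} (hp : 0 < p) (hB : IsLipschitzCoeff K B)
    (X : Lp H (ENNReal.ofReal p) P) :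
    nemytskii P hp hB X =ᵐ[P] fun ω => B (X ω) (lawPp hp X) :=
  MemLp.coeFn_toLp _

variable [Fact (1 ≤ ENNReal.ofReal p)]

theorem norm_nemytskii_sub_le {K₁ K₂ : ℝ≥0} {B₁ B₂ : H → Pp H p → H} (hp : 0 < p)
    (hB₁ : IsLipschitzCoeff K₁ B₁) (hB₂ : IsLipschitzCoeff K₂ B₂) {X Y : Lp H (ENNReal.ofReal p) P}
    {b K : ℝ} (hb : 0 ≤ b) (hK : 0 ≤ K)
    (h : ∀ x y, ‖B₁ x (lawPp hp X) - B₂ y (lawPp hp Y)‖ ≤ b + K * ‖x - y‖) :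
    ‖nemytskii P hp hB₁ X - nemytskii P hp hB₂ Y‖ ≤ b + K * ‖X - Y‖ := by
  refine Lp_norm_le_of_ae_le hb hK ?_
  filter_upwards [Lp.coeFn_sub X Y, Lp.coeFn_sub (nemytskii P hp hB₁ X) (nemytskii P hp hB₂ Y),
    coeFn_nemytskii hp hB₁ X, coeFn_nemytskii hp hB₂ Y] with ω h1 h2 h3 h4
  rw [h1, h2, Pi.sub_apply, Pi.sub_apply, h3, h4]
  exact h _ _

theorem lipschitzWith_nemytskii {K : ℝ≥0} {B : H → Pp H p → H} (hp : 0 < p)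
    (hB : IsLipschitzCoeff K B) : LipschitzWith (K + K) (nemytskii P hp hB) := by
  refine LipschitzWith.of_dist_le_mul fun X Y => ?_
  rw [dist_eq_norm, dist_eq_norm]
  have h := norm_nemytskii_sub_le hp hB hB (X := X) (Y := Y)
    (b := K * wassersteinDist (lawPp hp X) (lawPp hp Y))
    (mul_nonneg K.coe_nonneg (wassersteinDist_nonneg _ _)) K.coe_nonneg fun x y =>
      (hB x y _ _).trans_eq (by ring)
  have h2 := mul_le_mul_of_nonneg_left (wassersteinDist_lawPp_le hp X Y) K.coe_nonneg
  push_cast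
  linarith

end Law

theorem nemytskii_mem_lpMeas {Ω H : Type*} {m' m₀ : MeasurableSpace Ω} {P : Measure[m₀] Ω}
    [IsProbabilityMeasure P] [NormedAddCommGroup H] [NormedSpace ℝ H] [MeasurableSpace H]
    [BorelSpace H] [SecondCountableTopology H] {p : ℝ} [Fact (1 ≤ ENNReal.ofReal p)]
    {K : ℝ≥0} {B : H → Pp H p → H} (hp : 0 < p)
    (hB : IsLipschitzCoeff K B) {X : Lp H (ENNReal.ofReal p) P}
    (hX : X ∈ lpMeas H ℝ m' (ENNReal.ofReal p) P) :
    nemytskii P hp hB X ∈ lpMeas H ℝ m' (ENNReal.ofReal p) P := by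
  rw [mem_lpMeas_iff_aestronglyMeasurable] at hX ⊢
  exact ((hB.lipschitzWith hp (lawPp hp X)).continuous.comp_aestronglyMeasurable hX).congr
    (coeFn_nemytskii hp hB X).symm

section Predictable

variable {Ω H : Type*} [m : MeasurableSpace Ω] {P : Measure Ω} {ℱ : Filtration ℝ≥0 m}

theorem predictable_le_prod : ℱ.predictable ≤ (inferInstance : MeasurableSpace (ℝ≥0 × Ω)) :=
  measurableSpace_le_predictable_of_measurableSet
    (fun _ hA => (measurableSet_singleton _).prod (ℱ.le _ _ hA))
    (fun _ _ hA => measurableSet_Ioi.prod (ℱ.le _ _ hA))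

/-- A process that is constant in time on the intervals `(i/N, (i+1)/N]`, and there
`ℱ (i/N)`-measurable, is predictable. The truncated subtraction attaches `t = 0` to the interval
`i = 0`. -/
theorem measurable_predictable_step [MeasurableSpace H] {N : ℝ≥0} (hN : 0 < N) {ρ : ℝ≥0 → Ω → H}
    (hρ : ∀ t, Measurable[ℱ t] (ρ t)) :
    Measurable[ℱ.predictable] fun z : ℝ≥0 × Ω => ρ ((⌈z.1 * N⌉₊ - 1 : ℕ) / N) z.2 := by
  intro U hU
  have hset : (fun z : ℝ≥0 × Ω => ρ ((⌈z.1 * N⌉₊ - 1 : ℕ) / N) z.2) ⁻¹' U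
      = ({⊥} ×ˢ (ρ 0 ⁻¹' U)) ∪
        ⋃ i : ℕ, Set.Ioc ((i : ℝ≥0) / N) ((i + 1 : ℕ) / N) ×ˢ (ρ (i / N) ⁻¹' U) := by
    ext ⟨t, ω⟩
    simp only [Set.mem_preimage, Set.mem_union, Set.mem_iUnion, Set.mem_prod, Set.mem_singleton_iff,
      Set.mem_Ioc, bot_eq_zero]
    have hiff : ∀ i : ℕ, ((i : ℝ≥0) / N < t ∧ t ≤ (i + 1 : ℕ) / N) ↔ ⌈t * N⌉₊ = i + 1 := fun i => by
      rw [div_lt_iff₀ hN, le_div_iff₀ hN, Nat.ceil_eq_iff i.succ_ne_zero]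
      simp
    rcases eq_or_ne t 0 with rfl | ht
    · simp
    · have hc : ⌈t * N⌉₊ ≠ 0 := by
        exact (Nat.ceil_pos.2 (by positivity)).ne'
      obtain ⟨i, hi⟩ := Nat.exists_eq_succ_of_ne_zero hc
      constructor
      · intro h
        refine Or.inr ⟨i, (hiff i).2 hi, ?_⟩
        simpa [hi] using h
      · rintro (h | ⟨j, hj, h⟩)
        · exact absurd h.1 ht
        · have := (hiff j).1 hj
          simpa [this] using h
  rw [hset]
  refine MeasurableSet.union (measurableSet_predictable_singleton_bot_prod (hρ 0 hU))
    (MeasurableSet.iUnion fun i => measurableSet_predictable_Ioc_prod _ _ (hρ _ hU))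

/-- A continuous adapted curve of `p`-integrable random variables has a predictable version: it is
the almost sure limit of left-continuous step processes along a rapidly refining grid. -/
theorem exists_predictable_version [NormedAddCommGroup H] [NormedSpace ℝ H] [CompleteSpace H]
    [MeasurableSpace H] [BorelSpace H] [SecondCountableTopology H] {p : ℝ} (hp : 0 < p)
    [Fact (1 ≤ ENNReal.ofReal p)] {x : ℝ≥0 → Lp H (ENNReal.ofReal p) P} (hx : Continuous x)
    (hxm : ∀ t, x t ∈ lpMeas H ℝ (ℱ t) (ENNReal.ofReal p) P) :
    ∃ X : ℝ≥0 → Ω → H, IsStronglyPredictable ℱ X ∧ ∀ t, X t =ᵐ[P] x t := by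
  have hxm' : ∀ t, ∃ f : Ω → H, StronglyMeasurable[ℱ t] f ∧ x t =ᵐ[P] f := fun t => by
    have := hxm t
    rw [mem_lpMeas_iff_aestronglyMeasurable] at this
    exact this
  choose ρ hρ hxρ using hxm'
  set g : ℕ → ℝ≥0 → ℝ≥0 := fun N t => (⌈t * (N + 1 : ℕ)⌉₊ - 1 : ℕ) / (N + 1 : ℕ) with hg
  have hgt : ∀ N t, g N t ≤ t := fun N t => by
    rw [hg, div_le_iff₀ (by positivity)]
    rcases Nat.eq_zero_or_pos ⌈t * (N + 1 : ℕ)⌉₊ with h | h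
    · rw [h]
      simp
    · exact (Nat.lt_ceil.1 (Nat.sub_lt h one_pos)).le
  have hgd : ∀ N t, dist (g N t) t ≤ 1 / (N + 1 : ℕ) := fun N t => by
    have h1 : t ≤ g N t + 1 / (N + 1 : ℕ) := by
      rw [hg, ← add_div, le_div_iff₀ (by positivity)]
      refine (Nat.le_ceil _).trans ?_
      exact_mod_cast (by omega : ⌈t * (N + 1 : ℕ)⌉₊ ≤ ⌈t * (N + 1 : ℕ)⌉₊ - 1 + 1)
    have h1' : (t : ℝ) ≤ g N t + 1 / (N + 1 : ℕ) := by exact_mod_cast h1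
    have h2' : (g N t : ℝ) ≤ t := hgt N t
    rw [NNReal.dist_eq, abs_sub_comm, abs_of_nonneg (by linarith)]
    linarith
  -- on `[0, n]` the grid error is so small that the errors are summable over `n`
  have hN : ∀ n : ℕ, ∃ N : ℕ, ∀ t ≤ (n : ℝ≥0), ‖x (g N t) - x t‖ ^ p ≤ (1 / 2 : ℝ) ^ n :=
      fun n => by
    have huc := (isCompact_Icc (a := (0 : ℝ≥0)) (b := n)).uniformContinuousOn_of_continuous
      hx.continuousOn
    rw [Metric.uniformContinuousOn_iff] at huc
    obtain ⟨δ, hδ, h⟩ := huc (((1 / 2 : ℝ) ^ n) ^ p⁻¹) (by positivity)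
    obtain ⟨N, hN⟩ := exists_nat_one_div_lt hδ
    refine ⟨N, fun t ht => ?_⟩
    have := h (g N t) ⟨zero_le, (hgt N t).trans ht⟩ t ⟨zero_le, ht⟩
      ((hgd N t).trans_lt (by exact_mod_cast hN))
    rw [dist_eq_norm] at this
    exact (Real.le_rpow_inv_iff_of_pos (norm_nonneg _) (by positivity) hp).1 this.le
  choose N hN using hN
  refine ⟨fun t ω => limUnder atTop fun n => ρ (g (N n) t) ω, ?_, fun t => ?_⟩
  · refine stronglyMeasurable_limUnder_seq (m := ℱ.predictable)
      (f := fun n (z : ℝ≥0 × Ω) => ρ (g (N n) z.1) z.2) fun n => ?_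
    exact (measurable_predictable_step (by positivity) fun t =>
      (hρ t).measurable).stronglyMeasurable
  · obtain ⟨j, hj⟩ := exists_nat_ge t
    have h1 : ∀ n, ∫⁻ ω, ‖ρ (g (N (n + j)) t) ω - x t ω‖ₑ ^ p ∂P
        ≤ ENNReal.ofReal ((1 / 2 : ℝ) ^ n) := fun n => by
      have h2 := hN (n + j) t (hj.trans (by push_cast; exact le_add_of_nonneg_left zero_le))
      have h3 : (1 / 2 : ℝ) ^ (n + j) ≤ (1 / 2) ^ n :=
        pow_le_pow_of_le_one (by norm_num) (by norm_num) (by omega)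
      refine le_trans (le_of_eq ?_) (ENNReal.ofReal_le_ofReal (h2.trans h3))
      rw [← lintegral_rpow_enorm_lp hp]
      refine lintegral_congr_ae ?_
      filter_upwards [Lp.coeFn_sub (x (g (N (n + j)) t)) (x t), hxρ (g (N (n + j)) t)] with ω e1 e2
      rw [e1, Pi.sub_apply, e2]
    have hmeas : ∀ n, AEMeasurable (fun ω => ‖ρ (g (N (n + j)) t) ω - x t ω‖ₑ ^ p) P := fun n =>
      ((((hρ _).mono (ℱ.le _)).aestronglyMeasurable.sub (Lp.memLp (x t)).1).enorm).pow_const p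
    have h4 : ∫⁻ ω, ∑' n, ‖ρ (g (N (n + j)) t) ω - x t ω‖ₑ ^ p ∂P ≠ ∞ := by
      rw [lintegral_tsum hmeas]
      refine ne_top_of_le_ne_top ?_ (ENNReal.tsum_le_tsum h1)
      rw [← ENNReal.ofReal_tsum_of_nonneg (fun n => by positivity)
        (summable_geometric_of_lt_one (by norm_num) (by norm_num))]
      exact ENNReal.ofReal_ne_top
    filter_upwards [ae_lt_top' (AEMeasurable.tsum hmeas) h4] with ω hω
    have h5 := ENNReal.tendsto_atTop_zero_of_tsum_ne_top hω.ne
    have h6 := (ENNReal.continuous_rpow_const (y := 1 / p)).tendsto 0 |>.comp h5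
    rw [ENNReal.zero_rpow_of_pos (by positivity)] at h6
    have h7 : Tendsto (fun n => ρ (g (N (n + j)) t) ω) atTop (𝓝 (x t ω)) := by
      rw [tendsto_iff_edist_tendsto_0]
      refine h6.congr fun n => ?_
      simp only [Function.comp_apply]
      rw [← ENNReal.rpow_mul, mul_one_div_cancel hp.ne', ENNReal.rpow_one, edist_eq_enorm_sub]
    exact ((tendsto_add_atTop_iff_nat j).1 h7).limUnder_eq

end Predictable

/-! ### From curves in `L^p` to mild solutions -/

section LpIntegral

variable {Ω H : Type*} [m : MeasurableSpace Ω] {P : Measure Ω} [IsProbabilityMeasure P]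
  [NormedAddCommGroup H] {q : ℝ≥0∞} [hq : Fact (1 ≤ q)]

theorem lintegral_enorm_lp_le (u : Lp H q P) : ∫⁻ ω, ‖u ω‖ₑ ∂P ≤ ENNReal.ofReal ‖u‖ := by
  rw [← eLpNorm_one_eq_lintegral_enorm, Lp.norm_def, ENNReal.ofReal_toReal (Lp.eLpNorm_ne_top u)]
  exact eLpNorm_le_eLpNorm_of_exponent_le hq.out (Lp.memLp u).1

theorem integrable_lp (u : Lp H q P) : Integrable u P :=
  (Lp.memLp u).integrable hq.out

variable [NormedSpace ℝ H]

theorem exists_setIntegral_clm (A : Set Ω) :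
    ∃ Φ : Lp H q P →L[ℝ] H, ∀ u, Φ u = ∫ ω in A, u ω ∂P := by
  refine ⟨LinearMap.mkContinuous
    { toFun := fun u => ∫ ω in A, u ω ∂P
      map_add' := fun u v => ?_
      map_smul' := fun c u => ?_ } 1 fun u => ?_, fun u => rfl⟩
  · rw [← integral_add (integrable_lp u).restrict (integrable_lp v).restrict]
    exact integral_congr_ae (ae_restrict_of_ae (Lp.coeFn_add u v))
  · rw [RingHom.id_apply, ← integral_smul]
    exact integral_congr_ae (ae_restrict_of_ae (Lp.coeFn_smul c u))
  · rw [one_mul]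
    change ‖∫ ω in A, u ω ∂P‖ ≤ ‖u‖
    refine (norm_integral_le_lintegral_norm _).trans ?_
    refine ENNReal.toReal_le_of_le_ofReal (norm_nonneg u) ?_
    refine (le_trans ?_ (lintegral_enorm_lp_le u))
    simp_rw [ofReal_norm]
    exact setLIntegral_le_lintegral _ _

/-- The integral of a continuous `L^q`-valued curve can be computed `ω` by `ω` from any jointly
measurable version of the curve: both have the same integral over every event. -/
theorem ae_intervalIntegral_eq_lp [CompleteSpace H] {f : ℝ → Lp H q P} (hf : Continuous f)
    {φ : ℝ → Ω → H} (hφ : StronglyMeasurable (Function.uncurry φ)) (h : ∀ s, φ s =ᵐ[P] f s) {t : ℝ}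
    (ht : 0 ≤ t) :
    ∀ᵐ ω ∂P, IntervalIntegrable (fun s => φ s ω) volume 0 t ∧
      ∫ s in (0 : ℝ)..t, φ s ω = ((∫ s in (0 : ℝ)..t, f s : Lp H q P) : Ω → H) ω := by
  set μ : Measure ℝ := volume.restrict (Set.Ioc 0 t) with hμ
  obtain ⟨M, hM⟩ := (isCompact_Icc (a := (0 : ℝ)) (b := t)).exists_bound_of_continuousOn
    hf.continuousOn
  have hint : Integrable (Function.uncurry φ) (μ.prod P) := by
    refine ⟨hφ.aestronglyMeasurable, ?_⟩
    rw [hasFiniteIntegral_iff_enorm, lintegral_prod _ hφ.enorm.aemeasurable]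
    refine lt_of_le_of_lt (setLIntegral_mono' measurableSet_Ioc
      (g := fun _ => ENNReal.ofReal M) fun s hs => ?_) ?_
    · refine le_trans ?_ ((lintegral_enorm_lp_le (f s)).trans
        (ENNReal.ofReal_le_ofReal (hM s ⟨hs.1.le, hs.2⟩)))
      refine (lintegral_congr_ae ?_).le
      filter_upwards [h s] with ω hω
      rw [Function.uncurry_apply_pair, hω]
    · rw [lintegral_const]
      exact ENNReal.mul_lt_top ENNReal.ofReal_lt_top (by simp)
  have hae := hint.prod_left_ae
  have heq : (fun ω => ∫ s, φ s ω ∂μ) =ᵐ[P]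
      ((∫ s in (0 : ℝ)..t, f s : Lp H q P) : Ω → H) := by
    refine Integrable.ae_eq_of_forall_setIntegral_eq _ _ hint.integral_prod_right
      (integrable_lp _) fun A _ _ => ?_
    obtain ⟨Φ, hΦ⟩ := exists_setIntegral_clm (H := H) (q := q) (P := P) A
    rw [← hΦ, ← Φ.intervalIntegral_comp_comm (hf.intervalIntegrable _ _),
      intervalIntegral.integral_of_le ht]
    have hint' : Integrable (Function.uncurry φ) (μ.prod (P.restrict A)) := by
      refine hint.mono_measure ?_
      exact Measure.prod_mono le_rfl Measure.restrict_le_self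
    rw [← integral_integral_swap hint']
    refine integral_congr_ae (ae_of_all _ fun s => ?_)
    simp only
    rw [hΦ]
    exact integral_congr_ae (ae_restrict_of_ae (h s))
  filter_upwards [hae, heq] with ω h1 h2
  refine ⟨(intervalIntegrable_iff_integrableOn_Ioc_of_le ht).2 h1, ?_⟩
  rw [intervalIntegral.integral_of_le ht, ← h2]

end LpIntegral

section MildSolution

variable {Ω H : Type*} [m : MeasurableSpace Ω] {P : Measure Ω} [IsProbabilityMeasure P]
  {ℱ : Filtration ℝ≥0 m} [NormedAddCommGroup H] [InnerProductSpace ℝ H] [CompleteSpace H]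
  [MeasurableSpace H] [BorelSpace H] [SecondCountableTopology H] {p lam : ℝ}
  {S : ℝ≥0 → H →L[ℝ] H} {e : ℕ → H} {β : ℕ → ℝ} {L : ℕ → ℝ≥0 → Ω → ℝ}
  {K : ℝ≥0} {B : H → Pp H p → H} {ξ : Ω → H}

/-- A predictable version of an adapted solution of the mild equation in `L^p` is a mild
solution. -/
theorem IsMildCurve.exists_isMildSolution [Fact (1 ≤ ENNReal.ofReal p)] (hp : 0 < p)
    (hS : IsDecaySemigroup S lam) (hB : IsLipschitzCoeff K B)
    {x₀ : Lp H (ENNReal.ofReal p) P} {w x : ℝ≥0 → Lp H (ENNReal.ofReal p) P}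
    (hx : IsMildCurve (fun t => (S t).compLpL (ENNReal.ofReal p) P) (nemytskii P hp hB) w x₀ x)
    (hxm : ∀ t, x t ∈ lpMeas H ℝ (ℱ t) (ENNReal.ofReal p) P)
    (hw : ∀ t, w t =ᵐ[P] stochConvolution S e β L t) (hξ : x₀ =ᵐ[P] ξ) :
    ∃ X, IsMildSolution P ℱ S e p β L B ξ X ∧ ∀ t, X t =ᵐ[P] x t := by
  obtain ⟨X, hX, hXx⟩ := exists_predictable_version hp hx.continuous hxm
  have hXj : Measurable (Function.uncurry X) := hX.measurable.mono predictable_le_prod le_rfl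
  refine ⟨X, ⟨hX, hX.stronglyAdapted.adapted, fun T => ?_, fun t => lawPp hp (x t), fun t => ?_,
    ?_⟩, hXx⟩
  · obtain ⟨M, hM⟩ := (isCompact_Icc (a := (0 : ℝ≥0)) (b := T)).exists_bound_of_continuousOn
      hx.continuous.continuousOn
    refine ⟨Real.toNNReal (M ^ p), fun t ht => ?_⟩
    have h1 : ∫⁻ ω, ‖X t ω‖ₑ ^ p ∂P = ENNReal.ofReal (‖x t‖ ^ p) := by
      rw [← lintegral_rpow_enorm_lp hp]
      refine lintegral_congr_ae ?_
      filter_upwards [hXx t] with ω hω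
      rw [hω]
    rw [h1]
    exact ENNReal.ofReal_le_ofReal
      (Real.rpow_le_rpow (norm_nonneg _) (hM t ⟨zero_le, ht⟩) hp.le)
  · exact Measure.map_congr (hXx t).symm
  · have hT := hS.compLpL (P := P) hp
    have hN := lipschitzWith_nemytskii (P := P) hp hB
    have key : ∀ t : ℝ≥0, ∀ᵐ ω ∂P, IntervalIntegrable (fun s : ℝ => S (t - s.toNNReal)
          (B (X s.toNNReal ω) (lawPp hp (x s.toNNReal)))) volume 0 t ∧
        ∫ s in (0 : ℝ)..t, S (t - s.toNNReal) (B (X s.toNNReal ω) (lawPp hp (x s.toNNReal)))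
          = mildConv (fun t => (S t).compLpL (ENNReal.ofReal p) P)
            (fun s => nemytskii P hp hB (x s)) t ω := by
      intro t
      have hf : Continuous fun s : ℝ => (S (t - s.toNNReal)).compLpL (ENNReal.ofReal p) P
          (nemytskii P hp hB (x s.toNNReal)) :=
        (hT.continuous_integrand (hN.continuous.comp hx.continuous)).comp
          (by fun_prop : Continuous fun s : ℝ => (t, s))
      have hBc : Continuous fun z : H × ℝ≥0 => B z.1 (lawPp hp (x z.2)) := by
        refine continuous_iff_continuousAt.2 fun z => ?_
        rw [ContinuousAt, tendsto_iff_norm_sub_tendsto_zero]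
        have h0 : Tendsto (fun z' : H × ℝ≥0 => (K : ℝ) * (‖z'.1 - z.1‖ + ‖x z'.2 - x z.2‖)) (𝓝 z)
            (𝓝 (K * (‖z.1 - z.1‖ + ‖x z.2 - x z.2‖))) := by
          have hxc := hx.continuous
          exact Continuous.tendsto (by fun_prop) z
        simp only [sub_self, norm_zero, add_zero, mul_zero] at h0
        refine squeeze_zero (fun _ => norm_nonneg _) (fun z' => (hB _ _ _ _).trans ?_) h0
        gcongr
        exact wassersteinDist_lawPp_le hp _ _
      have hφ : StronglyMeasurable (Function.uncurry fun (s : ℝ) (ω : Ω) => S (t - s.toNNReal)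
          (B (X s.toNNReal ω) (lawPp hp (x s.toNNReal)))) := by
        have h1 : Continuous fun z : H × ℝ => S (t - z.2.toNNReal)
            (B z.1 (lawPp hp (x z.2.toNNReal))) :=
          hS.continuous_uncurry.comp ((hBc.comp (continuous_fst.prodMk
            (continuous_real_toNNReal.comp continuous_snd))).prodMk (by fun_prop))
        have h2 : Measurable fun z : ℝ × Ω => (X z.1.toNNReal z.2, z.1) :=
          (hXj.comp ((measurable_real_toNNReal.comp measurable_fst).prodMk
            measurable_snd)).prodMk measurable_fst
        exact (h1.measurable.comp h2).stronglyMeasurable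
      have := ae_intervalIntegral_eq_lp hf hφ (fun s => ?_) t.coe_nonneg
      · exact this
      · filter_upwards [(S (t - s.toNNReal)).coeFn_compLpL (nemytskii P hp hB (x s.toNNReal)),
          coeFn_nemytskii hp hB (x s.toNNReal), hXx s.toNNReal] with ω h1 h2 h3
        rw [h1, h2, h3]
    refine ⟨fun t => (key t).mono fun ω hω => hω.1, fun t => ?_⟩
    have h0 := hx.eq t
    filter_upwards [key t, hXx t, hw t, hξ, (S t).coeFn_compLpL x₀,
      Lp.coeFn_add ((S t).compLpL (ENNReal.ofReal p) P x₀ + mildConv _ _ t) (w t),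
      Lp.coeFn_add ((S t).compLpL (ENNReal.ofReal p) P x₀)
        (mildConv (fun t => (S t).compLpL (ENNReal.ofReal p) P)
            (fun s => nemytskii P hp hB (x s)) t)] with ω h1 h2 h3 h4 h5 h6 h7
    rw [h2, h0, h6, Pi.add_apply, h7, Pi.add_apply, h5, h4, h3, h1.2]

/-- An integral inequality without a forcing term has only the zero bounded solution. -/
theorem eq_zero_of_le_lintegral {u : ℝ≥0 → ℝ≥0∞} {c M : ℝ≥0} {T : ℝ≥0} (hM : ∀ t ≤ T, u t ≤ M)
    (hu : ∀ t ≤ T, u t ≤ c * ∫⁻ s in Set.Ioc (0 : ℝ) t, u s.toNNReal) : u T = 0 := by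
  set d : ℝ := c + 1 with hd
  have hd0 : 0 < d := by positivity
  -- iterating in the weight `e^{2dt}` gains a factor `1 / 2` each time
  have key : ∀ n : ℕ, ∀ t ≤ T, u t ≤ ENNReal.ofReal (M * (1 / 2) ^ n * Real.exp (2 * d * t)) := by
    intro n
    induction n with
    | zero =>
      intro t ht
      refine (hM t ht).trans ?_
      rw [← ENNReal.ofReal_coe_nnreal]
      refine ENNReal.ofReal_le_ofReal ?_
      rw [pow_zero, mul_one]
      exact le_mul_of_one_le_right M.coe_nonneg (Real.one_le_exp (by positivity))
    | succ n ih =>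
      intro t ht
      have h1 : ∫⁻ s in Set.Ioc (0 : ℝ) t, u s.toNNReal
          ≤ ∫⁻ s in Set.Ioc (0 : ℝ) t, ENNReal.ofReal (M * (1 / 2) ^ n * Real.exp (2 * d * s)) := by
        refine setLIntegral_mono' measurableSet_Ioc fun s hs => ?_
        have := ih s.toNNReal ((Real.toNNReal_le_iff_le_coe.2 hs.2).trans ht)
        rwa [Real.coe_toNNReal _ hs.1.le] at this
      have hcont : Continuous fun s : ℝ => M * (1 / 2) ^ n * Real.exp (2 * d * s) := by fun_prop
      have h2 : ∫⁻ s in Set.Ioc (0 : ℝ) t, ENNReal.ofReal (M * (1 / 2) ^ n * Real.exp (2 * d * s))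
          = ENNReal.ofReal (∫ s in (0 : ℝ)..t, M * (1 / 2) ^ n * Real.exp (2 * d * s)) := by
        rw [intervalIntegral.integral_of_le t.coe_nonneg, ofReal_integral_eq_lintegral_ofReal]
        · exact (hcont.integrableOn_Icc).mono_set Set.Ioc_subset_Icc_self
        · exact ae_of_all _ fun s => by positivity
      have h3 : ∫ s in (0 : ℝ)..t, M * (1 / 2) ^ n * Real.exp (2 * d * s)
          ≤ M * (1 / 2) ^ n * (Real.exp (2 * d * t) / (2 * d)) := by
        have hder : ∀ s ∈ Set.uIcc (0 : ℝ) t,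
            HasDerivAt (fun s => M * (1 / 2) ^ n * (Real.exp (2 * d * s) / (2 * d)))
              (M * (1 / 2) ^ n * Real.exp (2 * d * s)) s := fun s _ => by
          have := ((((hasDerivAt_id s).const_mul (2 * d)).exp).div_const (2 * d)).const_mul
            ((M : ℝ) * (1 / 2) ^ n)
          refine this.congr_deriv ?_
          simp only [id]
          field_simp
        rw [intervalIntegral.integral_eq_sub_of_hasDerivAt hder (hcont.intervalIntegrable _ _)]
        have : 0 ≤ M * (1 / 2) ^ n * (Real.exp (2 * d * 0) / (2 * d)) := by positivity
        linarith
      refine (hu t ht).trans ((mul_le_mul_right (h1.trans_eq h2) _).trans ?_)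
      rw [← ENNReal.ofReal_coe_nnreal, ← ENNReal.ofReal_mul c.coe_nonneg]
      refine ENNReal.ofReal_le_ofReal ((mul_le_mul_of_nonneg_left h3 c.coe_nonneg).trans ?_)
      have h4 : (c : ℝ) * (M * (1 / 2) ^ n * (Real.exp (2 * d * t) / (2 * d)))
          = (c / d) * (M * (1 / 2) ^ (n + 1) * Real.exp (2 * d * t)) := by
        field_simp
        ring
      rw [h4]
      refine mul_le_of_le_one_left (by positivity) ?_
      rw [div_le_one hd0]
      linarith
  refine le_antisymm ?_ zero_le
  have hlim : Tendsto (fun n : ℕ => ENNReal.ofReal (M * (1 / 2) ^ n * Real.exp (2 * d * T))) atTop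
      (𝓝 (ENNReal.ofReal (M * 0 * Real.exp (2 * d * T)))) :=
    (ENNReal.continuous_ofReal.tendsto _).comp (((tendsto_pow_atTop_nhds_zero_of_lt_one
      (by norm_num) (by norm_num)).const_mul _).mul_const _)
  simp only [mul_zero, zero_mul, ENNReal.ofReal_zero] at hlim
  exact ge_of_tendsto' hlim fun n => key n T le_rfl

end MildSolution

/-! ### Uniqueness of mild solutions -/

section Uniqueness

theorem rpow_lintegral_le {Ω : Type*} {m : MeasurableSpace Ω} {μ : Measure Ω} {p : ℝ} (hp : 1 ≤ p)
    {v : Ω → ℝ≥0∞} (hv : AEMeasurable v μ) :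
    (∫⁻ ω, v ω ∂μ) ^ p ≤ μ Set.univ ^ (p - 1) * ∫⁻ ω, v ω ^ p ∂μ := by
  have h := eLpNorm'_le_eLpNorm'_mul_rpow_measure_univ one_pos hp hv.aestronglyMeasurable
  have hp0 : 0 < p := by linarith
  simp only [eLpNorm', enorm_eq_self, ENNReal.rpow_one, div_one] at h
  have h2 := ENNReal.rpow_le_rpow h hp0.le
  rw [ENNReal.mul_rpow_of_nonneg _ _ hp0.le, ← ENNReal.rpow_mul, ← ENNReal.rpow_mul,
    one_div_mul_cancel hp0.ne', ENNReal.rpow_one, mul_comm] at h2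
  rwa [show (1 - 1 / p) * p = p - 1 by field_simp] at h2

variable {Ω H : Type*} [m : MeasurableSpace Ω] {P : Measure Ω} [IsProbabilityMeasure P]
  {ℱ : Filtration ℝ≥0 m} [NormedAddCommGroup H] [InnerProductSpace ℝ H]
  [MeasurableSpace H] [BorelSpace H] [SecondCountableTopology H] {p lam : ℝ}
  {S : ℝ≥0 → H →L[ℝ] H} {e : ℕ → H} {β : ℕ → ℝ} {L : ℕ → ℝ≥0 → Ω → ℝ}
  {K : ℝ≥0} {B : H → Pp H p → H} {ξ : Ω → H}

/-- Two mild solutions are modifications of each other: their `p`-th mean distance `u` satisfies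
`u(t) ≤ c ∫₀ᵗ u(s) ds`. -/
theorem IsMildSolution.ae_eq (hp : 1 ≤ p) (hS : IsDecaySemigroup S lam)
    (hB : IsLipschitzCoeff K B) {X X' : ℝ≥0 → Ω → H} (hX : IsMildSolution P ℱ S e p β L B ξ X)
    (hX' : IsMildSolution P ℱ S e p β L B ξ X') (T : ℝ≥0) : X T =ᵐ[P] X' T := by
  have hp0 : 0 < p := by linarith
  obtain ⟨law, hlaw, hint, heq⟩ := hX.equation
  obtain ⟨law', hlaw', hint', heq'⟩ := hX'.equation
  have hXj : Measurable (Function.uncurry X) :=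
    hX.predictable.measurable.mono predictable_le_prod le_rfl
  have hXj' : Measurable (Function.uncurry X') :=
    hX'.predictable.measurable.mono predictable_le_prod le_rfl
  have hXm : ∀ t, Measurable (X t) := fun t => hXj.comp measurable_prodMk_left
  have hXm' : ∀ t, Measurable (X' t) := fun t => hXj'.comp measurable_prodMk_left
  set u : ℝ≥0 → ℝ≥0∞ := fun t => ∫⁻ ω, ‖X t ω - X' t ω‖ₑ ^ p ∂P with hu
  have hdj : Measurable fun z : ℝ≥0 × Ω => ‖X z.1 z.2 - X' z.1 z.2‖ₑ := (hXj.sub hXj').enorm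
  have hum : Measurable u := (hdj.pow_const p).lintegral_prod_right'
  have hum1 : ∀ t, Measurable fun ω => ‖X t ω - X' t ω‖ₑ ^ p := fun t =>
    (hdj.comp measurable_prodMk_left).pow_const p
  have h2c : (((2 : ℝ≥0) ^ (p - 1) : ℝ≥0) : ℝ≥0∞) = 2 ^ (p - 1) := by
    rw [ENNReal.coe_rpow_of_nonneg _ (by linarith), ENNReal.coe_ofNat]
  have hbound : ∀ T : ℝ≥0, ∃ M : ℝ≥0, ∀ t ≤ T, u t ≤ M := by
    intro T
    obtain ⟨M, hM⟩ := hX.moment T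
    obtain ⟨M', hM'⟩ := hX'.moment T
    refine ⟨(2 : ℝ≥0) ^ (p - 1) * (M + M'), fun t ht => ?_⟩
    have h1 : u t ≤ ∫⁻ ω, (2 : ℝ≥0∞) ^ (p - 1) * (‖X t ω‖ₑ ^ p + ‖X' t ω‖ₑ ^ p) ∂P :=
      lintegral_mono fun ω => (ENNReal.rpow_le_rpow enorm_sub_le hp0.le).trans
        (ENNReal.rpow_add_le_mul_rpow_add_rpow _ _ hp)
    refine h1.trans ?_
    have hm : Measurable fun ω => ‖X t ω‖ₑ ^ p := (hXm t).enorm.pow_const p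
    have hm' : Measurable fun ω => ‖X' t ω‖ₑ ^ p := (hXm' t).enorm.pow_const p
    have hmm : Measurable fun ω => ‖X t ω‖ₑ ^ p + ‖X' t ω‖ₑ ^ p := hm.add hm'
    rw [lintegral_const_mul _ hmm, lintegral_add_left hm, ENNReal.coe_mul, h2c, ENNReal.coe_add]
    exact mul_le_mul_right (add_le_add (hM t ht) (hM' t ht)) _
  have hfin : ∀ t, u t ≠ ∞ := fun t => by
    obtain ⟨M, hM⟩ := hbound t
    exact ((hM t le_rfl).trans_lt ENNReal.coe_lt_top).ne
  have hW : ∀ s, ENNReal.ofReal (wassersteinDist (law s) (law' s)) ≤ u s ^ (1 / p) := fun s =>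
    (ENNReal.ofReal_le_ofReal (wassersteinDist_le_of_map hp0 (hXm s).aemeasurable
      (hXm' s).aemeasurable (hlaw s) (hlaw' s) (hfin s))).trans ENNReal.ofReal_toReal_le
  set v : ℝ → Ω → ℝ≥0∞ := fun s ω =>
    ‖X s.toNNReal ω - X' s.toNNReal ω‖ₑ + u s.toNNReal ^ (1 / p) with hv
  have hvj : Measurable (Function.uncurry v) :=
    (hdj.comp ((measurable_real_toNNReal.comp measurable_fst).prodMk measurable_snd)).add
      ((hum.pow_const _).comp (measurable_real_toNNReal.comp measurable_fst))
  have hstep : ∀ t ≤ T, u t ≤ ((K ^ p * T ^ (p - 1) * 2 ^ (p - 1) * 2 : ℝ≥0) : ℝ≥0∞)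
      * ∫⁻ s in Set.Ioc (0 : ℝ) t, u s.toNNReal := by
    intro t ht
    have h1 : ∀ᵐ ω ∂P, ‖X t ω - X' t ω‖ₑ ^ p
        ≤ (K : ℝ≥0∞) ^ p * ((T : ℝ≥0∞) ^ (p - 1) * ∫⁻ s in Set.Ioc (0 : ℝ) t, v s ω ^ p) := by
      filter_upwards [heq t, heq' t, hint t, hint' t] with ω e1 e2 i1 i2
      have hvω : Measurable fun s => v s ω := hvj.comp measurable_prodMk_right
      have e3 : X t ω - X' t ω = ∫ s in (0 : ℝ)..t,
          (S (t - s.toNNReal) (B (X s.toNNReal ω) (law s.toNNReal))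
            - S (t - s.toNNReal) (B (X' s.toNNReal ω) (law' s.toNNReal))) := by
        rw [intervalIntegral.integral_sub i1 i2, e1, e2]
        abel
      have e4 : ‖X t ω - X' t ω‖ₑ ≤ K * ∫⁻ s in Set.Ioc (0 : ℝ) t, v s ω := by
        rw [e3, intervalIntegral.integral_of_le t.coe_nonneg,
          ← lintegral_const_mul _ hvω]
        refine (enorm_integral_le_lintegral_enorm _).trans (lintegral_mono fun s => ?_)
        rw [← map_sub]
        refine (enorm_le_iff_norm_le.2 (hS.norm_apply_le _ _)).trans ?_
        rw [← ofReal_norm]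
        refine (ENNReal.ofReal_le_ofReal (hB _ _ _ _)).trans ?_
        rw [ENNReal.ofReal_mul K.coe_nonneg, ENNReal.ofReal_coe_nnreal,
          ENNReal.ofReal_add (norm_nonneg _) (wassersteinDist_nonneg _ _), ofReal_norm]
        exact mul_le_mul_right (add_le_add le_rfl (hW _)) _
      refine (ENNReal.rpow_le_rpow e4 hp0.le).trans ?_
      rw [ENNReal.mul_rpow_of_nonneg _ _ hp0.le]
      refine mul_le_mul_right ((rpow_lintegral_le hp hvω.aemeasurable).trans ?_) _
      refine mul_le_mul_left (ENNReal.rpow_le_rpow ?_ (by linarith)) _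
      simpa using ht
    have h2 : ∀ s : ℝ, ∫⁻ ω, v s ω ^ p ∂P ≤ (2 : ℝ≥0∞) ^ (p - 1) * (2 * u s.toNNReal) := by
      intro s
      have h3 : ∫⁻ ω, v s ω ^ p ∂P ≤ ∫⁻ ω, (2 : ℝ≥0∞) ^ (p - 1) *
          (‖X s.toNNReal ω - X' s.toNNReal ω‖ₑ ^ p + u s.toNNReal) ∂P := by
        refine lintegral_mono fun ω => (ENNReal.rpow_add_le_mul_rpow_add_rpow _ _ hp).trans_eq ?_
        rw [← ENNReal.rpow_mul, one_div_mul_cancel hp0.ne', ENNReal.rpow_one]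
      refine h3.trans_eq ?_
      have hm := hum1 s.toNNReal
      rw [lintegral_const_mul _ (hm.add_const _), lintegral_add_left hm, lintegral_const,
        measure_univ, mul_one, two_mul]
    calc u t ≤ ∫⁻ ω, (K : ℝ≥0∞) ^ p * ((T : ℝ≥0∞) ^ (p - 1) *
          ∫⁻ s in Set.Ioc (0 : ℝ) t, v s ω ^ p) ∂P := lintegral_mono_ae h1
      _ = (K : ℝ≥0∞) ^ p * ((T : ℝ≥0∞) ^ (p - 1) *
          ∫⁻ s in Set.Ioc (0 : ℝ) t, ∫⁻ ω, v s ω ^ p ∂P) := by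
        have hm : Measurable fun ω => ∫⁻ s in Set.Ioc (0 : ℝ) t, v s ω ^ p :=
          (hvj.pow_const p).lintegral_prod_left'
        rw [lintegral_const_mul _ (hm.const_mul _), lintegral_const_mul _ hm,
          lintegral_lintegral_swap (f := fun ω s => v s ω ^ p)
            ((hvj.pow_const p).comp measurable_swap).aemeasurable]
      _ ≤ (K : ℝ≥0∞) ^ p * ((T : ℝ≥0∞) ^ (p - 1) *
          ∫⁻ s in Set.Ioc (0 : ℝ) t, (2 : ℝ≥0∞) ^ (p - 1) * (2 * u s.toNNReal)) := by
        gcongr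
        exact h2 _
      _ = _ := by
        have hm : Measurable fun s : ℝ => u s.toNNReal := hum.comp measurable_real_toNNReal
        rw [lintegral_const_mul _ (hm.const_mul _), lintegral_const_mul _ hm]
        rw [ENNReal.coe_mul, ENNReal.coe_mul, ENNReal.coe_mul, h2c,
          ENNReal.coe_rpow_of_nonneg _ hp0.le, ENNReal.coe_rpow_of_nonneg _ (by linarith)]
        push_cast
        ring
  obtain ⟨M, hM⟩ := hbound T
  have h0 : u T = 0 := eq_zero_of_le_lintegral hM hstep
  rw [hu] at h0
  simp only at h0
  rw [lintegral_eq_zero_iff (hum1 T)] at h0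
  filter_upwards [h0] with ω hω
  rw [Pi.zero_apply, ENNReal.rpow_eq_zero_iff_of_pos hp0, enorm_eq_zero, sub_eq_zero] at hω
  exact hω

end Uniqueness

/-! ### Independence and stationarity of the noise increments -/

section IncrementLaws

theorem charFun_map_one {Ω : Type*} {m : MeasurableSpace Ω} {P : Measure Ω} {X : Ω → ℝ}
    (hX : AEMeasurable X P) :
    charFun (P.map X) 1 = ∫ ω, Complex.exp (X ω * Complex.I) ∂P := by
  rw [charFun_apply_real, integral_map hX (by fun_prop)]
  simp

theorem tendsto_charFun_map_one {Ω : Type*} {m : MeasurableSpace Ω} {P : Measure Ω}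
    [IsFiniteMeasure P] {X : ℕ → Ω → ℝ} {Y : Ω → ℝ} (hX : ∀ n, AEMeasurable (X n) P)
    (h : ∀ᵐ ω ∂P, Tendsto (fun n => X n ω) atTop (𝓝 (Y ω))) :
    Tendsto (fun n => charFun (P.map (X n)) 1) atTop (𝓝 (charFun (P.map Y) 1)) := by
  have hY : AEMeasurable Y P := aemeasurable_of_tendsto_metrizable_ae' hX h
  simp_rw [charFun_map_one (hX _), charFun_map_one hY]
  refine tendsto_integral_of_dominated_convergence (fun _ => (1 : ℝ)) (fun n => ?_)
    (integrable_const _) (fun n => ae_of_all _ fun ω => ?_) ?_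
  · exact (by fun_prop : Continuous fun x : ℝ => Complex.exp (x * Complex.I))
      |>.comp_aestronglyMeasurable (hX n).aestronglyMeasurable
  · rw [Complex.norm_exp_ofReal_mul_I]
  · filter_upwards [h] with ω hω
    exact ((by fun_prop : Continuous fun x : ℝ => Complex.exp (x * Complex.I)).tendsto _).comp hω

variable {Ω H : Type*} [m : MeasurableSpace Ω] {P : Measure Ω} [IsProbabilityMeasure P]
  {ℱ : Filtration ℝ≥0 m} {α : ℝ}

/-- The characteristic function of the Riemann sum with `N + 1` terms of a coordinate of the
stochastic convolution over a time interval of length `h`. -/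
noncomputable def riemannChar (α lam : ℝ) (h : ℝ≥0) (N : ℕ) (u : ℝ) : ℂ :=
  ∏ i : Fin (N + 1),
    (Real.exp (-((h / (N + 1) : ℝ) * |u * Real.exp (-lam * (h - h * i / (N + 1)))| ^ α)) : ℂ)

theorem IsSymmetricStableProcess.charFun_sum_riemannSum {ℓ : ℝ≥0 → Ω → ℝ}
    (hℓ : IsSymmetricStableProcess P α ℓ) (hm : ∀ t, Measurable (ℓ t)) (lam : ℝ) (h : ℝ≥0)
    (N n : ℕ) (u : Fin n → ℝ) :
    charFun (P.map fun ω => ∑ j : Fin n, u j * riemannSum lam (fun r => ℓ r ω)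
        ((j : ℕ) * h) ((j + 1 : ℕ) * h) N) 1
      = ∏ j, riemannChar α lam h N (u j) := by
  set τ : ℕ → ℝ≥0 := fun i => i * h / (N + 1) with hτ
  have hτm : Monotone τ := fun i j hij => by
    rw [hτ]
    simp only
    gcongr
  have hgrid : ∀ j i : ℕ, gridPt (j * h) ((j + 1 : ℕ) * h) N i = τ (j * (N + 1) + i) :=
      fun j i => by
    have : ((j + 1 : ℕ) : ℝ≥0) * h - j * h = h := by
      rw [Nat.cast_succ, add_mul, one_mul, add_tsub_cancel_left]
    rw [gridPt, this, hτ]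
    push_cast
    field_simp
  have hg : Function.Injective fun q : Fin n × Fin (N + 1) => (q.1 : ℕ) * (N + 1) + q.2 := by
    rintro ⟨j, i⟩ ⟨j', i'⟩ hq
    simp only at hq
    have h2 := congrArg (· % (N + 1)) hq
    simp only [Nat.mul_add_mod_self_right, Nat.mod_eq_of_lt i.2, Nat.mod_eq_of_lt i'.2] at h2
    rw [h2, Nat.add_right_cancel_iff] at hq
    exact Prod.ext (Fin.ext (Nat.eq_of_mul_eq_mul_right N.succ_pos hq)) (Fin.ext h2)
  have key := hℓ.charFun_sum_increments hm hτm hg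
    (fun q => u q.1 * Real.exp (-lam * (h - h * (q.2 : ℕ) / (N + 1)))) 1
  have hsum : (fun ω => ∑ j : Fin n, u j * riemannSum lam (fun r => ℓ r ω)
        ((j : ℕ) * h) ((j + 1 : ℕ) * h) N)
      = fun ω => ∑ q : Fin n × Fin (N + 1),
        (u q.1 * Real.exp (-lam * (h - h * (q.2 : ℕ) / (N + 1)))) *
          (ℓ (τ ((q.1 : ℕ) * (N + 1) + q.2 + 1)) ω - ℓ (τ ((q.1 : ℕ) * (N + 1) + q.2)) ω) := by
    ext ω
    rw [Fintype.sum_prod_type]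
    refine Finset.sum_congr rfl fun j _ => ?_
    rw [riemannSum, Finset.sum_range, Finset.mul_sum]
    refine Finset.sum_congr rfl fun i _ => ?_
    rw [← mul_assoc, hgrid, hgrid]
    congr 3
    rw [hτ]
    push_cast
    field_simp
    ring
  rw [hsum, key, Fintype.prod_prod_type]
  refine Finset.prod_congr rfl fun j _ => Finset.prod_congr rfl fun i _ => ?_
  have : ((τ ((j : ℕ) * (N + 1) + i + 1) : ℝ) - τ ((j : ℕ) * (N + 1) + i)) = h / (N + 1) := by
    rw [hτ]
    push_cast
    field_simp
    ring
  rw [this, mul_one]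

variable {lam γ : ℕ → ℝ} {Z : ℕ → ℝ≥0 → Ω → ℝ}

namespace IsConvolvableNoise

theorem charFun_sum_sum_riemannSum (hZ : IsConvolvableNoise P ℱ α lam γ Z) (h : ℝ≥0) (N n K : ℕ)
    (a : ℕ → Fin n → ℝ) :
    charFun (P.map fun ω => ∑ k : Fin K, ∑ j : Fin n, a k j * riemannSum (lam k)
        (fun r => Z k r ω) ((j : ℕ) * h) ((j + 1 : ℕ) * h) N) 1
      = ∏ k : Fin K, ∏ j, riemannChar α (lam k) h N (a k j) := by
  have hle : ∀ j : ℕ, (j : ℝ≥0) * h ≤ (j + 1 : ℕ) * h := fun j => by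
    gcongr
    exact_mod_cast j.le_succ
  have hmeas : ∀ k : Fin K, Measurable fun path : ℝ≥0 → ℝ => ∑ j : Fin n, a k j * riemannSum (lam k)
      path ((j : ℕ) * h) ((j + 1 : ℕ) * h) N := fun k => by
    refine Finset.measurable_fun_sum _ fun j _ => Measurable.const_mul ?_ _
    exact measurable_riemannSum (ℓ := fun r (path : ℝ≥0 → ℝ) => path r) (lam k) (hle j)
      (fun r _ => measurable_pi_apply r) N
  have hind : iIndepFun (fun (k : Fin K) (ω : Ω) => ∑ j : Fin n, a k j * riemannSum (lam k)
        (fun r => Z k r ω) ((j : ℕ) * h) ((j + 1 : ℕ) * h) N) P :=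
    (hZ.cyl.indep.precomp Fin.val_injective).comp _ hmeas
  have hpath : ∀ k : Fin K, Measurable fun ω t => Z k t ω := fun k =>
    measurable_pi_lambda _ fun t => hZ.measurable k t
  refine (congrFun (hind.charFun_map_fun_sum_eq_prod fun k =>
    ((hmeas k).comp (hpath k)).aemeasurable) 1).trans ?_
  rw [Finset.prod_apply]
  exact Finset.prod_congr rfl fun k _ =>
    (hZ.cyl.stable k).charFun_sum_riemannSum (hZ.measurable k) (lam k) h N n (a k)

/-- Over consecutive time intervals of equal length, finitely many coordinates of the stochastic
convolution have the characteristic function of independent copies. -/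
theorem charFun_sum_sum_pathConv (hZ : IsConvolvableNoise P ℱ α lam γ Z) (h : ℝ≥0) (n K : ℕ)
    (a : ℕ → Fin n → ℝ) :
    charFun (P.map fun ω => ∑ k : Fin K, ∑ j : Fin n, a k j * pathConv (lam k)
        (fun r => Z k r ω) ((j : ℕ) * h) ((j + 1 : ℕ) * h)) 1
      = ∏ j, charFun (P.map fun ω => ∑ k : Fin K, a k j * pathConv (lam k)
        (fun r => Z k r ω) 0 h) 1 := by
  have hle : ∀ j : ℕ, (j : ℝ≥0) * h ≤ (j + 1 : ℕ) * h := fun j => by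
    gcongr
    exact_mod_cast j.le_succ
  have hlim : ∀ (n : ℕ) (b : ℕ → Fin n → ℝ),
      Tendsto (fun N => ∏ k : Fin K, ∏ j, riemannChar α (lam k) h N (b k j)) atTop
        (𝓝 (charFun (P.map fun ω => ∑ k : Fin K, ∑ j : Fin n, b k j * pathConv (lam k)
          (fun r => Z k r ω) ((j : ℕ) * h) ((j + 1 : ℕ) * h)) 1)) := fun n b => by
    simp_rw [← hZ.charFun_sum_sum_riemannSum h _ n K b]
    refine tendsto_charFun_map_one (fun N => Measurable.aemeasurable ?_) ?_
    · refine Finset.measurable_fun_sum _ fun k _ => Finset.measurable_fun_sum _ fun j _ =>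
        Measurable.const_mul ?_ _
      exact measurable_riemannSum (lam k) (hle j) (fun r _ => hZ.measurable k r) N
    · filter_upwards [hZ.ae_isCadlag] with ω hω
      exact tendsto_finsetSum _ fun k _ => tendsto_finsetSum _ fun j _ =>
        ((hω k).tendsto_riemannSum (hZ.lam_pos k).le (hle j)).const_mul _
  refine tendsto_nhds_unique (hlim n a) ?_
  simp_rw [fun N => Finset.prod_comm (s := (Finset.univ : Finset (Fin K)))
    (t := (Finset.univ : Finset (Fin n))) (f := fun k j => riemannChar α (lam k) h N (a k j))]
  refine tendsto_finsetProd _ fun j _ => ?_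
  have := hlim 1 fun k _ => a k j
  simpa using this

variable [NormedAddCommGroup H] [InnerProductSpace ℝ H] [CompleteSpace H] [MeasurableSpace H]
  [BorelSpace H] {e : HilbertBasis ℕ ℝ H}

theorem aemeasurable_noise (hZ : IsConvolvableNoise P ℱ α lam γ Z) {s t : ℝ≥0} (hst : s ≤ t) :
    AEMeasurable (noise e lam γ Z s t) P :=
  ((hZ.aestronglyMeasurable_noise hst).mono (ℱ.le t)).aemeasurable

variable [SecondCountableTopology H]

/-- The joint characteristic function of consecutive increments factorizes; this gives both their
independence and their equality in law. -/
theorem charFun_sum_inner_noise (hZ : IsConvolvableNoise P ℱ α lam γ Z) (h : ℝ≥0) (n : ℕ)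
    (a : Fin n → H) :
    charFun (P.map fun ω => ∑ j : Fin n,
        inner ℝ (noise e lam γ Z ((j : ℕ) * h) ((j + 1 : ℕ) * h) ω) (a j)) 1
      = ∏ j, charFun (P.map (noise e lam γ Z 0 h)) (a j) := by
  have hle : ∀ j : ℕ, (j : ℝ≥0) * h ≤ (j + 1 : ℕ) * h := fun j => by
    gcongr
    exact_mod_cast j.le_succ
  have hsum : ∀ (s t : ℝ≥0), s ≤ t → ∀ᵐ ω ∂P, ∀ v : H, Tendsto (fun K : ℕ => ∑ k : Fin K,
      (γ k * inner ℝ (e k) v) * pathConv (lam k) (fun r => Z k r ω) s t) atTop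
        (𝓝 (inner ℝ (noise e lam γ Z s t ω) v)) := fun s t hst => by
    filter_upwards [hZ.ae_summable (e := e) hst] with ω hω v
    have h1 := hω.hasSum.tendsto_sum_nat.inner (𝕜 := ℝ) (tendsto_const_nhds (x := v))
    refine h1.congr fun K => ?_
    rw [sum_inner, Finset.sum_range]
    refine Finset.sum_congr rfl fun k _ => ?_
    rw [real_inner_smul_left]
    ring
  have hcoord : ∀ (k j : ℕ), AEMeasurable (fun ω => pathConv (lam k) (fun r => Z k r ω)
      ((j : ℕ) * h) ((j + 1 : ℕ) * h)) P := fun k j =>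
    (((hZ.cyl.stable k).aestronglyMeasurable_pathConv (hZ.lam_pos k).le (hle j)
      fun r _ => hZ.measurable k r)).aemeasurable
  have hL := tendsto_charFun_map_one (P := P)
    (X := fun K ω => ∑ k : Fin K, ∑ j : Fin n, (γ k * inner ℝ (e k) (a j)) * pathConv (lam k)
        (fun r => Z k r ω) ((j : ℕ) * h) ((j + 1 : ℕ) * h))
    (Y := fun ω => ∑ j : Fin n,
        inner ℝ (noise e lam γ Z ((j : ℕ) * h) ((j + 1 : ℕ) * h) ω) (a j))
    (fun K => Finset.aemeasurable_fun_sum _ fun k _ => Finset.aemeasurable_fun_sum _ fun j _ =>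
      (hcoord k j).const_mul _) (by
      have hall : ∀ᵐ ω ∂P, ∀ j : Fin n, _ := ae_all_iff.2 fun j : Fin n => hsum _ _ (hle j)
      filter_upwards [hall] with ω hω
      exact (tendsto_finsetSum _ fun j _ => hω j (a j)).congr fun K => Finset.sum_comm)
  refine tendsto_nhds_unique hL ?_
  simp_rw [fun K => hZ.charFun_sum_sum_pathConv h n K fun k j => γ k * inner ℝ (e k) (a j)]
  refine tendsto_finsetProd _ fun j _ => ?_
  have hR : charFun (P.map (noise e lam γ Z 0 h)) (a j)
      = charFun (P.map fun ω => inner ℝ (noise e lam γ Z 0 h ω) (a j)) 1 := by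
    have hm := hZ.aemeasurable_noise (e := e) (zero_le (a := h))
    rw [charFun_map_one (by fun_prop), charFun_apply,
      integral_map hm (by fun_prop)]
  rw [hR]
  refine tendsto_charFun_map_one (fun K => ?_) ?_
  · refine Finset.aemeasurable_fun_sum _ fun k _ => ?_
    have := hcoord k 0
    simp only [Nat.cast_zero, zero_mul, zero_add, Nat.cast_one, one_mul] at this
    exact this.const_mul _
  · filter_upwards [hsum 0 h zero_le] with ω hω
    exact hω (a j)

theorem map_noise_eq (hZ : IsConvolvableNoise P ℱ α lam γ Z) (h : ℝ≥0) (n : ℕ) :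
    P.map (noise e lam γ Z (n * h) ((n + 1 : ℕ) * h)) = P.map (noise e lam γ Z 0 h) := by
  have hle : (n : ℝ≥0) * h ≤ (n + 1 : ℕ) * h := by
    gcongr
    exact_mod_cast n.le_succ
  have hm := hZ.aemeasurable_noise (e := e) hle
  have := Measure.isProbabilityMeasure_map hm
  have := Measure.isProbabilityMeasure_map (hZ.aemeasurable_noise (e := e) (zero_le (a := h)))
  refine Measure.ext_of_charFun (funext fun v => ?_)
  have key := hZ.charFun_sum_inner_noise (e := e) h (n + 1) (Fin.snoc (fun _ => 0) v)
  simp only [Fin.sum_univ_castSucc, Fin.prod_univ_castSucc, Fin.snoc_castSucc, Fin.snoc_last,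
    inner_zero_right, Finset.sum_const_zero, zero_add, Fin.val_last, charFun_zero] at key
  rw [charFun_map_one (by fun_prop)] at key
  rw [charFun_apply, integral_map hm (by fun_prop), key]
  simp

/-- The increments of the stochastic convolution over consecutive intervals are independent. -/
theorem iIndepFun_noise (hZ : IsConvolvableNoise P ℱ α lam γ Z) (h : ℝ≥0) (n : ℕ) :
    iIndepFun (fun (j : Fin n) => noise e lam γ Z ((j : ℕ) * h) ((j + 1 : ℕ) * h)) P := by
  have hle : ∀ j : ℕ, (j : ℝ≥0) * h ≤ (j + 1 : ℕ) * h := fun j => by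
    gcongr
    exact_mod_cast j.le_succ
  have hm : ∀ j : ℕ, AEMeasurable (noise e lam γ Z (j * h) ((j + 1 : ℕ) * h)) P := fun j =>
    hZ.aemeasurable_noise (hle j)
  rw [iIndepFun_iff_charFun_pi (ι := Fin n) fun j => hm j]
  intro t
  have key := hZ.charFun_sum_inner_noise (e := e) h n t
  have hm' : AEMeasurable (fun ω => ∑ j : Fin n,
      inner ℝ (noise e lam γ Z ((j : ℕ) * h) ((j + 1 : ℕ) * h) ω) (t j)) P :=
    Finset.aemeasurable_fun_sum _ fun j _ => (hm j).inner_const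
  rw [charFun_map_one hm'] at key
  simp_rw [hZ.map_noise_eq h]
  rw [← key, charFun_apply, integral_map]
  · rfl
  · exact (WithLp.measurable_toLp 2 _).comp_aemeasurable (aemeasurable_pi_lambda _ fun j => hm j)
  · fun_prop

end IsConvolvableNoise

end IncrementLaws

/-! ### The Euler chain -/

section EulerChain

variable {E : Type*} [NormedAddCommGroup E] [NormedSpace ℝ E] {S : ℝ≥0 → E →L[ℝ] E} {g : E → E}

theorem euler_congr {h : ℝ≥0} {δ δ' : ℕ → E} {y : E} {n : ℕ} (hδ : ∀ j < n, δ j = δ' j) :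
    euler S g h δ y n = euler S g h δ' y n := by
  induction n with
  | zero => rfl
  | succ n ih =>
    simp only [euler]
    rw [ih fun j hj => hδ j (hj.trans n.lt_succ_self), hδ n n.lt_succ_self]

theorem norm_euler_sub_le {lam : ℝ} (hS : IsDecaySemigroup S lam) {K : ℝ≥0} (hg : LipschitzWith K g)
    (h : ℝ≥0) (δ : ℕ → E) (y z : E) (n : ℕ) :
    ‖euler S g h δ y n - euler S g h δ z n‖ ≤ Real.exp (K * (n * h)) * ‖y - z‖ := by
  induction n with
  | zero => simp [euler]
  | succ n ih =>
    simp only [euler]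
    set a := euler S g h δ y n
    set b := euler S g h δ z n
    rw [add_sub_add_right_eq_sub, ← map_sub]
    have h1 : a + (h : ℝ) • g a - (b + (h : ℝ) • g b) = (a - b) + (h : ℝ) • (g a - g b) := by
      rw [smul_sub]
      abel
    rw [h1]
    refine (hS.norm_apply_le _ _).trans ((norm_add_le _ _).trans ?_)
    rw [norm_smul, Real.norm_of_nonneg h.coe_nonneg]
    have h2 : (h : ℝ) * ‖g a - g b‖ ≤ h * (K * ‖a - b‖) := by
      gcongr
      exact hg.norm_sub_le _ _
    have h3 : 1 + (K : ℝ) * h ≤ Real.exp (K * h) := by linarith [Real.add_one_le_exp ((K : ℝ) * h)]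
    have h4 : Real.exp (K * ((n + 1 : ℕ) * h)) = Real.exp (K * h) * Real.exp (K * (n * h)) := by
      rw [← Real.exp_add]
      push_cast
      ring_nf
    calc ‖a - b‖ + h * ‖g a - g b‖ ≤ (1 + K * h) * ‖a - b‖ := by linarith
      _ ≤ Real.exp (K * h) * (Real.exp (K * (n * h)) * ‖y - z‖) := by gcongr
      _ = _ := by rw [h4, mul_assoc]

variable [MeasurableSpace E] [BorelSpace E] [SecondCountableTopology E]

theorem measurable_euler {X : Type*} [MeasurableSpace X] {f : X → ℕ → E} {h : ℝ≥0} {y : E} {n : ℕ}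
    (hf : ∀ j < n, Measurable fun x => f x j) (hg : Continuous g) :
    Measurable fun x => euler S g h (f x) y n := by
  induction n with
  | zero => exact measurable_const
  | succ n ih =>
    have h1 := ih fun j hj => hf j (hj.trans n.lt_succ_self)
    have h2 : Continuous fun z : E => S h (z + (h : ℝ) • g z) := by fun_prop
    exact (h2.measurable.comp h1).add (hf n n.lt_succ_self)

/-- The transition operator of the Euler chain with noise increments of law `π`. -/
noncomputable def eulerOp (S : ℝ≥0 → E →L[ℝ] E) (g : E → E) (h : ℝ≥0) (π : Measure E)
    (φ : E → ℝ) (z : E) : ℝ :=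
  ∫ v, φ (S h (z + (h : ℝ) • g z) + v) ∂π

theorem measurable_eulerOp (hg : Continuous g) (h : ℝ≥0) (π : Measure E) [SFinite π] {φ : E → ℝ}
    (hφ : Measurable φ) : Measurable (eulerOp S g h π φ) := by
  have h2 : Continuous fun z : E × E => S h (z.1 + (h : ℝ) • g z.1) + z.2 := by fun_prop
  exact ((hφ.comp h2.measurable).stronglyMeasurable.integral_prod_right' (ν := π)).measurable

omit [BorelSpace E] [SecondCountableTopology E] in
theorem abs_eulerOp_le (h : ℝ≥0) (π : Measure E) [IsProbabilityMeasure π] {φ : E → ℝ} {M : ℝ}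
    (hM : ∀ y, |φ y| ≤ M) (z : E) : |eulerOp S g h π φ z| ≤ M := by
  have := norm_integral_le_of_norm_le_const (μ := π) (C := M)
    (f := fun v => φ (S h (z + (h : ℝ) • g z) + v)) (ae_of_all _ fun v => hM _)
  rwa [probReal_univ, mul_one] at this

end EulerChain

section EulerNoise

variable {Ω H : Type*} [m : MeasurableSpace Ω] {P : Measure Ω} [IsProbabilityMeasure P]
  {ℱ : Filtration ℝ≥0 m} {α : ℝ} {lam γ : ℕ → ℝ} {Z : ℕ → ℝ≥0 → Ω → ℝ}
  [NormedAddCommGroup H] [InnerProductSpace ℝ H] [CompleteSpace H] [MeasurableSpace H]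
  [BorelSpace H] [SecondCountableTopology H] {e : HilbertBasis ℕ ℝ H} {S : ℝ≥0 → H →L[ℝ] H}
  {g : H → H}

namespace IsConvolvableNoise

omit [SecondCountableTopology H] in
theorem aemeasurable_noise_step (hZ : IsConvolvableNoise P ℱ α lam γ Z) (h : ℝ≥0) (j : ℕ) :
    AEMeasurable (noise e lam γ Z (j * h) ((j + 1 : ℕ) * h)) P := by
  refine hZ.aemeasurable_noise ?_
  gcongr
  exact_mod_cast j.le_succ

theorem aemeasurable_euler (hZ : IsConvolvableNoise P ℱ α lam γ Z) (hg : Continuous g) (h : ℝ≥0)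
    (y : H) (n : ℕ) : AEMeasurable (fun ω => euler S g h
      (fun j => noise e lam γ Z (j * h) ((j + 1 : ℕ) * h) ω) y n) P := by
  have h1 : AEMeasurable (fun ω (j : ℕ) => noise e lam γ Z (j * h) ((j + 1 : ℕ) * h) ω) P :=
    aemeasurable_pi_lambda _ fun j => hZ.aemeasurable_noise_step h j
  exact (measurable_euler (f := fun δ : ℕ → H => δ) (fun j _ => measurable_pi_apply j)
    hg).comp_aemeasurable h1

/-- The state of the Euler scheme after `n` steps depends on the increments `0, …, n - 1` only,
so it is independent of the next one. -/
theorem indepFun_euler (hZ : IsConvolvableNoise P ℱ α lam γ Z) (hg : Continuous g) (h : ℝ≥0)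
    (y : H) (n : ℕ) : IndepFun (fun ω => euler S g h
      (fun j => noise e lam γ Z (j * h) ((j + 1 : ℕ) * h) ω) y n)
      (noise e lam γ Z (n * h) ((n + 1 : ℕ) * h)) P := by
  have h0 := (hZ.iIndepFun_noise (e := e) h (n + 1)).indepFun_finset₀ {Fin.last n}ᶜ {Fin.last n}
    disjoint_compl_left fun j => hZ.aemeasurable_noise_step h j
  have hψ : Measurable fun δ : ({Fin.last n}ᶜ : Finset (Fin (n + 1))) → H => euler S g h
      (fun j => if hj : j < n then δ ⟨⟨j, hj.trans n.lt_succ_self⟩, by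
        simp [Fin.ext_iff, hj.ne]⟩ else 0) y n := by
    refine measurable_euler (fun j hj => ?_) hg
    simp only [hj, dite_true]
    exact measurable_pi_apply _
  have hψ' : Measurable fun δ : ({Fin.last n} : Finset (Fin (n + 1))) → H =>
      δ ⟨Fin.last n, by simp⟩ := measurable_pi_apply _
  refine (h0.comp hψ hψ').congr (ae_of_all _ fun ω => ?_) (ae_of_all _ fun ω => rfl)
  refine euler_congr fun j hj => ?_
  simp [hj]

/-- The Euler scheme is a Markov chain with transition operator `eulerOp`. -/
theorem integral_euler_eq_iterate (hZ : IsConvolvableNoise P ℱ α lam γ Z) (hg : Continuous g)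
    (h : ℝ≥0) (n : ℕ) {φ : H → ℝ} (hφ : Measurable φ) {M : ℝ} (hM : ∀ y, |φ y| ≤ M) (y : H) :
    ∫ ω, φ (euler S g h (fun j => noise e lam γ Z (j * h) ((j + 1 : ℕ) * h) ω) y n) ∂P
      = (eulerOp S g h (P.map (noise e lam γ Z 0 h)))^[n] φ y := by
  set π := P.map (noise e lam γ Z 0 h) with hπ
  have : IsProbabilityMeasure π :=
    Measure.isProbabilityMeasure_map (hZ.aemeasurable_noise (e := e) zero_le)
  induction n generalizing φ with
  | zero => simp [euler]
  | succ n ih =>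
    rw [Function.iterate_succ_apply, ← ih (measurable_eulerOp hg h π hφ) (abs_eulerOp_le h π hM)]
    have hm := hZ.aemeasurable_euler (e := e) (S := S) hg h y n
    have hV := hZ.aemeasurable_noise_step (e := e) h n
    have hmap := (indepFun_iff_map_prod_eq_prod_map_map hm hV).1
      (hZ.indepFun_euler (e := e) (S := S) hg h y n)
    rw [hZ.map_noise_eq, ← hπ] at hmap
    have := Measure.isProbabilityMeasure_map hm
    have h2 : Continuous fun z : H × H => S h (z.1 + (h : ℝ) • g z.1) + z.2 := by fun_prop
    have hφ2 : Measurable fun z : H × H => φ (S h (z.1 + (h : ℝ) • g z.1) + z.2) :=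
      hφ.comp h2.measurable
    have h3 := integral_map (hm.prodMk hV) (hφ2.aestronglyMeasurable (μ := P.map _))
    have h4 := integral_map hm
      ((measurable_eulerOp (S := S) hg h π hφ).aestronglyMeasurable (μ := P.map _))
    rw [← h4]
    refine h3.symm.trans ?_
    rw [hmap, integral_prod]
    · rfl
    · refine Integrable.of_bound hφ2.aestronglyMeasurable M (ae_of_all _ fun z => ?_)
      exact hM _

/-- Chapman--Kolmogorov equation of the Euler chain. -/
theorem integral_euler_add (hZ : IsConvolvableNoise P ℱ α lam γ Z) (hg : Continuous g)
    (h : ℝ≥0) (a b : ℕ) {φ : H → ℝ} (hφ : Measurable φ) {M : ℝ} (hM : ∀ y, |φ y| ≤ M) (y : H) :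
    ∫ ω, φ (euler S g h (fun j => noise e lam γ Z (j * h) ((j + 1 : ℕ) * h) ω) y (a + b)) ∂P
      = ∫ ω, ∫ ω', φ (euler S g h (fun j => noise e lam γ Z (j * h) ((j + 1 : ℕ) * h) ω')
        (euler S g h (fun j => noise e lam γ Z (j * h) ((j + 1 : ℕ) * h) ω) y a) b) ∂P ∂P := by
  set π := P.map (noise e lam γ Z 0 h) with hπ
  have : IsProbabilityMeasure π :=
    Measure.isProbabilityMeasure_map (hZ.aemeasurable_noise (e := e) zero_le)
  have hpres : ∀ n, Measurable ((eulerOp S g h π)^[n] φ) ∧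
      ∀ y, |(eulerOp S g h π)^[n] φ y| ≤ M := fun n => by
    induction n with
    | zero => exact ⟨hφ, hM⟩
    | succ n ih =>
      rw [Function.iterate_succ_apply']
      exact ⟨measurable_eulerOp hg h π ih.1, abs_eulerOp_le h π ih.2⟩
  rw [hZ.integral_euler_eq_iterate hg h _ hφ hM, Function.iterate_add_apply,
    ← hZ.integral_euler_eq_iterate hg h _ (hpres b).1 (hpres b).2]
  exact integral_congr_ae (ae_of_all _ fun ω => (hZ.integral_euler_eq_iterate hg h b hφ hM _).symm)

end IsConvolvableNoise

end EulerNoise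

/-! ### The flow of a frozen equation -/

section LipschitzFunctionals

variable {Ω H V : Type*} [m : MeasurableSpace Ω] {P : Measure Ω} [IsProbabilityMeasure P]
  [NormedAddCommGroup H] {q : ℝ≥0∞} [Fact (1 ≤ q)] [NormedAddCommGroup V]

theorem LipschitzWith.integrable_comp {μ : Measure Ω} [IsFiniteMeasure μ] {L : ℝ≥0} {f : H → V}
    (hf : LipschitzWith L f) {X : Ω → H} (hX : Integrable X μ) :
    Integrable (fun ω => f (X ω)) μ := by
  refine Integrable.mono' ((hX.norm.const_mul (L : ℝ)).add (integrable_const ‖f 0‖))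
    (hf.continuous.comp_aestronglyMeasurable hX.1) (ae_of_all _ fun ω => ?_)
  have h1 := hf.norm_sub_le (X ω) 0
  have h2 := norm_sub_norm_le (f (X ω)) (f 0)
  rw [sub_zero] at h1
  simp only [Pi.add_apply]
  linarith

theorem integral_norm_sub_le_lp (X Y : Lp H q P) : ∫ ω, ‖X ω - Y ω‖ ∂P ≤ ‖X - Y‖ := by
  have h1 : ∫ ω, ‖X ω - Y ω‖ ∂P = ∫ ω, ‖(X - Y) ω‖ ∂P := by
    refine integral_congr_ae ?_
    filter_upwards [Lp.coeFn_sub X Y] with ω hω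
    rw [hω, Pi.sub_apply]
  rw [h1, integral_norm_eq_lintegral_enorm (Lp.memLp _).1]
  exact ENNReal.toReal_le_of_le_ofReal (norm_nonneg _) (lintegral_enorm_lp_le _)

/-- The estimate holds for any coupling; it is integrated over the given one. -/
theorem norm_integral_comp_sub_le [NormedSpace ℝ V] {L₁ L₂ : ℝ≥0} {f₁ f₂ : H → V}
    (hf₁ : LipschitzWith L₁ f₁) (hf₂ : LipschitzWith L₂ f₂) {c L : ℝ} (hL : 0 ≤ L)
    (h : ∀ a b, ‖f₁ a - f₂ b‖ ≤ c + L * ‖a - b‖) (X Y : Lp H q P) :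
    ‖∫ ω, f₁ (X ω) ∂P - ∫ ω, f₂ (Y ω) ∂P‖ ≤ c + L * ‖X - Y‖ := by
  have hX := integrable_lp X
  have hY := integrable_lp Y
  rw [← integral_sub (hf₁.integrable_comp hX) (hf₂.integrable_comp hY)]
  have hs : Integrable (fun ω => L * ‖X ω - Y ω‖) P := (hX.sub hY).norm.const_mul L
  have hi : Integrable (fun ω => c + L * ‖X ω - Y ω‖) P := (integrable_const c).add hs
  refine (norm_integral_le_of_norm_le hi (ae_of_all _ fun ω => h _ _)).trans ?_
  rw [integral_add (integrable_const c) hs, integral_const,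
    probReal_univ, one_smul, integral_const_mul]
  gcongr
  exact integral_norm_sub_le_lp X Y

/-- The operator `φ ↦ 𝔼 φ(U y t)` of a flow `U`, the counterpart of `transitionOp` for curves in
`L^q`. -/
noncomputable def flowOp {Ω : Type*} [MeasurableSpace Ω] {P : Measure Ω} {q : ℝ≥0∞}
    (U : H → ℝ≥0 → Lp H q P) (t : ℝ≥0) (φ : H → ℝ) (y : H) : ℝ :=
  ∫ ω, φ (U y t ω) ∂P

omit [Fact (1 ≤ q)] in
theorem abs_flowOp_le {U : H → ℝ≥0 → Lp H q P} (t : ℝ≥0) {φ : H → ℝ} {M : ℝ}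
    (hM : ∀ y, |φ y| ≤ M) (y : H) : |flowOp U t φ y| ≤ M := by
  have := norm_integral_le_of_norm_le_const (μ := P) (C := M)
    (f := fun ω => φ (U y t ω)) (ae_of_all _ fun v => hM _)
  rwa [probReal_univ, mul_one] at this

end LipschitzFunctionals

section FrozenFlow

variable {Ω H : Type*} [m : MeasurableSpace Ω] {P : Measure Ω} [IsProbabilityMeasure P]
  {ℱ : Filtration ℝ≥0 m} {α : ℝ} {lam γ : ℕ → ℝ} {Z : ℕ → ℝ≥0 → Ω → ℝ}
  [NormedAddCommGroup H] [InnerProductSpace ℝ H] [CompleteSpace H] [MeasurableSpace H]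
  [BorelSpace H] [SecondCountableTopology H] {e : HilbertBasis ℕ ℝ H} {A : H →ₗ.[ℝ] H}
  {S : ℝ≥0 → H →L[ℝ] H} {lam₀ p : ℝ} [Fact (1 ≤ ENNReal.ofReal p)] {hp : 0 < p} {K : ℝ≥0}
  {g : H → H}

/-- The solutions `U y` in `L^p`, for all deterministic initial values `y`, of the equation
`dU = [A U + g(U)] dt + dZ`; `w` is the stochastic convolution. The field `drift_lipschitz` is
`lipschitz` for `g` read as a coefficient that ignores the law, the form that `nemytskii` takes. -/
structure IsFrozenFlow (P : Measure Ω) [IsProbabilityMeasure P] (ℱ : Filtration ℝ≥0 m) (α : ℝ)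
    (lam γ : ℕ → ℝ) (Z : ℕ → ℝ≥0 → Ω → ℝ) (e : HilbertBasis ℕ ℝ H) (A : H →ₗ.[ℝ] H)
    (S : ℝ≥0 → H →L[ℝ] H) (lam₀ : ℝ) (hp : 0 < p) (K : ℝ≥0) (g : H → H)
    (w : ℝ≥0 → Lp H (ENNReal.ofReal p) P) (U : H → ℝ≥0 → Lp H (ENNReal.ofReal p) P) : Prop where
  noise : IsConvolvableNoise P ℱ α lam γ Z
  generated : IsSemigroupGeneratedBy A S
  eigen : ∀ k, (e k, -(lam k) • e k) ∈ A.graph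
  decay : IsDecaySemigroup S lam₀
  lipschitz : LipschitzWith K g
  dissipative : K < lam₀
  w_zero : w 0 = 0
  w_bdd : ∃ M, ∀ t, ‖w t‖ ≤ M
  w_ae : ∀ t, w t =ᵐ[P] _root_.noise e lam γ Z 0 t
  drift_lipschitz : IsLipschitzCoeff K (fun z (_ : Pp H p) => g z)
  curve : ∀ y, IsMildCurve (fun t => (S t).compLpL (ENNReal.ofReal p) P)
    (nemytskii P hp drift_lipschitz) w (Lp.const (ENNReal.ofReal p) P y) (U y)

namespace IsFrozenFlow

variable {w : ℝ≥0 → Lp H (ENNReal.ofReal p) P} {U : H → ℝ≥0 → Lp H (ENNReal.ofReal p) P}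

omit [CompleteSpace H] in
theorem lipschitzWith_drift (hU : IsFrozenFlow P ℱ α lam γ Z e A S lam₀ hp K g w U) :
    LipschitzWith K (nemytskii P hp hU.drift_lipschitz) := by
  refine LipschitzWith.of_dist_le_mul fun X Y => ?_
  rw [dist_eq_norm, dist_eq_norm]
  have := norm_nemytskii_sub_le hp hU.drift_lipschitz hU.drift_lipschitz (X := X) (Y := Y)
    le_rfl K.coe_nonneg fun x y => by simpa using hU.lipschitz.norm_sub_le x y
  simpa using this

/-- The Euler scheme in `L^p` is the Euler scheme in `H`, `ω` by `ω`. -/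
theorem euler_ae (hU : IsFrozenFlow P ℱ α lam γ Z e A S lam₀ hp K g w U) (h : ℝ≥0) (y : H) (n : ℕ) :
    ((euler (fun t => (S t).compLpL (ENNReal.ofReal p) P) (nemytskii P hp hU.drift_lipschitz) h
        (fun j => w ((j + 1 : ℕ) * h) - (S h).compLpL (ENNReal.ofReal p) P (w (j * h)))
        (Lp.const (ENNReal.ofReal p) P y) n : Lp H (ENNReal.ofReal p) P) : Ω → H)
      =ᵐ[P] fun ω => euler S g h
        (fun j => _root_.noise e lam γ Z (j * h) ((j + 1 : ℕ) * h) ω) y n := by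
  induction n with
  | zero => exact Lp.coeFn_const ..
  | succ n ih =>
    simp only [euler]
    set x := euler (fun t => (S t).compLpL (ENNReal.ofReal p) P)
      (nemytskii P hp hU.drift_lipschitz) h
      (fun j => w ((j + 1 : ℕ) * h) - (S h).compLpL (ENNReal.ofReal p) P (w (j * h)))
      (Lp.const (ENNReal.ofReal p) P y) n
    have hle : (n : ℝ≥0) * h ≤ (n + 1 : ℕ) * h := by
      gcongr
      exact_mod_cast n.le_succ
    have hsub : ((n + 1 : ℕ) : ℝ≥0) * h - n * h = h := by
      rw [Nat.cast_succ, add_mul, one_mul, add_tsub_cancel_left]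
    have hadd := hU.noise.noise_add hU.generated hU.eigen (zero_le (a := (n : ℝ≥0) * h)) hle
    rw [hsub] at hadd
    filter_upwards [ih, hadd, hU.w_ae ((n + 1 : ℕ) * h), hU.w_ae (n * h),
      coeFn_nemytskii hp hU.drift_lipschitz x, Lp.coeFn_smul (h : ℝ)
        (nemytskii P hp hU.drift_lipschitz x),
      Lp.coeFn_add x ((h : ℝ) • nemytskii P hp hU.drift_lipschitz x),
      (S h).coeFn_compLpL (x + (h : ℝ) • nemytskii P hp hU.drift_lipschitz x),
      (S h).coeFn_compLpL (w (n * h)),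
      Lp.coeFn_sub (w ((n + 1 : ℕ) * h)) ((S h).compLpL (ENNReal.ofReal p) P (w (n * h))),
      Lp.coeFn_add ((S h).compLpL (ENNReal.ofReal p) P
        (x + (h : ℝ) • nemytskii P hp hU.drift_lipschitz x)) (w ((n + 1 : ℕ) * h)
          - (S h).compLpL (ENNReal.ofReal p) P (w (n * h)))] with
      ω h1 h2 h3 h4 h5 h6 h7 h8 h9 h10 h11
    rw [h11, Pi.add_apply, h8, h7, Pi.add_apply, h6, Pi.smul_apply, h5, h10, Pi.sub_apply, h9, h3,
      h4, h2, h1]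
    congr 1
    abel

/-- Along a refining grid the Euler scheme converges to the solution. -/
theorem tendsto_euler (hU : IsFrozenFlow P ℱ α lam γ Z e A S lam₀ hp K g w U) (h : ℝ≥0) (a : ℕ)
    (y : H) :
    Tendsto (fun n : ℕ => ∫ ω, ‖euler S g (h / (n + 1 : ℕ)) (fun j => _root_.noise e lam γ Z
        (j * (h / (n + 1 : ℕ))) ((j + 1 : ℕ) * (h / (n + 1 : ℕ))) ω) y (a * (n + 1))
        - U y (a * h) ω‖ ∂P) atTop (𝓝 0) := by
  refine Metric.tendsto_atTop.2 fun ε hε => ?_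
  obtain ⟨δ, hδ, key⟩ := (hU.curve y).euler_close (hU.decay.compLpL hp) hU.lipschitzWith_drift
    hU.w_zero (a * h) (half_pos hε)
  obtain ⟨N, hN⟩ := exists_nat_gt (h / δ)
  refine ⟨N, fun n hn => ?_⟩
  have hn' : h / (n + 1 : ℕ) ≤ δ := by
    rw [div_le_iff₀ (by positivity)]
    rw [div_lt_iff₀ hδ] at hN
    refine hN.le.trans ?_
    rw [mul_comm]
    gcongr
    exact_mod_cast hn.trans n.le_succ
  have heq : ((a * (n + 1) : ℕ) : ℝ≥0) * (h / (n + 1 : ℕ)) = a * h := by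
    push_cast
    field_simp
  have := key (h / (n + 1 : ℕ)) hn' (a * (n + 1)) heq.le
  rw [heq, norm_sub_rev] at this
  have h2 := (integral_norm_sub_le_lp _ _).trans this
  rw [Real.dist_eq, sub_zero, abs_of_nonneg (integral_nonneg fun ω => norm_nonneg _)]
  refine lt_of_le_of_lt (le_of_eq ?_) (h2.trans_lt (half_lt_self hε))
  refine integral_congr_ae ?_
  filter_upwards [hU.euler_ae (h / (n + 1 : ℕ)) y (a * (n + 1))] with ω hω
  rw [hω]

omit [CompleteSpace H] in
theorem norm_sub_le (hU : IsFrozenFlow P ℱ α lam γ Z e A S lam₀ hp K g w U) (y z : H) (t : ℝ≥0) :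
    ‖U y t - U z t‖ ≤ Real.exp (-(lam₀ - K) * t) * ‖y - z‖ := by
  have hd := hU.lipschitzWith_drift
  have := IsMildCurve.norm_sub_le (hU.decay.compLpL (P := P) hp) hd.continuous hd.continuous
    K.coe_nonneg hU.dissipative le_rfl (fun z₁ z₂ => by simpa using hd.norm_sub_le z₁ z₂)
    (hU.curve y) (hU.curve z) t
  rw [zero_div, add_zero, ← map_sub] at this
  refine this.trans ?_
  gcongr
  refine (Lp.norm_const_le ..).trans ?_
  simp

omit [CompleteSpace H] in
theorem abs_flowOp_sub_le (hU : IsFrozenFlow P ℱ α lam γ Z e A S lam₀ hp K g w U) (t : ℝ≥0)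
    {φ : H → ℝ} {L : ℝ≥0} (hφ : LipschitzWith L φ) (y z : H) :
    |flowOp U t φ y - flowOp U t φ z| ≤ L * Real.exp (-(lam₀ - K) * t) * ‖y - z‖ := by
  have := norm_integral_comp_sub_le (c := 0) hφ hφ L.coe_nonneg (fun a b => by
    simpa using hφ.norm_sub_le a b) (U y t) (U z t)
  rw [zero_add] at this
  refine this.trans ?_
  rw [mul_assoc]
  gcongr
  exact hU.norm_sub_le y z t

omit [CompleteSpace H] in
theorem lipschitzWith_flowOp (hU : IsFrozenFlow P ℱ α lam γ Z e A S lam₀ hp K g w U) (t : ℝ≥0)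
    {φ : H → ℝ} {L : ℝ≥0} (hφ : LipschitzWith L φ) : LipschitzWith L (flowOp U t φ) := by
  refine LipschitzWith.of_dist_le_mul fun y z => ?_
  rw [dist_eq_norm, dist_eq_norm]
  refine (hU.abs_flowOp_sub_le t hφ y z).trans ?_
  gcongr
  refine mul_le_of_le_one_right L.coe_nonneg ?_
  rw [Real.exp_le_one_iff]
  nlinarith [hU.dissipative, t.coe_nonneg]

/-- The semigroup property, for two times that are multiples of a common time step: it is the limit
of the Chapman--Kolmogorov equations of the Euler chains. -/
theorem flowOp_add (hU : IsFrozenFlow P ℱ α lam γ Z e A S lam₀ hp K g w U) (h : ℝ≥0) (a b : ℕ)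
    {φ : H → ℝ} {L : ℝ≥0} (hφ : LipschitzWith L φ) {M : ℝ} (hM : ∀ y, |φ y| ≤ M) (y : H) :
    flowOp U ((a + b : ℕ) * h) φ y = flowOp U (a * h) (flowOp U (b * h) φ) y := by
  set E : ℕ → ℕ → H → Ω → H := fun n a y ω => euler S g (h / (n + 1 : ℕ)) (fun j =>
    _root_.noise e lam γ Z (j * (h / (n + 1 : ℕ))) ((j + 1 : ℕ) * (h / (n + 1 : ℕ))) ω) y
      (a * (n + 1)) with hE
  have hEm : ∀ n a y, AEMeasurable (E n a y) P := fun n a y =>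
    hU.noise.aemeasurable_euler hU.lipschitz.continuous _ y _
  have hEi : ∀ n a y, Integrable (E n a y) P := fun n a y =>
    (integrable_lp _).congr (hU.euler_ae (h / (n + 1 : ℕ)) y (a * (n + 1)))
  have hlim : ∀ a y, Tendsto (fun n => ∫ ω, ‖E n a y ω - U y (a * h) ω‖ ∂P) atTop (𝓝 0) :=
    fun a y => hU.tendsto_euler h a y
  have hdiff : ∀ {ψ : H → ℝ} {L : ℝ≥0}, LipschitzWith L ψ → ∀ n a y,
      |∫ ω, ψ (E n a y ω) ∂P - flowOp U (a * h) ψ y| ≤ L * ∫ ω, ‖E n a y ω - U y (a * h) ω‖ ∂P := by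
    intro ψ L hψ n a y
    have hUi := integrable_lp (U y (a * h))
    rw [flowOp, ← integral_sub (hψ.integrable_comp (hEi n a y)) (hψ.integrable_comp hUi),
      ← integral_const_mul, ← Real.norm_eq_abs]
    exact norm_integral_le_of_norm_le (((hEi n a y).sub hUi).norm.const_mul _)
      (ae_of_all _ fun ω => hψ.norm_sub_le _ _)
  have hconv : ∀ {ψ : H → ℝ} {L : ℝ≥0}, LipschitzWith L ψ → ∀ a y,
      Tendsto (fun n => ∫ ω, ψ (E n a y ω) ∂P) atTop (𝓝 (flowOp U (a * h) ψ y)) := by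
    intro ψ L hψ a y
    rw [tendsto_iff_norm_sub_tendsto_zero]
    refine squeeze_zero (fun _ => norm_nonneg _) (fun n => hdiff hψ n a y) ?_
    simpa using (hlim a y).const_mul (L : ℝ)
  set f : ℕ → H → ℝ := fun n z => ∫ ω, φ (E n b z ω) ∂P with hf
  have hfL : ∀ n, LipschitzWith (L * (Real.exp (K * (b * h))).toNNReal) (f n) := fun n => by
    refine LipschitzWith.of_dist_le_mul fun y z => ?_
    rw [dist_eq_norm, dist_eq_norm, hf]
    simp only
    rw [← integral_sub (hφ.integrable_comp (hEi n b y)) (hφ.integrable_comp (hEi n b z))]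
    have h1 : ∀ ω, ‖φ (E n b y ω) - φ (E n b z ω)‖
        ≤ L * (Real.exp (K * (b * h)) * ‖y - z‖) := fun ω => by
      refine (hφ.norm_sub_le _ _).trans ?_
      gcongr
      refine (norm_euler_sub_le hU.decay hU.lipschitz _ _ y z _).trans_eq ?_
      congr 3
      push_cast
      field_simp
    refine (norm_integral_le_of_norm_le_const (ae_of_all _ h1)).trans_eq ?_
    rw [probReal_univ, mul_one, NNReal.coe_mul, Real.coe_toNNReal _ (Real.exp_nonneg _), mul_assoc]
  have hfM : ∀ n z, |f n z| ≤ M := fun n z => by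
    have := norm_integral_le_of_norm_le_const (μ := P) (C := M)
      (f := fun ω => φ (E n b z ω)) (ae_of_all _ fun v => hM _)
    rwa [probReal_univ, mul_one] at this
  have h1 : ∀ n, ∫ ω, φ (E n (a + b) y ω) ∂P = ∫ ω, f n (E n a y ω) ∂P := fun n => by
    have := hU.noise.integral_euler_add (e := e) (S := S) hU.lipschitz.continuous (h / (n + 1 : ℕ))
      (a * (n + 1)) (b * (n + 1)) hφ.continuous.measurable hM y
    rw [← add_mul] at this
    exact this
  have h2 : Tendsto (fun n => ∫ ω, f n (U y (a * h) ω) ∂P) atTop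
      (𝓝 (flowOp U (a * h) (flowOp U (b * h) φ) y)) := by
    refine tendsto_integral_of_dominated_convergence (fun _ => M) (fun n => ?_)
      (integrable_const M) (fun n => ae_of_all _ fun ω => hfM n _)
      (ae_of_all _ fun ω => hconv hφ b _)
    exact (hfL n).continuous.comp_aestronglyMeasurable (Lp.memLp _).1
  have h3 : Tendsto (fun n => ∫ ω, f n (E n a y ω) ∂P - ∫ ω, f n (U y (a * h) ω) ∂P) atTop
      (𝓝 0) := by
    refine squeeze_zero_norm (fun n => hdiff (hfL n) n a y) ?_
    simpa using (hlim a y).const_mul ((L * (Real.exp (K * (b * h))).toNNReal : ℝ≥0) : ℝ)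
  have h4 := h3.add h2
  simp only [sub_add_cancel, zero_add] at h4
  refine tendsto_nhds_unique (hconv hφ (a + b) y) ?_
  simp_rw [h1]
  exact h4

end IsFrozenFlow

end FrozenFlow

/-! ### Bounded Lipschitz functions and tightness -/

section BoundedLipschitz

variable {V : Type*} [MetricSpace V]

theorem lipschitzWith_coe_thickenedIndicator {δ : ℝ} (hδ : 0 < δ) (F : Set V) :
    LipschitzWith δ.toNNReal⁻¹ fun x => (thickenedIndicator hδ F x : ℝ) :=
  fun x y => lipschitzWith_thickenedIndicator hδ F x y

theorem abs_thickenedIndicator_le {δ : ℝ} (hδ : 0 < δ) (F : Set V) (x : V) :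
    |(thickenedIndicator hδ F x : ℝ)| ≤ 1 := by
  rw [NNReal.abs_eq]
  exact_mod_cast thickenedIndicator_le_one hδ F x

variable [MeasurableSpace V] [BorelSpace V]

/-- Bounded Lipschitz functions separate probability measures. -/
theorem Measure.ext_of_lipschitz {μ ν : Measure V} [IsProbabilityMeasure μ] [IsProbabilityMeasure ν]
    (h : ∀ (φ : V → ℝ) (L : ℝ≥0) (M : ℝ), LipschitzWith L φ → (∀ x, |φ x| ≤ M) →
      ∫ x, φ x ∂μ = ∫ x, φ x ∂ν) : μ = ν := by
  refine ext_of_generate_finite _ (by rw [BorelSpace.measurable_eq (α := V),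
    borel_eq_generateFrom_isClosed]) isPiSystem_isClosed (fun F hF => ?_) (by simp)
  have h1 := tendsto_integral_thickenedIndicator_of_isClosed μ hF
    (fun n => Nat.one_div_pos_of_nat (n := n) (α := ℝ)) tendsto_one_div_add_atTop_nhds_zero_nat
  have h2 := tendsto_integral_thickenedIndicator_of_isClosed ν hF
    (fun n => Nat.one_div_pos_of_nat (n := n) (α := ℝ)) tendsto_one_div_add_atTop_nhds_zero_nat
  have h3 := tendsto_nhds_unique h1 (h2.congr fun n =>
    (h _ _ 1 (lipschitzWith_coe_thickenedIndicator _ F) (abs_thickenedIndicator_le _ F)).symm)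
  exact (measureReal_eq_measureReal_iff (measure_ne_top _ _) (measure_ne_top _ _)).1 h3

/-- A family of probability measures is measurable if it is so against bounded Lipschitz
functions. -/
theorem measurable_of_lipschitz {X : Type*} [MeasurableSpace X] {κ : X → Measure V}
    [∀ a, IsProbabilityMeasure (κ a)]
    (h : ∀ (φ : V → ℝ) (L : ℝ≥0) (M : ℝ), LipschitzWith L φ → (∀ x, |φ x| ≤ M) →
      Measurable fun a => ∫ x, φ x ∂(κ a)) : Measurable κ := by
  refine Measurable.measure_of_isPiSystem_of_isProbabilityMeasure
    (by rw [BorelSpace.measurable_eq (α := V), borel_eq_generateFrom_isClosed]) isPiSystem_isClosed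
    fun F hF => ?_
  have h1 : Measurable fun a => (κ a).real F := by
    refine measurable_of_tendsto_metrizable (f := fun (n : ℕ) a =>
      ∫ x, (thickenedIndicator (Nat.one_div_pos_of_nat (n := n) (α := ℝ)) F x : ℝ) ∂(κ a))
      (fun n => ?_) (tendsto_pi_nhds.2 fun a => tendsto_integral_thickenedIndicator_of_isClosed _ hF
        _ tendsto_one_div_add_atTop_nhds_zero_nat)
    exact h _ _ 1 (lipschitzWith_coe_thickenedIndicator _ F) (abs_thickenedIndicator_le _ F)
  have h2 : (fun a => κ a F) = fun a => ENNReal.ofReal ((κ a).real F) := funext fun a => by simp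
  rw [h2]
  exact ENNReal.measurable_ofReal.comp h1

/-- In a complete separable space, a sequence of probability measures is tight if eventually it
gives to each neighbourhood of a compact set almost the mass of the set under one of its terms. -/
theorem isTightMeasureSet_of_thickening [CompleteSpace V] [SecondCountableTopology V]
    {μ : ℕ → Measure V} [∀ n, IsProbabilityMeasure (μ n)]
    (h : ∀ δ : ℝ, 0 < δ → ∀ ε : ℝ≥0∞, 0 < ε → ∃ N, ∀ n, N ≤ n → ∀ F : Set V,
      IsClosed F → μ N F ≤ μ n (Metric.thickening δ F) + ε) :
    IsTightMeasureSet (Set.range μ) := by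
  have hstep : ∀ δ : ℝ, 0 < δ → ∀ ε : ℝ≥0∞, 0 < ε → ∃ C : Set V, IsCompact C ∧
      ∀ n, μ n (Metric.cthickening δ C)ᶜ ≤ ε := by
    intro δ hδ ε hε
    have hε2 : 0 < ε / 2 := ENNReal.half_pos hε.ne'
    obtain ⟨N, hN⟩ := h δ hδ (ε / 2) hε2
    have hC : ∀ i, ∃ C : Set V, IsCompact C ∧ μ i Cᶜ ≤ ε / 2 := fun i => by
      obtain ⟨C, hC, hC'⟩ := isTightMeasureSet_iff_exists_isCompact_measure_compl_le.1
        (isTightMeasureSet_singleton (μ := μ i)) (ε / 2) hε2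
      exact ⟨C, hC, hC' _ rfl⟩
    choose C hC hCμ using hC
    have hsub : ∀ i, i ≤ N → C i ⊆ ⋃ j ∈ Finset.range (N + 1), C j := fun i hi =>
      Set.subset_biUnion_of_mem (u := C) (Finset.mem_coe.2 (Finset.mem_range_succ_iff.2 hi))
    refine ⟨⋃ j ∈ Finset.range (N + 1), C j, Finset.isCompact_biUnion _ fun j _ => hC j,
      fun n => ?_⟩
    rcases le_total n N with hn | hn
    · refine (measure_mono (Set.compl_subset_compl.2 ((hsub n hn).trans
        (Metric.self_subset_cthickening _)))).trans ((hCμ n).trans ENNReal.half_le_self)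
    · have h1 := hN n hn (C N) (hC N).isClosed
      have h2 : Metric.thickening δ (C N)
          ⊆ Metric.cthickening δ (⋃ j ∈ Finset.range (N + 1), C j) :=
        (Metric.thickening_subset_of_subset _ (hsub N le_rfl)).trans
          (Metric.thickening_subset_cthickening _ _)
      refine (measure_mono (Set.compl_subset_compl.2 h2)).trans ?_
      rw [prob_compl_eq_one_sub Metric.isOpen_thickening.measurableSet, tsub_le_iff_right]
      have h3 : (1 : ℝ≥0∞) ≤ μ N (C N) + ε / 2 := by
        have := measure_union_le (μ := μ N) (C N) (C N)ᶜ
        rw [Set.union_compl_self, measure_univ] at this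
        exact this.trans (add_le_add le_rfl (hCμ N))
      refine h3.trans ((add_le_add h1 le_rfl).trans_eq ?_)
      rw [add_assoc, ENNReal.add_halves, add_comm]
  rw [isTightMeasureSet_iff_exists_isCompact_measure_compl_le]
  intro ε hε
  obtain ⟨u, -, hu, hulim⟩ := exists_seq_strictAnti_tendsto (0 : ℝ)
  obtain ⟨ε', hε', hsum⟩ := ENNReal.exists_pos_sum_of_countable' hε.ne' ℕ
  choose C hC hCμ using fun k => hstep (u k) (hu k) (ε' k) (hε' k)
  -- an intersection of closed thickenings, with widths tending to `0`, is totally bounded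
  refine ⟨⋂ k, Metric.cthickening (u k) (C k), ?_, ?_⟩
  · refine TotallyBounded.isCompact_of_isClosed (Metric.totallyBounded_iff.2 fun δ hδ => ?_)
      (isClosed_iInter fun k => Metric.isClosed_cthickening)
    obtain ⟨k, hk⟩ := (hulim.eventually_lt_const (half_pos hδ)).exists
    obtain ⟨t, ht, htC⟩ := Metric.totallyBounded_iff.1 (hC k).totallyBounded (δ / 2) (half_pos hδ)
    refine ⟨t, ht, (Set.iInter_subset _ k).trans fun x hx => ?_⟩
    have hx' := Metric.cthickening_subset_thickening' (half_pos hδ) hk (C k) hx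
    obtain ⟨z, hz, hxz⟩ := Metric.mem_thickening_iff.1 hx'
    obtain ⟨y, hy, hzy⟩ := Set.mem_iUnion₂.1 (htC hz)
    refine Set.mem_iUnion₂.2 ⟨y, hy, ?_⟩
    rw [Metric.mem_ball] at hzy ⊢
    linarith [dist_triangle x z y]
  · rintro _ ⟨n, rfl⟩
    rw [Set.compl_iInter]
    exact (measure_iUnion_le _).trans ((ENNReal.tsum_le_tsum fun k => hCμ k n).trans hsum.le)

end BoundedLipschitz

/-! ### Existence and uniqueness of the invariant measure -/

section InvariantMeasure

variable {Ω H : Type*} [m : MeasurableSpace Ω] {P : Measure Ω} [IsProbabilityMeasure P]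
  {ℱ : Filtration ℝ≥0 m} {α : ℝ} {lam γ : ℕ → ℝ} {Z : ℕ → ℝ≥0 → Ω → ℝ}
  [NormedAddCommGroup H] [InnerProductSpace ℝ H] [CompleteSpace H] [MeasurableSpace H]
  [BorelSpace H] [SecondCountableTopology H] {e : HilbertBasis ℕ ℝ H} {A : H →ₗ.[ℝ] H}
  {S : ℝ≥0 → H →L[ℝ] H} {lam₀ p : ℝ} [Fact (1 ≤ ENNReal.ofReal p)] {hp : 0 < p} {K : ℝ≥0}
  {g : H → H} {w : ℝ≥0 → Lp H (ENNReal.ofReal p) P} {U : H → ℝ≥0 → Lp H (ENNReal.ofReal p) P}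

theorem tendsto_exp_decay {κ : ℝ} (hκ : 0 < κ) (c : ℝ) :
    Tendsto (fun n : ℕ => c * Real.exp (-κ * (n : ℝ≥0))) atTop (𝓝 0) := by
  have h1 : Tendsto (fun n : ℕ => -κ * (n : ℝ)) atTop atBot :=
    tendsto_natCast_atTop_atTop.const_mul_atTop_of_neg (by linarith)
  have := (Real.tendsto_exp_atBot.comp h1).const_mul c
  simpa using this

namespace IsFrozenFlow

omit [CompleteSpace H] in
theorem exists_moment_bound (hU : IsFrozenFlow P ℱ α lam γ Z e A S lam₀ hp K g w U) :
    ∃ C : ℝ, 0 ≤ C ∧ ∀ t, ∫ ω, ‖U 0 t ω‖ ∂P ≤ C := by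
  obtain ⟨M, hM⟩ := hU.w_bdd
  have hn := fun t => IsMildCurve.norm_le (hU.decay.compLpL (P := P) hp) hU.lipschitzWith_drift
    hU.dissipative hM (hU.curve 0) t
  refine ⟨_, (norm_nonneg _).trans (hn 0), fun t => le_trans ?_ (hn t)⟩
  have := integral_norm_sub_le_lp (U 0 t) 0
  rw [sub_zero] at this
  refine le_trans (le_of_eq (integral_congr_ae ?_)) this
  filter_upwards [Lp.coeFn_zero H (ENNReal.ofReal p) P] with ω hω
  rw [hω, Pi.zero_apply, sub_zero]

/-- Started at `0`, the averages of Lipschitz functions converge exponentially fast: after the first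
`k` time units the flow restarts from an integrable random point, and forgets it. -/
theorem abs_flowOp_add_sub_le (hU : IsFrozenFlow P ℱ α lam γ Z e A S lam₀ hp K g w U) {C : ℝ}
    (hC : ∀ t, ∫ ω, ‖U 0 t ω‖ ∂P ≤ C) {φ : H → ℝ} {L : ℝ≥0} (hφ : LipschitzWith L φ) {M : ℝ}
    (hM : ∀ y, |φ y| ≤ M) {n n' : ℕ} (hn : n ≤ n') :
    |flowOp U n' φ 0 - flowOp U n φ 0| ≤ L * C * Real.exp (-(lam₀ - K) * (n : ℝ≥0)) := by
  obtain ⟨k, rfl⟩ := Nat.exists_eq_add_of_le' hn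
  have h1 := hU.flowOp_add 1 k n hφ hM 0
  simp only [mul_one] at h1
  have hL := hU.lipschitzWith_flowOp n hφ
  rw [h1]
  have h2 : flowOp U n φ 0 = ∫ _ : Ω, flowOp U n φ 0 ∂P := by simp
  have hUi := integrable_lp (U 0 k)
  rw [h2, flowOp, ← integral_sub (hL.integrable_comp hUi) (integrable_const _), ← Real.norm_eq_abs]
  have hb : ∀ ω, ‖flowOp U n φ (U 0 k ω) - flowOp U n φ 0‖
      ≤ L * Real.exp (-(lam₀ - K) * (n : ℝ≥0)) * ‖U 0 k ω‖ := fun ω => by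
    have := hU.abs_flowOp_sub_le n hφ (U 0 k ω) 0
    rwa [sub_zero] at this
  refine (norm_integral_le_of_norm_le (hUi.norm.const_mul _) (ae_of_all _ hb)).trans ?_
  rw [integral_const_mul, mul_right_comm]
  gcongr
  exact hC k

/-- The laws of the flow started at `0` form a tight sequence. -/
theorem isTightMeasureSet (hU : IsFrozenFlow P ℱ α lam γ Z e A S lam₀ hp K g w U) :
    IsTightMeasureSet (Set.range fun n : ℕ => P.map (U 0 n)) := by
  have hprob : ∀ n : ℕ, IsProbabilityMeasure (P.map (U 0 n)) := fun n =>
    Measure.isProbabilityMeasure_map (Lp.memLp _).1.aemeasurable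
  obtain ⟨C, hC0, hC⟩ := hU.exists_moment_bound
  refine isTightMeasureSet_of_thickening fun δ hδ ε hε => ?_
  have hlim := tendsto_exp_decay (sub_pos.2 hU.dissipative) ((δ.toNNReal⁻¹ : ℝ≥0) * C)
  have hlim2 := (ENNReal.continuous_ofReal.tendsto 0).comp hlim
  rw [ENNReal.ofReal_zero] at hlim2
  obtain ⟨N, hN⟩ := (hlim2.eventually_lt_const hε).exists
  refine ⟨N, fun n hn F hF => ?_⟩
  set φ : H → ℝ := fun x => (thickenedIndicator hδ F x : ℝ) with hφ
  have hφL : LipschitzWith δ.toNNReal⁻¹ φ := lipschitzWith_coe_thickenedIndicator hδ F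
  have key := hU.abs_flowOp_add_sub_le hC hφL (abs_thickenedIndicator_le hδ F) hn
  have hflow : ∀ k : ℕ, ENNReal.ofReal (flowOp U k φ 0)
      = ∫⁻ x, (thickenedIndicator hδ F x : ℝ≥0∞) ∂(P.map (U 0 k)) := fun k => by
    rw [flowOp, ← integral_map (Lp.memLp _).1.aemeasurable hφL.continuous.aestronglyMeasurable,
      lintegral_coe_eq_integral _ (integrable_thickenedIndicator F hδ)]
  have h1 : P.map (U 0 N) F ≤ ENNReal.ofReal (flowOp U N φ 0) := by
    rw [hflow]
    exact measure_le_lintegral_thickenedIndicator _ hF.measurableSet hδ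
  have h2 : ENNReal.ofReal (flowOp U n φ 0) ≤ P.map (U 0 n) (Metric.thickening δ F) := by
    rw [hflow, ← lintegral_indicator_one Metric.isOpen_thickening.measurableSet]
    refine lintegral_mono fun x => ?_
    by_cases hx : x ∈ Metric.thickening δ F
    · rw [Set.indicator_of_mem hx, Pi.one_apply]
      exact ENNReal.coe_le_one_iff.2 (thickenedIndicator_le_one hδ F x)
    · rw [thickenedIndicator_zero hδ F hx]
      simp
  have h3 := (abs_sub_le_iff.1 key).2
  have h4 : flowOp U N φ 0 ≤ flowOp U n φ 0
      + (δ.toNNReal⁻¹ : ℝ≥0) * C * Real.exp (-(lam₀ - K) * (N : ℝ≥0)) := by linarith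
  refine h1.trans ((ENNReal.ofReal_le_ofReal h4).trans (ENNReal.ofReal_add_le.trans ?_))
  exact add_le_add h2 hN.le

/-- There is a probability measure to which the averages of bounded Lipschitz functions converge. -/
theorem exists_limit_measure (hU : IsFrozenFlow P ℱ α lam γ Z e A S lam₀ hp K g w U) :
    ∃ ν : Measure H, IsProbabilityMeasure ν ∧ ∀ (φ : H → ℝ) (L : ℝ≥0) (M : ℝ), LipschitzWith L φ →
      (∀ y, |φ y| ≤ M) → ∀ y, Tendsto (fun n : ℕ => flowOp U n φ y) atTop (𝓝 (∫ z, φ z ∂ν)) := by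
  have hprob : ∀ n : ℕ, IsProbabilityMeasure (P.map (U 0 n)) := fun n =>
    Measure.isProbabilityMeasure_map (Lp.memLp _).1.aemeasurable
  obtain ⟨C, hC0, hC⟩ := hU.exists_moment_bound
  set μ : ℕ → ProbabilityMeasure H := fun n => ⟨P.map (U 0 n), hprob n⟩ with hμ
  have htight : IsTightMeasureSet {((ρ : ProbabilityMeasure H) : Measure H) | ρ ∈ Set.range μ} := by
    refine hU.isTightMeasureSet.subset ?_
    rintro _ ⟨_, ⟨n, rfl⟩, rfl⟩
    exact ⟨n, rfl⟩
  obtain ⟨ν, -, sub, hsub, hlim⟩ := (isCompact_closure_of_isTightMeasureSet htight).isSeqCompact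
    fun n => subset_closure (Set.mem_range_self n)
  refine ⟨ν, inferInstance, fun φ L M hφ hM y => ?_⟩
  have hflow : ∀ k : ℕ, flowOp U k φ 0 = ∫ x, φ x ∂(μ k : Measure H) := fun k =>
    (integral_map (Lp.memLp _).1.aemeasurable hφ.continuous.aestronglyMeasurable).symm
  have h1 : Tendsto (fun k => flowOp U (sub k) φ 0) atTop (𝓝 (∫ z, φ z ∂ν)) := by
    have := (ProbabilityMeasure.tendsto_iff_forall_integral_tendsto.1 hlim)
      (BoundedContinuousFunction.ofNormedAddCommGroup φ hφ.continuous M hM)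
    refine this.congr fun k => ?_
    rw [hflow]
    rfl
  have h2 : ∀ n : ℕ, |∫ z, φ z ∂ν - flowOp U n φ 0|
      ≤ L * C * Real.exp (-(lam₀ - K) * (n : ℝ≥0)) := fun n => by
    refine le_of_tendsto (h1.sub_const _).abs (eventually_atTop.2 ⟨n, fun k hk => ?_⟩)
    exact hU.abs_flowOp_add_sub_le hC hφ hM (hk.trans (hsub.le_apply))
  rw [tendsto_iff_norm_sub_tendsto_zero]
  refine squeeze_zero (fun _ => norm_nonneg _) (fun n => ?_)
    (tendsto_exp_decay (sub_pos.2 hU.dissipative) (L * ‖y - 0‖ + L * C))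
  have h3 := hU.abs_flowOp_sub_le n hφ y 0
  have h4 := abs_sub_le (flowOp U n φ y) (flowOp U n φ 0) (∫ z, φ z ∂ν)
  rw [abs_sub_comm (flowOp U n φ 0)] at h4
  rw [Real.norm_eq_abs]
  refine h4.trans ((add_le_add h3 (h2 n)).trans_eq ?_)
  ring

/-- The limit measure is invariant, tested on bounded Lipschitz functions. -/
theorem integral_flowOp_of_lipschitz (hU : IsFrozenFlow P ℱ α lam γ Z e A S lam₀ hp K g w U)
    {ν : Measure H} [IsProbabilityMeasure ν]
    (hν : ∀ (φ : H → ℝ) (L : ℝ≥0) (M : ℝ), LipschitzWith L φ → (∀ y, |φ y| ≤ M) →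
      ∀ y, Tendsto (fun n : ℕ => flowOp U n φ y) atTop (𝓝 (∫ z, φ z ∂ν)))
    {φ : H → ℝ} {L : ℝ≥0} (hφ : LipschitzWith L φ) {M : ℝ} (hM : ∀ y, |φ y| ≤ M) (t : ℝ≥0) :
    ∫ y, flowOp U t φ y ∂ν = ∫ y, φ y ∂ν := by
  -- at a rational time `s`, let `n → ∞` in `P_n P_s φ (0) = P_s P_n φ (0)`
  have hrat : ∀ a b : ℕ, ∫ y, flowOp U (a * (1 / (b + 1 : ℕ))) φ y ∂ν = ∫ y, φ y ∂ν := by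
    intro a b
    set h : ℝ≥0 := 1 / (b + 1 : ℕ) with hh
    have h1 := hν (flowOp U (a * h) φ) L M (hU.lipschitzWith_flowOp _ hφ) (abs_flowOp_le _ hM) 0
    have h2 : ∀ n : ℕ, flowOp U n (flowOp U (a * h) φ) 0 = ∫ ω,
        flowOp U n φ (U 0 (a * h) ω) ∂P := by
      intro n
      have hn : ((n * (b + 1) : ℕ) : ℝ≥0) * h = n := by
        rw [hh]
        push_cast
        field_simp
      have e1 := hU.flowOp_add h (n * (b + 1)) a hφ hM 0
      have e2 := hU.flowOp_add h a (n * (b + 1)) hφ hM 0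
      rw [hn] at e1 e2
      rw [← e1, Nat.add_comm, e2]
      rfl
    simp_rw [h2] at h1
    have h3 : Tendsto (fun n : ℕ => ∫ ω, flowOp U n φ (U 0 (a * h) ω) ∂P) atTop
        (𝓝 (∫ _ : Ω, (∫ z, φ z ∂ν) ∂P)) := by
      refine tendsto_integral_of_dominated_convergence (fun _ => M) (fun n => ?_)
        (integrable_const M) (fun n => ae_of_all _ fun ω => abs_flowOp_le _ hM _)
        (ae_of_all _ fun ω => hν φ L M hφ hM _)
      exact (hU.lipschitzWith_flowOp n hφ).continuous.comp_aestronglyMeasurable (Lp.memLp _).1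
    have h4 := tendsto_nhds_unique h1 h3
    simpa using h4
  -- approximate `t` by rational times
  set τ : ℕ → ℝ≥0 := fun b => (⌊t * (b + 1 : ℕ)⌋₊ : ℕ) * (1 / (b + 1 : ℕ)) with hτ
  have hτlim : Tendsto τ atTop (𝓝 t) := by
    have h1 : Tendsto (fun b : ℕ => ((b + 1 : ℕ) : ℝ)) atTop atTop :=
      tendsto_natCast_atTop_atTop.comp (tendsto_add_atTop_nat 1)
    rw [← NNReal.tendsto_coe]
    refine ((tendsto_nat_floor_mul_div_atTop t.coe_nonneg).comp h1).congr fun b => ?_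
    have hfl : ⌊t * ((b : ℝ≥0) + 1)⌋₊ = ⌊(t : ℝ) * ((b : ℝ) + 1)⌋₊ := rfl
    simp [hτ, div_eq_mul_inv, hfl]
  have hlim : Tendsto (fun b => ∫ y, flowOp U (τ b) φ y ∂ν) atTop (𝓝 (∫ y, flowOp U t φ y ∂ν)) := by
    refine tendsto_integral_of_dominated_convergence (fun _ => M) (fun n => ?_)
      (integrable_const M) (fun n => ae_of_all _ fun y => abs_flowOp_le _ hM _)
      (ae_of_all _ fun y => ?_)
    · exact (hU.lipschitzWith_flowOp _ hφ).continuous.aestronglyMeasurable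
    · have hc := (((hU.curve y).continuous.tendsto t).comp hτlim)
      rw [tendsto_iff_norm_sub_tendsto_zero] at hc ⊢
      refine squeeze_zero (fun _ => norm_nonneg _) (fun b => ?_)
        (by simpa using hc.const_mul (L : ℝ))
      have := norm_integral_comp_sub_le (c := 0) hφ hφ L.coe_nonneg (fun a b => by
        simpa using hφ.norm_sub_le a b) (U y (τ b)) (U y t)
      rwa [zero_add] at this
  refine tendsto_nhds_unique hlim ?_
  simp_rw [hτ, hrat]
  exact tendsto_const_nhds

/-- The frozen equation has exactly one invariant probability measure, the limit of its laws. -/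
theorem exists_invariant (hU : IsFrozenFlow P ℱ α lam γ Z e A S lam₀ hp K g w U) :
    ∃ ν : Measure H, (∀ ρ, IsInvariantMeasure (flowOp U) ρ ↔ ρ = ν) ∧ IsProbabilityMeasure ν ∧
      ∀ (φ : H → ℝ) (L : ℝ≥0) (M : ℝ), LipschitzWith L φ →
        (∀ y, |φ y| ≤ M) → ∀ y, Tendsto (fun n : ℕ => flowOp U n φ y) atTop (𝓝 (∫ z, φ z ∂ν)) := by
  obtain ⟨ν, hνp, hν⟩ := hU.exists_limit_measure
  refine ⟨ν, fun ρ => ⟨fun hρ => ?_, ?_⟩, hνp, hν⟩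
  · have := hρ.1
    refine Measure.ext_of_lipschitz fun φ L M hφ hM => ?_
    have h1 : Tendsto (fun n : ℕ => ∫ y, flowOp U n φ y ∂ρ) atTop
        (𝓝 (∫ _ : H, (∫ z, φ z ∂ν) ∂ρ)) := by
      refine tendsto_integral_of_dominated_convergence (fun _ => M) (fun n => ?_)
        (integrable_const M) (fun n => ae_of_all _ fun y => abs_flowOp_le _ hM _)
        (ae_of_all _ fun y => hν φ L M hφ hM y)
      exact (hU.lipschitzWith_flowOp _ hφ).continuous.aestronglyMeasurable
    simp_rw [hρ.2 _ φ hφ.continuous.measurable ⟨M, hM⟩] at h1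
    simpa using tendsto_nhds_unique tendsto_const_nhds h1
  · rintro rfl
    refine ⟨hνp, fun t φ hφ ⟨M, hM⟩ => ?_⟩
    have hprob : ∀ y, IsProbabilityMeasure (P.map (U y t)) := fun n =>
      Measure.isProbabilityMeasure_map (Lp.memLp _).1.aemeasurable
    have hflow : ∀ {ψ : H → ℝ}, Measurable ψ → ∀ y, flowOp U t ψ y = ∫ x, ψ x ∂(P.map (U y t)) :=
      fun hψ y => (integral_map (Lp.memLp _).1.aemeasurable hψ.aestronglyMeasurable).symm
    -- the laws form a Markov kernel `κ`; `ρ` and `η = ρ κ` agree on bounded Lipschitz functions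
    have hκm : Measurable fun y => P.map (U y t) := measurable_of_lipschitz fun ψ L M hψ hM => by
      simp_rw [← hflow hψ.continuous.measurable]
      exact (hU.lipschitzWith_flowOp t hψ).continuous.measurable
    set κ : Kernel H H := ⟨fun y => P.map (U y t), hκm⟩ with hκ
    have : IsMarkovKernel κ := ⟨hprob⟩
    set η : Measure H := (κ ∘ₖ Kernel.const Unit ρ) () with hη
    have hint : ∀ {ψ : H → ℝ} {M : ℝ}, Measurable ψ → (∀ y, |ψ y| ≤ M) →
        ∫ y, ψ y ∂η = ∫ y, flowOp U t ψ y ∂ρ := fun {ψ M} hψ hM => by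
      rw [hη, Kernel.integral_comp (Integrable.of_bound hψ.aestronglyMeasurable M
        (ae_of_all _ hM)), Kernel.const_apply]
      simp_rw [hflow hψ]
      rfl
    have hηρ : η = ρ := Measure.ext_of_lipschitz fun ψ L M hψ hM => by
      rw [hint hψ.continuous.measurable hM, hU.integral_flowOp_of_lipschitz hν hψ hM]
    rw [← hint hφ hM, hηρ]

end IsFrozenFlow

end InvariantMeasure

/-! ### Well-posedness and passage to the limit in averages -/

section AveragedEquation

theorem HilbertBasis.secondCountableTopology {H : Type*} [NormedAddCommGroup H]
    [InnerProductSpace ℝ H] (e : HilbertBasis ℕ ℝ H) : SecondCountableTopology H := by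
  have h1 : TopologicalSpace.IsSeparable (Submodule.span ℝ (Set.range e) : Set H) :=
    (Set.countable_range e).isSeparable.span
  have h2 := h1.closure
  rw [← Submodule.topologicalClosure_coe, e.dense_span, Submodule.top_coe] at h2
  have := TopologicalSpace.isSeparable_univ_iff.1 h2
  exact UniformSpace.secondCountable_of_separable H

theorem IsSemigroupGeneratedBy.isDecaySemigroup {H : Type*} [NormedAddCommGroup H]
    [InnerProductSpace ℝ H] [CompleteSpace H] {e : HilbertBasis ℕ ℝ H} {lam : ℕ → ℝ}
    {A : H →ₗ.[ℝ] H} {S : ℝ≥0 → H →L[ℝ] H} (hS : IsSemigroupGeneratedBy A S)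
    (hAe : ∀ k, (e k, -(lam k) • e k) ∈ A.graph) (hlam : Monotone lam) (h0 : 0 ≤ lam 0) :
    IsDecaySemigroup S (lam 0) :=
  ⟨hS.map_zero, hS.map_add, hS.continuous, hS.norm_apply_le hAe hlam, h0⟩

/-- For spectral parameters bounded away from `0`, summability against a power `lam ^ (-r)` with
`r ≤ 1` improves to summability against `lam⁻¹`. -/
theorem summable_div_of_summable_div_rpow {b lam : ℕ → ℝ} (hb : ∀ k, 0 ≤ b k) (h0 : 0 < lam 0)
    (hlam : Monotone lam) {r : ℝ} (hr : r ≤ 1) (h : Summable fun k => b k / lam k ^ r) :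
    Summable fun k => b k / lam k := by
  refine Summable.of_nonneg_of_le (fun k => ?_) (fun k => ?_) (h.mul_left (lam 0 ^ (r - 1)))
  · exact div_nonneg (hb k) (h0.le.trans (hlam zero_le))
  · have hk0 : lam 0 ≤ lam k := hlam zero_le
    have hk : 0 < lam k := h0.trans_le hk0
    have h1 : lam k ^ (r - 1) ≤ lam 0 ^ (r - 1) :=
      Real.rpow_le_rpow_of_nonpos h0 hk0 (by linarith)
    have h2 : b k / lam k = lam k ^ (r - 1) * (b k / lam k ^ r) := by
      rw [Real.rpow_sub_one hk.ne']
      field_simp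
    rw [h2]
    exact mul_le_mul_of_nonneg_right h1 (div_nonneg (hb k) (Real.rpow_nonneg hk.le _))

variable {Ω H : Type*} [m : MeasurableSpace Ω] {P : Measure Ω} [IsProbabilityMeasure P]
  {ℱ : Filtration ℝ≥0 m} {α : ℝ} {lam γ : ℕ → ℝ} {Z : ℕ → ℝ≥0 → Ω → ℝ}
  [NormedAddCommGroup H] [InnerProductSpace ℝ H] [CompleteSpace H] [MeasurableSpace H]
  [BorelSpace H] [SecondCountableTopology H] {e : HilbertBasis ℕ ℝ H} {A : H →ₗ.[ℝ] H}
  {S : ℝ≥0 → H →L[ℝ] H} {lam₀ p : ℝ} [Fact (1 ≤ ENNReal.ofReal p)] {K : ℝ≥0}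

/-- A mild curve in `L^p(Ω; H)` driven by the stochastic convolution and started from an
`ℱ 0`-measurable point is, up to modification, the unique mild solution. -/
theorem IsMildCurve.exists_isUniqueMildSolution (hp : 1 ≤ p) (hS : IsSemigroupGeneratedBy A S)
    (hAe : ∀ k, (e k, -(lam k) • e k) ∈ A.graph) (hD : IsDecaySemigroup S lam₀)
    (hZ : IsConvolvableNoise P ℱ α lam γ Z) {B : H → Pp H p → H} (hB : IsLipschitzCoeff K B)
    {w : ℝ≥0 → Lp H (ENNReal.ofReal p) P} (hw0 : w 0 = 0)
    (hwm : ∀ t, w t ∈ lpMeas H ℝ (ℱ t) (ENNReal.ofReal p) P)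
    (hwae : ∀ t, w t =ᵐ[P] noise e lam γ Z 0 t) {x₀ : Lp H (ENNReal.ofReal p) P}
    {x : ℝ≥0 → Lp H (ENNReal.ofReal p) P}
    (hx : IsMildCurve (fun t => (S t).compLpL (ENNReal.ofReal p) P)
      (nemytskii P (zero_lt_one.trans_le hp) hB) w x₀ x)
    (hx₀ : x₀ ∈ lpMeas H ℝ (ℱ 0) (ENNReal.ofReal p) P) {ξ : Ω → H} (hξ : x₀ =ᵐ[P] ξ) :
    ∃ X, IsUniqueMildSolution P ℱ S e p γ Z B ξ X ∧ ∀ t, X t =ᵐ[P] x t := by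
  have hp0 : 0 < p := zero_lt_one.trans_le hp
  have hxm : ∀ t, x t ∈ lpMeas H ℝ (ℱ t) (ENNReal.ofReal p) P := by
    refine IsMildCurve.mem (hD.compLpL (P := P) hp0) (lipschitzWith_nemytskii hp0 hB) hw0 hx
      (V := fun t => lpMeas H ℝ (ℱ t) (ENNReal.ofReal p) P) (fun s t hst f hf => ?_)
      (fun t => isClosed_aestronglyMeasurable (ℱ.le t)) (fun t h z hz => compLpL_mem_lpMeas hz)
      (fun t z hz => nemytskii_mem_lpMeas hp0 hB hz) hwm hx₀
    rw [mem_lpMeas_iff_aestronglyMeasurable] at hf ⊢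
    exact hf.mono (ℱ.mono hst)
  obtain ⟨X, hX, hXx⟩ := hx.exists_isMildSolution (ξ := ξ) (e := e) (β := γ) (L := Z) hp0 hD hB hxm
    (fun t => (hwae t).trans (hZ.noise_eq_stochConvolution hS hAe t)) hξ
  exact ⟨X, ⟨hX, fun X' hX' t => hX'.ae_eq hp hD hB hX t⟩, hXx⟩

/-- McKean--Vlasov equations with jointly Lipschitz coefficients are well-posed. -/
theorem IsConvolvableNoise.exists_isUniqueMildSolution (hp : 1 ≤ p) (hpα : p < α)
    (hS : IsSemigroupGeneratedBy A S) (hAe : ∀ k, (e k, -(lam k) • e k) ∈ A.graph)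
    (hD : IsDecaySemigroup S lam₀) (hZ : IsConvolvableNoise P ℱ α lam γ Z) {B : H → Pp H p → H}
    (hB : IsLipschitzCoeff K B) {ξ : Ω → H} (hξm : Measurable[ℱ 0] ξ)
    (hξ : ∫⁻ ω, ‖ξ ω‖ₑ ^ p ∂P < ∞) : ∃ X, IsUniqueMildSolution P ℱ S e p γ Z B ξ X := by
  have hp0 : 0 < p := zero_lt_one.trans_le hp
  obtain ⟨w, hwc, ⟨M, hM⟩, hw0, hwm, hwae⟩ := hZ.exists_noiseCurve (e := e) hp0 hpα
  have hξs : StronglyMeasurable[ℱ 0] ξ := hξm.stronglyMeasurable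
  have hξL : MemLp ξ (ENNReal.ofReal p) P :=
    (memLp_ofReal_iff hp0 (hξs.mono (ℱ.le 0)).aestronglyMeasurable).2 hξ
  obtain ⟨x, hx⟩ := (hD.compLpL (P := P) hp0).exists_isMildCurve (lipschitzWith_nemytskii hp0 hB)
    hwc hM (hξL.toLp ξ)
  obtain ⟨X, hX, -⟩ := hx.exists_isUniqueMildSolution hp hS hAe hD hZ hB hw0 hwm hwae
    (mem_lpMeas_iff_aestronglyMeasurable.2 ⟨ξ, hξs, hξL.coeFn_toLp⟩) hξL.coeFn_toLp
  exact ⟨X, hX⟩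

omit [SecondCountableTopology H] [BorelSpace H] [MeasurableSpace H] [CompleteSpace H] in
theorem LipschitzWith.inner_right {E : Type*} [PseudoMetricSpace E] {f : E → H}
    (hf : LipschitzWith K f) (d : H) : LipschitzWith (K * ‖d‖₊) fun x => inner ℝ (f x) d := by
  refine LipschitzWith.of_dist_le_mul fun x y => ?_
  rw [dist_eq_norm, ← inner_sub_left, NNReal.coe_mul, coe_nnnorm]
  refine (norm_inner_le_norm _ _).trans ?_
  rw [mul_right_comm, ← dist_eq_norm]
  exact mul_le_mul_of_nonneg_right (hf.dist_le_mul x y) (norm_nonneg d)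

/-- If the laws of `X n`, `Y n` converge to `ν₁`, `ν₂` when tested on bounded Lipschitz functions,
then a uniform bound for `𝔼 f₁(X n) - 𝔼 f₂(Y n)` passes to the limit. The vector-valued integrals
are tested against their own difference. -/
theorem norm_integral_sub_integral_le_of_tendsto {ν₁ ν₂ : Measure H} [IsProbabilityMeasure ν₁]
    [IsProbabilityMeasure ν₂] {f₁ f₂ : H → H} {M₁ M₂ b : ℝ} (hf₁ : LipschitzWith K f₁)
    (hf₂ : LipschitzWith K f₂) (hM₁ : ∀ y, ‖f₁ y‖ ≤ M₁) (hM₂ : ∀ y, ‖f₂ y‖ ≤ M₂)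
    {X Y : ℕ → Lp H (ENNReal.ofReal p) P}
    (hX : ∀ (φ : H → ℝ) (L : ℝ≥0) (M : ℝ), LipschitzWith L φ → (∀ y, |φ y| ≤ M) →
      Tendsto (fun n : ℕ => ∫ ω, φ (X n ω) ∂P) atTop (𝓝 (∫ z, φ z ∂ν₁)))
    (hY : ∀ (φ : H → ℝ) (L : ℝ≥0) (M : ℝ), LipschitzWith L φ → (∀ y, |φ y| ≤ M) →
      Tendsto (fun n : ℕ => ∫ ω, φ (Y n ω) ∂P) atTop (𝓝 (∫ z, φ z ∂ν₂)))
    (hb : ∀ n, ‖∫ ω, f₁ (X n ω) ∂P - ∫ ω, f₂ (Y n ω) ∂P‖ ≤ b) :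
    ‖∫ z, f₁ z ∂ν₁ - ∫ z, f₂ z ∂ν₂‖ ≤ b := by
  set d := ∫ z, f₁ z ∂ν₁ - ∫ z, f₂ z ∂ν₂ with hd
  have key : ∀ {ν : Measure H} [IsProbabilityMeasure ν] {f : H → H} {M : ℝ}
      {W : ℕ → Lp H (ENNReal.ofReal p) P}, LipschitzWith K f → (∀ y, ‖f y‖ ≤ M) →
      (∀ (φ : H → ℝ) (L : ℝ≥0) (M : ℝ), LipschitzWith L φ → (∀ y, |φ y| ≤ M) →
        Tendsto (fun n : ℕ => ∫ ω, φ (W n ω) ∂P) atTop (𝓝 (∫ z, φ z ∂ν))) →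
      Tendsto (fun n => inner ℝ (∫ ω, f (W n ω) ∂P) d) atTop (𝓝 (inner ℝ (∫ z, f z ∂ν) d)) := by
    intro ν _ f M W hf hM hW
    have h1 := hW (fun z => inner ℝ (f z) d) _ (M * ‖d‖) (hf.inner_right d) fun y =>
      (abs_real_inner_le_norm _ _).trans (mul_le_mul_of_nonneg_right (hM y) (norm_nonneg d))
    have hfi : Integrable f ν := Integrable.of_bound hf.continuous.aestronglyMeasurable M
      (ae_of_all _ hM)
    have h2 : ∫ z, inner ℝ (f z) d ∂ν = inner ℝ (∫ z, f z ∂ν) d := by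
      simp_rw [real_inner_comm d]
      rw [← integral_inner hfi d]
    have h3 : ∀ n, ∫ ω, inner ℝ (f (W n ω)) d ∂P = inner ℝ (∫ ω, f (W n ω) ∂P) d := fun n => by
      simp_rw [real_inner_comm d]
      rw [← integral_inner (hf.integrable_comp (integrable_lp (W n))) d]
    rw [h2] at h1
    exact h1.congr h3
  have hlim := (key hf₁ hM₁ hX).sub (key hf₂ hM₂ hY)
  simp_rw [← inner_sub_left] at hlim
  rw [← hd, real_inner_self_eq_norm_sq] at hlim
  have hle : ‖d‖ ^ 2 ≤ b * ‖d‖ := le_of_tendsto' hlim fun n =>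
    (real_inner_le_norm _ _).trans (mul_le_mul_of_nonneg_right (hb n) (norm_nonneg d))
  have hb0 : 0 ≤ b := (norm_nonneg _).trans (hb 0)
  by_contra! hlt
  nlinarith [norm_nonneg d]

end AveragedEquation

/-! ### Averaging -/

section FrozenEquation

variable {Ω H : Type*} [m : MeasurableSpace Ω] {P : Measure Ω} [IsProbabilityMeasure P]
  {ℱ : Filtration ℝ≥0 m} {α : ℝ} {lam γ : ℕ → ℝ} {Z : ℕ → ℝ≥0 → Ω → ℝ}
  [NormedAddCommGroup H] [InnerProductSpace ℝ H] [CompleteSpace H] [MeasurableSpace H]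
  [BorelSpace H] [SecondCountableTopology H] {e : HilbertBasis ℕ ℝ H} {A : H →ₗ.[ℝ] H}
  {S : ℝ≥0 → H →L[ℝ] H} {lam₀ p : ℝ} [Fact (1 ≤ ENNReal.ofReal p)] {hp : 0 < p} {K : ℝ≥0}

theorem exists_isFrozenFlow (hS : IsSemigroupGeneratedBy A S)
    (hAe : ∀ k, (e k, -(lam k) • e k) ∈ A.graph) (hD : IsDecaySemigroup S lam₀)
    (hZ : IsConvolvableNoise P ℱ α lam γ Z) {g : H → H} (hg : LipschitzWith K g) (hK : K < lam₀)
    {w : ℝ≥0 → Lp H (ENNReal.ofReal p) P} (hwc : Continuous w) (hwb : ∃ M, ∀ t, ‖w t‖ ≤ M)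
    (hw0 : w 0 = 0) (hwae : ∀ t, w t =ᵐ[P] noise e lam γ Z 0 t) :
    ∃ U, IsFrozenFlow P ℱ α lam γ Z e A S lam₀ hp K g w U := by
  have hgc : IsLipschitzCoeff K (fun z (_ : Pp H p) => g z) := fun x y μ ν =>
    (hg.norm_sub_le x y).trans (mul_le_mul_of_nonneg_left
      (le_add_of_nonneg_right (wassersteinDist_nonneg μ ν)) K.coe_nonneg)
  obtain ⟨M, hM⟩ := hwb
  choose U hU using fun y => (hD.compLpL (P := P) hp).exists_isMildCurve
    (lipschitzWith_nemytskii hp hgc) hwc hM (Lp.const (ENNReal.ofReal p) P y)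
  exact ⟨U, hZ, hS, hAe, hD, hg, hK, hw0, ⟨M, hM⟩, hwae, hgc, hU⟩

namespace IsFrozenFlow

variable {g₁ g₂ : H → H} {w : ℝ≥0 → Lp H (ENNReal.ofReal p) P}
  {U₁ U₂ : H → ℝ≥0 → Lp H (ENNReal.ofReal p) P}

omit [CompleteSpace H] in
/-- The frozen equation depends on its drift in a Lipschitz way, uniformly in time. -/
theorem norm_sub_le_of_drift (h₁ : IsFrozenFlow P ℱ α lam γ Z e A S lam₀ hp K g₁ w U₁)
    (h₂ : IsFrozenFlow P ℱ α lam γ Z e A S lam₀ hp K g₂ w U₂) {b : ℝ} (hb : 0 ≤ b)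
    (hg : ∀ y z, ‖g₁ y - g₂ z‖ ≤ b + K * ‖y - z‖) (y : H) (t : ℝ≥0) :
    ‖U₁ y t - U₂ y t‖ ≤ b / (lam₀ - K) := by
  have := IsMildCurve.norm_sub_le (h₁.decay.compLpL (P := P) hp) h₁.lipschitzWith_drift.continuous
    h₂.lipschitzWith_drift.continuous K.coe_nonneg h₁.dissipative hb
    (fun X Y => norm_nemytskii_sub_le hp h₁.drift_lipschitz h₂.drift_lipschitz hb K.coe_nonneg hg)
    (h₁.curve y) (h₂.curve y) t
  rwa [sub_self, norm_zero, mul_zero, zero_add] at this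

end IsFrozenFlow

end FrozenEquation

theorem theorem3p8
    {H : Type*} [NormedAddCommGroup H] [InnerProductSpace ℝ H] [CompleteSpace H]
    [MeasurableSpace H] [BorelSpace H]
    {Ω : Type*} [m : MeasurableSpace Ω] (P : Measure Ω) [IsProbabilityMeasure P]
    (ℱ : Filtration ℝ≥0 m)
    -- the operator `A`, its eigenbasis and eigenvalues, and the semigroup `S t = e^{tA}`
    (e : HilbertBasis ℕ ℝ H) (lam : ℕ → ℝ) (A : H →ₗ.[ℝ] H) (S : ℝ≥0 → H →L[ℝ] H)
    (hA : IsSelfAdjoint A) (hAe : ∀ k, (e k, -(lam k) • e k) ∈ A.graph)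
    (hlam_pos : ∀ k, 0 < lam k) (hlam_mono : Monotone lam) (hlam_top : Tendsto lam atTop atTop)
    (hS : IsSemigroupGeneratedBy A S)
    -- the two independent cylindrical `α`-stable processes
    (α : ℝ) (hα : 1 < α ∧ α < 2)
    (β γ : ℕ → ℝ) (hβ : ∀ k, 0 < β k) (hγ : ∀ k, 0 < γ k)
    (L Z : ℕ → ℝ≥0 → Ω → ℝ)
    (hL : IsCylindricalStable P ℱ α L) (hZ : IsCylindricalStable P ℱ α Z)
    (hLZ : IndepFun (fun (ω : Ω) (k : ℕ) (t : ℝ≥0) => L k t ω)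
      (fun (ω : Ω) (k : ℕ) (t : ℝ≥0) => Z k t ω) P)
    -- the coefficients
    (p : ℝ) (hp : 1 ≤ p ∧ p < α) (F G : H → Pp H p → H → H)
    (C LG : ℝ) (hC : 0 < C) (hLG : 0 < LG)
    (hF : ∀ x₁ x₂ μ₁ μ₂ y₁ y₂, ‖F x₁ μ₁ y₁ - F x₂ μ₂ y₂‖
      ≤ C * (‖x₁ - x₂‖ + wassersteinDist μ₁ μ₂ + ‖y₁ - y₂‖))
    (hG : ∀ x₁ x₂ μ₁ μ₂ y₁ y₂, ‖G x₁ μ₁ y₁ - G x₂ μ₂ y₂‖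
      ≤ C * (‖x₁ - x₂‖ + wassersteinDist μ₁ μ₂) + LG * ‖y₁ - y₂‖)
    (hβγ : ∃ θ : ℝ, 0 < θ ∧ θ ≤ 2 / α ∧
      Summable (fun k => β k ^ α / lam k ^ (1 - α * θ / 2)) ∧
      Summable (fun k => γ k ^ α / lam k))
    (hdiss : 0 < lam 0 - LG)
    (hFbdd : ∃ C' : ℝ, 0 < C' ∧ ∀ x μ y, ‖F x μ y‖ ≤ C' * (1 + μ.momentNorm)) :
    ∃ (Y : H → Pp H p → H → ℝ≥0 → Ω → H) (ν : H → Pp H p → Measure H),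
      -- `Y x μ y` is the unique mild solution of the frozen equation started at `y`
      (∀ x μ y, IsUniqueMildSolution P ℱ S e p γ Z (fun z _ => G x μ z) (fun _ => y) (Y x μ y)) ∧
      -- `ν x μ` is the unique invariant probability measure of the frozen equation
      (∀ x μ (ρ : Measure H), IsInvariantMeasure (transitionOp P (Y x μ)) ρ ↔ ρ = ν x μ) ∧
      -- the averaged coefficient is well defined and Lipschitz
      (∀ x μ, Integrable (F x μ) (ν x μ)) ∧
      (∃ K : ℝ, 0 < K ∧ ∀ x₁ x₂ μ₁ μ₂, ‖averagedCoeff F ν x₁ μ₁ - averagedCoeff F ν x₂ μ₂‖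
        ≤ K * (‖x₁ - x₂‖ + wassersteinDist μ₁ μ₂)) ∧
      -- the averaged equation has a unique mild solution
      (∀ ξ : Ω → H, Measurable[ℱ 0] ξ → ∫⁻ ω, ‖ξ ω‖ₑ ^ p ∂P < ∞ →
        ∃ X : ℝ≥0 → Ω → H,
          IsUniqueMildSolution P ℱ S e p β L (averagedCoeff F ν) ξ X) := by
  have := e.secondCountableTopology
  have hp0 : 0 < p := zero_lt_one.trans_le hp.1
  have : Fact (1 ≤ ENNReal.ofReal p) := ⟨ENNReal.one_le_ofReal.2 hp.1⟩
  obtain ⟨θ, hθ, -, hβs, hγs⟩ := hβγ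
  obtain ⟨C', -, hFb⟩ := hFbdd
  have hD := hS.isDecaySemigroup hAe hlam_mono (hlam_pos 0).le
  have hZc : IsConvolvableNoise P ℱ α lam γ Z := ⟨hZ, hα.1, hlam_pos, fun k => (hγ k).le, hγs⟩
  have hr : 1 - α * θ / 2 ≤ 1 := by
    have := mul_pos (zero_lt_one.trans hα.1) hθ
    linarith
  have hLc : IsConvolvableNoise P ℱ α lam β L := ⟨hL, hα.1, hlam_pos, fun k => (hβ k).le,
    summable_div_of_summable_div_rpow (fun k => Real.rpow_nonneg (hβ k).le α) (hlam_pos 0) hlam_mono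
      hr hβs⟩
  obtain ⟨w, hwc, hwb, hw0, hwm, hwae⟩ := hZc.exists_noiseCurve (e := e) hp0 hp.2
  lift LG to ℝ≥0 using hLG.le
  lift C to ℝ≥0 using hC.le
  have hKl : (LG : ℝ) < lam 0 := by linarith
  have hGl : ∀ x μ, LipschitzWith LG (G x μ) := fun x μ => LipschitzWith.of_dist_le_mul fun y z =>
      by
    have := hG x x μ μ y z
    rwa [sub_self, norm_zero, wassersteinDist_self hp0, add_zero, mul_zero, zero_add,
      ← dist_eq_norm, ← dist_eq_norm] at this
  have hFl : ∀ x μ, LipschitzWith C (F x μ) := fun x μ => LipschitzWith.of_dist_le_mul fun y z => by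
    have := hF x x μ μ y z
    rwa [sub_self, norm_zero, wassersteinDist_self hp0, add_zero, zero_add,
      ← dist_eq_norm, ← dist_eq_norm] at this
  -- the same noise curve `w` drives all frozen equations, which couples them synchronously
  choose U hU using fun x μ => exists_isFrozenFlow (hp := hp0) hS hAe hD hZc
      (hGl x μ) hKl hwc hwb hw0
    hwae
  have hY := fun x μ y => ((hU x μ).curve y).exists_isUniqueMildSolution hp.1 hS hAe hD hZc
    (hU x μ).drift_lipschitz hw0 hwm hwae (mem_lpMeas_iff_aestronglyMeasurable.2
      ⟨fun _ => y, stronglyMeasurable_const, Lp.coeFn_const _ P y⟩) (Lp.coeFn_const _ P y)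
  choose Y hYs hYU using hY
  choose ν hν hνp hνlim using fun x μ => (hU x μ).exists_invariant
  have htrans : ∀ x μ, transitionOp P (Y x μ) = flowOp (U x μ) := fun x μ => by
    funext t φ y
    refine integral_congr_ae ?_
    filter_upwards [hYU x μ y t] with ω hω
    rw [hω]
  set K : ℝ≥0 := C + C * (C / (lam 0 - LG).toNNReal) with hK
  have hKeq : (K : ℝ) = C + C * (C / (lam 0 - LG)) := by
    rw [hK]
    push_cast
    rw [Real.coe_toNNReal _ hdiss.le]
  have hFavg : IsLipschitzCoeff K (averagedCoeff F ν) := fun x₁ x₂ μ₁ μ₂ => by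
    have := hνp x₁ μ₁
    have := hνp x₂ μ₂
    set D := ‖x₁ - x₂‖ + wassersteinDist μ₁ μ₂ with hDdef
    have hD0 : 0 ≤ D := add_nonneg (norm_nonneg _) (wassersteinDist_nonneg _ _)
    refine norm_integral_sub_integral_le_of_tendsto (hFl x₁ μ₁) (hFl x₂ μ₂) (hFb x₁ μ₁) (hFb x₂ μ₂)
      (X := fun n => U x₁ μ₁ 0 n) (Y := fun n => U x₂ μ₂ 0 n)
      (fun φ L M h h' => hνlim x₁ μ₁ φ L M h h' 0) (fun φ L M h h' => hνlim x₂ μ₂ φ L M h h' 0)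
      fun n => ?_
    have h1 := (hU x₁ μ₁).norm_sub_le_of_drift (hU x₂ μ₂) (mul_nonneg C.coe_nonneg hD0)
      (fun y z => hG x₁ x₂ μ₁ μ₂ y z) 0 n
    have h2 := norm_integral_comp_sub_le (c := C * D) (hFl x₁ μ₁) (hFl x₂ μ₂) C.coe_nonneg
      (fun y z => (hF x₁ x₂ μ₁ μ₂ y z).trans_eq (mul_add _ _ _)) (U x₁ μ₁ 0 n) (U x₂ μ₂ 0 n)
    refine h2.trans ((add_le_add_right (mul_le_mul_of_nonneg_left h1 C.coe_nonneg) _).trans_eq ?_)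
    rw [hKeq]
    ring
  have hKpos : (0 : ℝ) < K := by
    rw [hKeq]
    positivity
  refine ⟨Y, ν, hYs, fun x μ ρ => ?_, fun x μ => ?_, ⟨K, hKpos, fun x₁ x₂ => hFavg x₁ x₂⟩,
    fun ξ hξm hξ => hLc.exists_isUniqueMildSolution hp.1 hp.2 hS hAe hD hFavg hξm hξ⟩
  · rw [htrans]
    exact hν x μ ρ
  · have := hνp x μ
    exact Integrable.of_bound (hFl x μ).continuous.aestronglyMeasurable _ (ae_of_all _ (hFb x μ))
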